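/- **Setting.** Let $1<q\le\infty$, $\frac1p+\frac1q=1$, and $N\in\mathbb N$. The state space is $\mathbb R$, the action space $A$ is a Borel space, the disturbance space $\mathcal Z$ is a measurable space. For $n=0,\dots,N-1$: $D_n\subseteq\mathbb R\times A$ is measurable and contains the graph of a measurable map, $D_n(x)=\{a:(x,a)\in D_n\}$; $T_n:D_n\times\mathcal Z\to\mathbb R$ is measurable; $c_n:D_n\times\mathbb R\to\mathbb R$ and $c_N:\mathbb R\to\mathbb R$ are cost functions; $Z_{n+1}$ is the identity on the separable, atomless probability space $(\mathcal Z,\mathfrak Z,\mathbb P_{n+1})$ (atomless: every set of positive measure can be split into two sets of positive measure); $\mathcal Q^d_{n+1}\subseteq L^q(\mathbb P_{n+1})$ is a non-empty set of probability densities, with $\mathcal Q_{n+1}=\{Y\,d\mathbb P_{n+1}:Y\in\mathcal Q^d_{n+1}\}$, carrying the Borel $\sigma$-algebra of $\sigma(L^q,L^p)$. The controller uses randomized history-dependent policies $\pi\in\Pi^R$ with $\pi_n(D_n(x_n)|h_n)=1$; nature, knowing the action, answers with measurable maps $\gamma_n:(h_n,a_n)\mapsto\gamma_n(h_n,a_n)\in\mathcal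 Q_{n+1}$ ($\gamma\in\Gamma$); $x_{n+1}=T_n(x_n,a_n,z_{n+1})$ with $z_{n+1}\sim\gamma_n(h_n,a_n)$. Put $V_{n\pi\gamma}(h_n)=\mathbb E^{\pi\gamma}_{nh_n}\big[\sum_{k=n}^{N-1}c_k(X_k,A_k,X_{k+1})+c_N(X_N)\big]$, $V_{n\pi}=\sup_{\gamma\in\Gamma}V_{n\pi\gamma}$ and $V_n=\inf_{\pi\in\Pi^R}V_{n\pi}$. $\Pi^M,\Gamma^M$ are the deterministic Markov policies, $J_n(x)=\inf_{\pi\in\Pi^M}\sup_{\gamma\in\Gamma^M}J_{n\pi\gamma}(x)$ the Markovian value function, and $L_nv(x,a,\mathbb Q)=\int c_n(x,a,T_n(x,a,z))+v(T_n(x,a,z))\,\mathbb Q(dz)$. **Assumptions.** (A1) There are $\alpha,\underline\epsilon,\bar\epsilon\ge0$, $\underline\epsilon+\bar\epsilon=1$, $\alpha\ne1$, and measurable $\underline b:\mathbb R\to(-\infty,-\underline\epsilon]$, $\bar b:\mathbb R\to[\bar\epsilon,\infty)$ with $\underline b\le c_N\le\bar b$ such that for all $n<N$, $\mathbb Q\in\mathcal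 Q_{n+1}$, $(x,a)\in D_n$, writing $T=T_n(x,a,Z_{n+1})$: $\mathbb E^{\mathbb Q}[-c_n^-(x,a,T)]\ge\underline b(x)$, $\mathbb E^{\mathbb Q}[\underline b(T)]\ge\alpha\underline b(x)$, $\mathbb E^{\mathbb Q}[c_n^+(x,a,T)]\le\bar b(x)$, $\mathbb E^{\mathbb Q}[\bar b(T)]\le\alpha\bar b(x)$. Every point of $D_n$ has a neighbourhood such that $|c_n(x,a,T_n(x,a,z))|$ and $(\bar b-\underline b)(T_n(x,a,z))$ are, for $(x,a)\in D_n$ in it and all $z$, bounded by functions of $z$ in $L^p(\mathbb P_{n+1})$. The sets $\mathcal Q^d_{n+1}$ are uniformly norm bounded in $L^q$. (A2) $D_n(x)$ is compact, decreasing in $x$, and upper semicontinuous (if $x_k\to x$ and $a_k\in D_n(x_k)$, then $(a_k)$ has an accumulation point in $D_n(x)$); $T_n$ is lower semicontinuous in $(x,a)$ and increasing in $x$; $c_n$ and $c_N$ are lower semicontinuous, $c_n$ is increasing in $(x,x')$ and $c_N$ is increasing. (A3) For every $n<N$, $\mathcal Q^d_{n+1}$ is law invariant ($Y_1\in\mathcal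 Q^d_{n+1}$, $Y_2\in L^q$, $Y_2\sim Y_1$ imply $Y_2\in\mathcal Q^d_{n+1}$) and has a greatest element $Y^*_{n+1}$ in convex order, i.e. $Y^*_{n+1}\in\mathcal Q^d_{n+1}$ and $Y\le_{cx}Y^*_{n+1}$ for all $Y\in\mathcal Q^d_{n+1}$. Write $q_X^-(u)=\inf\{x:F_X(x)\ge u\}$, $q_X^+(u)=\inf\{x:F_X(x)>u\}$, and $\phi_{n+1}=q^+_{Y^*_{n+1}}$. A *distributional transform* of $X$ is a random variable $U_X\sim\mathcal U(0,1)$ with $q_X^-(U_X)=q_X^+(U_X)=X$ a.s. A Markov policy $\gamma$ of nature is called *optimal* if (1) $\gamma_n(x,a)$ attains $\sup_{\mathbb Q\in\mathcal Q_{n+1}}L_nJ_{n+1}(x,a,\mathbb Q)$ for all $n<N$, $(x,a)\in D_n$; (2) $\inf_{\pi\in\Pi^R}V_{n\pi\gamma}=V_n$ for all $n\le N$; (3) some $\pi\in\Pi^M$ satisfies $V_{n\pi\gamma}=V_{n\pi}=V_n$ for all $n\le N$. **Lemma.** a) For each $n<N$, $\phi_{n+1}$ is a spectrum (on $[0,1)$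 it is non-negative, increasing and right-continuous, and $\int_0^1\phi_{n+1}(u)\,du=1$), and $$\sup_{Y\in\mathcal Q^d_{n+1}}\mathbb E[XY]=\rho_{\phi_{n+1}}(X):=\int_0^1q^-_X(u)\phi_{n+1}(u)\,du\in\mathbb R,\qquad X\in L^p(\mathbb P_{n+1}),$$ a spectral, in particular coherent, risk measure. Moreover $V_n(h_n)=J_n(x_n)$ for $n\le N$ and $$J_n(x)=\inf_{a\in D_n(x)}\rho_{\phi_{n+1}}\big(c_n(x,a,T_n(x,a,Z_{n+1}))+J_{n+1}(T_n(x,a,Z_{n+1}))\big),\qquad n<N.$$ There is a Markov policy $\gamma$ of nature such that for all $n<N$ and $(x,a)\in D_n$ the density of $\gamma_n(x,a)$ is $\phi_{n+1}(U)$ for some distributional transform $U$ of $T_n(x,a,Z_{n+1})$, and every such Markov policy of nature is optimal. b) Suppose in addition that $\mathcal Z=\mathbb R$ and that $z\mapsto T_n(x,a,z)$ is increasing and lower semicontinuous for all $n<N$, $(x,a)\in D_n$. Then distributional transforms $U_{Z_{n+1}}$ of $Z_{n+1}$ exist, and for every choice of them $\phi_{n+1}(U_{Z_{n+1}})\in\mathcal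 Q^d_{n+1}$ and the constant policy $\gamma_n\equiv\phi_{n+1}(U_{Z_{n+1}})$ of nature is optimal. With $d\mathbb Q^*_{n+1}=\phi_{n+1}(U_{Z_{n+1}})\,d\mathbb P_{n+1}$, the robust problem becomes the risk-neutral MDP with independent disturbances $Z_{n+1}\sim\mathbb Q^*_{n+1}$: for all $n\le N$, $V_n$ is the infimum over $\Pi^R$, and also over $\Pi^M$, of the expected cost from time $n$ on in that MDP, and a policy in $\Pi^M$ is optimal at all stages in the MDP iff it is optimal at all stages in the robust problem. Equivalently, it is the minimization of a coherent risk measure: $V_n(h_n)=\inf_{\pi\in\Pi^M}\sup_{\mathbb Q\in\mathfrak Q}\mathbb E^{\pi,\mathbb Q}_{nh_n}\big[\sum_{k=n}^{N-1}c_k(X_k,A_k,X_{k+1})+c_N(X_N)\big]$, where $\mathfrak Q$ is the set of product probability measures $\bigotimes_{n<N}Y_{n+1}d\mathbb P_{n+1}$ with $0\le Y_{n+1}\in L^q(\mathbb P_{n+1})$ and $Y_{n+1}\le_{cx}\phi_{n+1}(U_{Z_{n+1}})$. -/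

import Mathlib

open MeasureTheory ProbabilityTheory Set Filter Topology
open scoped ENNReal NNReal

noncomputable section

namespace RobustMDP

/-! ### Quantiles, spectral risk measures, convex order -/

/-- `q⁻(α) = inf {x | F(x) ≥ α}` for the distribution function `F` of the law `ν`. -/
def lowerQuantile (ν : Measure ℝ) (α : ℝ) : ℝ := sInf {x : ℝ | α ≤ cdf ν x}

/-- `q⁺(α) = inf {x | F(x) > α}` for the distribution function `F` of the law `ν`. -/
def upperQuantile (ν : Measure ℝ) (α : ℝ) : ℝ := sInf {x : ℝ | α < cdf ν x}

/-- Spectra. The value at the right end point `1` is irrelevant (and may be infinite for an upper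
quantile function), so the conditions are imposed on `[0,1)`. -/
structure IsSpectrum (φ : ℝ → ℝ) : Prop where
  nonneg : ∀ u ∈ Ico (0 : ℝ) 1, 0 ≤ φ u
  mono : MonotoneOn φ (Ico 0 1)
  rightCont : ∀ u ∈ Ico (0 : ℝ) 1, ContinuousWithinAt φ (Ici u) u
  integrable : IntegrableOn φ (Ioo 0 1)
  integral_eq_one : ∫ u in Ioo (0 : ℝ) 1, φ u = 1

section Probability

variable {Ω : Type*} [MeasurableSpace Ω]

/-- `ρ_φ(X) = ∫₀¹ q_X(u) φ(u) du`. -/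
def spectralRisk (φ : ℝ → ℝ) (μ : Measure Ω) (X : Ω → ℝ) : ℝ :=
  ∫ u in Ioo (0 : ℝ) 1, lowerQuantile (μ.map X) u * φ u

/-- Coherent risk measures on `L^p` (large values of `X` are bad). -/
structure IsCoherent {p : ℝ≥0∞} {μ : Measure Ω} [IsFiniteMeasure μ] (ρ : Lp ℝ p μ → ℝ) :
    Prop where
  monotone : ∀ X Y : Lp ℝ p μ, X ≤ Y → ρ X ≤ ρ Y
  translation : ∀ (X : Lp ℝ p μ) (m : ℝ), ρ (X + Lp.const p μ m) = ρ X + m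
  posHomogeneous : ∀ (X : Lp ℝ p μ) (t : ℝ), 0 ≤ t → ρ (t • X) = t * ρ X
  subadditive : ∀ X Y : Lp ℝ p μ, ρ (X + Y) ≤ ρ X + ρ Y

/-- The probability space has no atoms: every set of positive measure can be split. (This is not
Mathlib's `NoAtoms`, which only speaks about points.) -/
def Atomless (μ : Measure Ω) : Prop :=
  ∀ s, MeasurableSet s → 0 < μ s → ∃ t, t ⊆ s ∧ MeasurableSet t ∧ 0 < μ t ∧ μ t < μ s

/-- `U` is a (generalized) distributional transform of `X`: it is uniform on `(0,1)` and
`q⁻_X(U) = q⁺_X(U) = X` almost surely. -/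
structure IsDistribTransform (μ : Measure Ω) (X U : Ω → ℝ) : Prop where
  measurable : Measurable U
  uniform : μ.map U = (volume : Measure ℝ).restrict (Ioo 0 1)
  quantile : ∀ᵐ ω ∂μ, lowerQuantile (μ.map X) (U ω) = X ω ∧ upperQuantile (μ.map X) (U ω) = X ω

/-- Convex order: `E f(X) ≤ E f(Y)` for all convex `f` for which both expectations exist. -/
def ConvexOrderLE (μ : Measure Ω) (X Y : Ω → ℝ) : Prop :=
  ∀ f : ℝ → ℝ, ConvexOn ℝ univ f → Integrable (fun ω => f (X ω)) μ →
    Integrable (fun ω => f (Y ω)) μ → ∫ ω, f (X ω) ∂μ ≤ ∫ ω, f (Y ω) ∂μ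

/-- Densities of probability measures with respect to `μ`. -/
def IsDensity (μ : Measure Ω) (Y : Ω → ℝ) : Prop := 0 ≤ᵐ[μ] Y ∧ ∫ ω, Y ω ∂μ = 1

/-- The measure `Y dμ`. -/
def densMeasure (μ : Measure Ω) (Y : Ω → ℝ) : Measure Ω :=
  μ.withDensity (fun ω => ENNReal.ofReal (Y ω))

lemma IsDensity.integrable {μ : Measure Ω} {Y : Ω → ℝ} (h : IsDensity μ Y) : Integrable Y μ := by
  by_contra hc
  have := h.2
  rw [integral_undef hc] at this
  exact zero_ne_one this

lemma IsDensity.isProbabilityMeasure {μ : Measure Ω} {Y : Ω → ℝ} (h : IsDensity μ Y) :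
    IsProbabilityMeasure (densMeasure μ Y) := by
  constructor
  rw [densMeasure, withDensity_apply _ MeasurableSet.univ, Measure.restrict_univ,
    ← ofReal_integral_eq_lintegral_ofReal h.integrable h.1, h.2, ENNReal.ofReal_one]

/-- The weak* topology `σ(L^q, L^p)` on `L^q`: the coarsest topology for which all maps
`Y ↦ ∫ X Y dμ`, `X ∈ L^p`, are continuous. -/
@[reducible] def weakStarTopology (p q : ℝ≥0∞) (μ : Measure Ω) : TopologicalSpace (Lp ℝ q μ) :=
  ⨅ X : Lp ℝ p μ, TopologicalSpace.induced (fun Y : Lp ℝ q μ => ∫ ω, X ω * Y ω ∂μ) inferInstance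

/-- The Borel σ-algebra of the weak* topology `σ(L^q, L^p)`. -/
@[reducible] def weakStarBorel (p q : ℝ≥0∞) (μ : Measure Ω) : MeasurableSpace (Lp ℝ q μ) :=
  @borel _ (weakStarTopology p q μ)

lemma measurable_pairing (p q : ℝ≥0∞) (μ : Measure Ω) (X : Lp ℝ p μ) :
    Measurable[weakStarBorel p q μ] (fun Y : Lp ℝ q μ => ∫ ω, X ω * Y ω ∂μ) := by
  let _ := weakStarTopology p q μ
  let _ : MeasurableSpace (Lp ℝ q μ) := weakStarBorel p q μ
  have : BorelSpace (Lp ℝ q μ) := ⟨rfl⟩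
  have hc : Continuous (fun Y : Lp ℝ q μ => ∫ ω, X ω * Y ω ∂μ) :=
    continuous_iInf_dom (i := X) continuous_induced_dom
  exact hc.measurable

/-- A weak*-measurable family of densities induces a stochastic kernel. -/
lemma measurable_densMeasure (p : ℝ≥0∞) {q : ℝ≥0∞} {μ : Measure Ω} [IsFiniteMeasure μ]
    {β : Type*} [MeasurableSpace β] (γ : β → Lp ℝ q μ)
    (hγ : @Measurable _ _ _ (weakStarBorel p q μ) γ) (hd : ∀ b, IsDensity μ (γ b)) :
    Measurable (fun b => densMeasure μ (γ b)) := by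
  refine Measure.measurable_of_measurable_coe _ fun B hB => ?_
  have hB' : μ B ≠ ∞ := measure_ne_top μ B
  have key : ∀ b, densMeasure μ (γ b) B
      = ENNReal.ofReal (∫ ω, (indicatorConstLp p hB hB' (1 : ℝ)) ω * (γ b) ω ∂μ) := by
    intro b
    have h1 : ∫ ω, (indicatorConstLp p hB hB' (1 : ℝ)) ω * (γ b) ω ∂μ
        = ∫ ω in B, (γ b) ω ∂μ := by
      rw [← integral_indicator hB]
      refine integral_congr_ae ?_
      filter_upwards [indicatorConstLp_coeFn (p := p) (hs := hB) (hμs := hB') (c := (1 : ℝ))]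
        with ω hω
      rw [hω]
      by_cases h : ω ∈ B <;> simp [h]
    rw [h1, densMeasure, withDensity_apply _ hB,
      ofReal_integral_eq_lintegral_ofReal (hd b).integrable.integrableOn
        (ae_restrict_of_ae (hd b).1)]
  simp_rw [key]
  exact ((measurable_pairing p q μ _).comp hγ).ennreal_ofReal

end Probability

/-! ### Histories -/

/-- The action preceding the `i`-th state: none for `i = 0`. -/
def PrevAct (A : Type*) : ℕ → Type _
  | 0 => PUnit
  | _ + 1 => A

instance instMeasurableSpacePrevAct (A : Type*) [MeasurableSpace A] :
    ∀ i, MeasurableSpace (PrevAct A i)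
  | 0 => (inferInstance : MeasurableSpace PUnit)
  | _ + 1 => (inferInstance : MeasurableSpace A)

/-- The `i`-th step of a trajectory: `x₀` for `i = 0`, and `(a_{i-1}, x_i)` for `i ≥ 1`. -/
abbrev Coord (A : Type*) (i : ℕ) : Type _ := PrevAct A i × ℝ

/-- Histories `h_n = (x₀, a₀, x₁, …, a_{n-1}, x_n)`. -/
abbrev History (A : Type*) (n : ℕ) : Type _ := (i : Finset.Iic n) → Coord A i

/-- The current state `x_n` of the history `h_n`. -/
def History.state {A : Type*} {n : ℕ} (h : History A n) : ℝ :=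
  (h ⟨n, Finset.mem_Iic.2 le_rfl⟩).2

lemma History.measurable_state {A : Type*} [MeasurableSpace A] {n : ℕ} :
    Measurable (History.state : History A n → ℝ) :=
  measurable_snd.comp (measurable_pi_apply _)

/-! ### The decision model -/

/-- The data of the distributionally robust Markov decision model with real state space, action
space `A`, disturbance space `Z` and planning horizon `N`. Only the data at the stages `n < N` and
the values of `T n` and `c n` at `(x, a) ∈ D n` matter. The probability space at stage `n` is
canonical: `P n` is the law on `Z` of the disturbance `Z_{n+1}` that leads from `x_n` to
`x_{n+1} = T n x_n a_n z_{n+1}`, and `Z_{n+1}` is the identity of `Z`. The ambiguity set of stage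
`n` is given by its set `Qd n ⊆ L^q` of densities with respect to `P n`. -/
structure Model (A Z : Type*) [MeasurableSpace A] [MeasurableSpace Z] (q : ℝ≥0∞) where
  N : ℕ
  D : ℕ → Set (ℝ × A)
  measurableSet_D : ∀ n, MeasurableSet (D n)
  exists_selector : ∀ n, ∃ d : ℝ → A, Measurable d ∧ ∀ x, (x, d x) ∈ D n
  T : ℕ → ℝ → A → Z → ℝ
  measurable_T : ∀ n, Measurable fun y : (ℝ × A) × Z => T n y.1.1 y.1.2 y.2
  c : ℕ → ℝ → A → ℝ → ℝ
  cN : ℝ → ℝ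
  P : ℕ → Measure Z
  isProbabilityMeasure_P : ∀ n, IsProbabilityMeasure (P n)
  Qd : (n : ℕ) → Set (Lp ℝ q (P n))
  isDensity_Qd : ∀ n, ∀ Y ∈ Qd n, IsDensity (P n) Y
  nonempty_Qd : ∀ n, (Qd n).Nonempty

namespace Model

variable {A Z : Type*} [MeasurableSpace A] [MeasurableSpace Z] {q : ℝ≥0∞}

instance instIsProbabilityMeasureP (M : Model A Z q) (n : ℕ) : IsProbabilityMeasure (M.P n) :=
  M.isProbabilityMeasure_P n

/-- A history is feasible if `a_k ∈ D_k(x_k)` for all `k < n`. -/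
def Feasible (M : Model A Z q) {n : ℕ} (h : History A n) : Prop :=
  ∀ (k : ℕ) (hk : k < n),
    (((h ⟨k, Finset.mem_Iic.2 hk.le⟩).2, (h ⟨k + 1, Finset.mem_Iic.2 hk⟩).1) : ℝ × A) ∈ M.D k

/-! #### Policies -/

/-- Randomized history-dependent policies of the controller (`Π^R`). -/
structure RandPolicy (M : Model A Z q) where
  ker : (n : ℕ) → Kernel (History A n) A
  isMarkov : ∀ n, IsMarkovKernel (ker n)
  admissible : ∀ n (h : History A n), M.Feasible h → ker n h {a | (h.state, a) ∈ M.D n} = 1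

instance instIsMarkovKernelRandPolicy {M : Model A Z q} (π : M.RandPolicy) (n : ℕ) :
    IsMarkovKernel (π.ker n) := π.isMarkov n

/-- Deterministic Markov policies of the controller (`Π^M`). -/
structure MarkovPolicy (M : Model A Z q) where
  d : ℕ → ℝ → A
  measurable_d : ∀ n, Measurable (d n)
  admissible : ∀ n x, (x, d n x) ∈ M.D n

/-- A deterministic Markov policy as a randomized policy, through Dirac kernels. -/
def MarkovPolicy.toRand {M : Model A Z q} (π : M.MarkovPolicy) : M.RandPolicy where
  ker n := Kernel.deterministic (fun h : History A n => π.d n h.state)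
    ((π.measurable_d n).comp History.measurable_state)
  isMarkov _ := inferInstance
  admissible n h _ := by
    have hm : MeasurableSet {a | (h.state, a) ∈ M.D n} :=
      measurable_prodMk_left (M.measurableSet_D n)
    rw [Kernel.deterministic_apply' _ _ hm]
    simp [π.admissible n h.state]

/-- Policies of nature (`Γ`): measurable maps from histories and actions into the ambiguity sets,
which carry the Borel σ-algebra of `σ(L^q, L^p)`. -/
structure NaturePolicy (M : Model A Z q) (p : ℝ≥0∞) where
  γ : (n : ℕ) → History A n × A → Lp ℝ q (M.P n)
  mem : ∀ n y, γ n y ∈ M.Qd n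
  measurable_γ : ∀ n, @Measurable _ _ _ (weakStarBorel p q (M.P n)) (γ n)

/-- Markov policies of nature (`Γ^M`). Only the values on `D n` matter. -/
structure MarkovNaturePolicy (M : Model A Z q) (p : ℝ≥0∞) where
  γ : (n : ℕ) → ℝ × A → Lp ℝ q (M.P n)
  mem : ∀ n y, γ n y ∈ M.Qd n
  measurable_γ : ∀ n, @Measurable _ _ _ (weakStarBorel p q (M.P n)) (γ n)

variable {p : ℝ≥0∞}

/-- A Markov policy of nature as a history-dependent one. -/
def MarkovNaturePolicy.toNature {M : Model A Z q} (g : M.MarkovNaturePolicy p) :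
    M.NaturePolicy p where
  γ n y := g.γ n (y.1.state, y.2)
  mem n y := g.mem n _
  measurable_γ n := (g.measurable_γ n).comp
    ((History.measurable_state.comp measurable_fst).prodMk measurable_snd)

/-- Nature always plays the same density `Y n` at stage `n`. -/
def constNature (M : Model A Z q) (p : ℝ≥0∞) (Y : (n : ℕ) → M.Qd n) :
    M.MarkovNaturePolicy p where
  γ n _ := Y n
  mem n _ := (Y n).2
  measurable_γ _ := measurable_const

/-- The stochastic kernel from histories and actions to disturbances induced by nature's rule. -/
def NaturePolicy.kernel {M : Model A Z q} (g : M.NaturePolicy p) (n : ℕ) :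
    Kernel (History A n × A) Z where
  toFun y := densMeasure (M.P n) (g.γ n y)
  measurable' := measurable_densMeasure p (g.γ n) (g.measurable_γ n)
    fun _ => M.isDensity_Qd n _ (g.mem n _)

instance instIsMarkovKernelNature {M : Model A Z q} (g : M.NaturePolicy p) (n : ℕ) :
    IsMarkovKernel (g.kernel n) :=
  ⟨fun y => (M.isDensity_Qd n _ (g.mem n y)).isProbabilityMeasure⟩

/-! #### Law of motion and values -/

/-- `Q_n(B | h_n, a_n) = ∫ 1_B(T_n(x_n, a_n, z)) η_n(dz | h_n, a_n)`. -/
def stateKernel (M : Model A Z q) {n : ℕ} (η : Kernel (History A n × A) Z) :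
    Kernel (History A n × A) ℝ :=
  (Kernel.id ×ₖ η).map
    (fun y : (History A n × A) × Z => M.T n y.1.1.state y.1.2 y.2)

lemma measurable_transition (M : Model A Z q) (n : ℕ) :
    Measurable (fun y : (History A n × A) × Z => M.T n y.1.1.state y.1.2 y.2) :=
  (M.measurable_T n).comp
    (((History.measurable_state.comp (measurable_fst.comp measurable_fst)).prodMk
      (measurable_snd.comp measurable_fst)).prodMk measurable_snd)

instance instIsMarkovKernelStateKernel (M : Model A Z q) {n : ℕ}
    (η : Kernel (History A n × A) Z) [IsMarkovKernel η] : IsMarkovKernel (M.stateKernel η) :=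
  Kernel.IsMarkovKernel.map _ (M.measurable_transition n)

/-- One step `h_n ↦ (a_n, x_{n+1})` of the process: `π_n ⊗ Q_n`. -/
def stepKernel (M : Model A Z q) (n : ℕ) (κ : Kernel (History A n) A)
    (η : Kernel (History A n × A) Z) : Kernel (History A n) (Coord A (n + 1)) :=
  (κ ⊗ₖ M.stateKernel η : Kernel (History A n) (A × ℝ))

instance instIsMarkovKernelStepKernel (M : Model A Z q) (n : ℕ) (κ : Kernel (History A n) A)
    (η : Kernel (History A n × A) Z) [IsMarkovKernel κ] [IsMarkovKernel η] :
    IsMarkovKernel (M.stepKernel n κ η) :=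
  inferInstanceAs (IsMarkovKernel (κ ⊗ₖ M.stateKernel η : Kernel (History A n) (A × ℝ)))

/-- The cost `∑_{k=n}^{N-1} c_k(x_k, a_k, x_{k+1}) + c_N(x_N)` of a trajectory from time `n` on. -/
def totalCost (M : Model A Z q) (n : ℕ) (ω : (i : ℕ) → Coord A i) : ℝ :=
  (∑ k ∈ Finset.Ico n M.N, M.c k (ω k).2 (ω (k + 1)).1 (ω (k + 1)).2) + M.cN (ω M.N).2

/-- Expected cost from time `n` on, given the history `h_n`, under the Ionescu-Tulcea law of motion
of the policy `π`, when the disturbances are generated by the kernels `η`. -/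
def expectedCost (M : Model A Z q) (π : M.RandPolicy) (η : (n : ℕ) → Kernel (History A n × A) Z)
    [∀ n, IsMarkovKernel (η n)] (n : ℕ) (h : History A n) : ℝ :=
  ∫ ω, M.totalCost n ω ∂(Kernel.traj (fun k => M.stepKernel k (π.ker k) (η k)) n h)

/-- The value `V_{nπγ}(h_n)` of a pair of policies. -/
def value (M : Model A Z q) (π : M.RandPolicy) (g : M.NaturePolicy p) (n : ℕ)
    (h : History A n) : ℝ :=
  M.expectedCost π (fun k => g.kernel k) n h

/-- The robust value `V_{nπ}(h_n) = sup_{γ ∈ Γ} V_{nπγ}(h_n)` of the policy `π`. -/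
def robustValue (M : Model A Z q) (p : ℝ≥0∞) (π : M.RandPolicy) (n : ℕ) (h : History A n) :
    EReal :=
  ⨆ g : M.NaturePolicy p, (M.value π g n h : EReal)

/-- The value function `V_n(h_n) = inf_{π ∈ Π^R} sup_{γ ∈ Γ} V_{nπγ}(h_n)`. -/
def upperValue (M : Model A Z q) (p : ℝ≥0∞) (n : ℕ) (h : History A n) : EReal :=
  ⨅ π : M.RandPolicy, M.robustValue p π n h

/-- Expected cost from time `n` on in the risk-neutral model in which the disturbances are
independent and `Z_{k+1}` has the law `Q k`. -/
def riskNeutralValue (M : Model A Z q) (Q : ℕ → ProbabilityMeasure Z) (π : M.RandPolicy) (n : ℕ)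
    (h : History A n) : ℝ :=
  M.expectedCost π (fun k => Kernel.const (History A k × A) (Q k : Measure Z)) n h

/-- `L_n v(x, a, ℚ) = ∫ c_n(x, a, T_n(x, a, z)) + v(T_n(x, a, z)) ℚ(dz)` for `dℚ = Y dP_n`. -/
def L (M : Model A Z q) (n : ℕ) (v : ℝ → ℝ) (x : ℝ) (a : A) (Y : Lp ℝ q (M.P n)) : ℝ :=
  ∫ z, (M.c n x a (M.T n x a z) + v (M.T n x a z)) ∂(densMeasure (M.P n) Y)

/-- The value `J_{nπγ}(x)` of a pair of Markov policies: `J_{Nπγ} = c_N` and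
`J_{nπγ}(x) = L_n J_{n+1,πγ}(x, d_n(x), γ_n(x, d_n(x)))`. -/
def markovValue (M : Model A Z q) (π : M.MarkovPolicy) (g : M.MarkovNaturePolicy p) (n : ℕ)
    (x : ℝ) : ℝ :=
  if n < M.N then
    M.L n (fun y => M.markovValue π g (n + 1) y) x (π.d n x) (g.γ n (x, π.d n x))
  else M.cN x
termination_by M.N - n

/-- The Markovian value function `J_n(x) = inf_{π ∈ Π^M} sup_{γ ∈ Γ^M} J_{nπγ}(x)`. -/
def J (M : Model A Z q) (p : ℝ≥0∞) (n : ℕ) (x : ℝ) : ℝ :=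
  (⨅ π : M.MarkovPolicy, ⨆ g : M.MarkovNaturePolicy p, (M.markovValue π g n x : EReal)).toReal

/-- The Markov policy `g` of nature is optimal in the robust control problem:
* at every stage and in every scenario `(x, a)` it maximizes the right-hand side of the Bellman
  equation over the ambiguity set;
* the controller's optimal value against `g` is the value of the robust problem;
* together with some Markov policy of the controller, which is optimal for the robust problem, it
  attains this value. -/
structure IsOptimalNature (M : Model A Z q) (g : M.MarkovNaturePolicy p) : Prop where
  bellman : ∀ n < M.N, ∀ x a, (x, a) ∈ M.D n →
    IsGreatest {r : ℝ | ∃ Y ∈ M.Qd n, r = M.L n (M.J p (n + 1)) x a Y}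
      (M.L n (M.J p (n + 1)) x a (g.γ n (x, a)))
  value_eq : ∀ n ≤ M.N, ∀ h : History A n, M.Feasible h →
    (⨅ π : M.RandPolicy, (M.value π g.toNature n h : EReal)) = M.upperValue p n h
  attained : ∃ π : M.MarkovPolicy, ∀ n ≤ M.N, ∀ h : History A n, M.Feasible h →
    M.robustValue p π.toRand n h = M.upperValue p n h ∧
      (M.value π.toRand g.toNature n h : EReal) = M.upperValue p n h

/-! #### Assumptions -/

/-- Integrability assumptions: lower and upper bounding functions, local `L^p`-bounds and
norm-boundedness of the ambiguity sets. -/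
structure BoundingAssumption [TopologicalSpace A] (M : Model A Z q) (p : ℝ≥0∞) : Prop where
  bounds : ∃ (α ε₁ ε₂ : ℝ) (b₁ b₂ : ℝ → ℝ),
    0 ≤ α ∧ α ≠ 1 ∧ 0 ≤ ε₁ ∧ 0 ≤ ε₂ ∧ ε₁ + ε₂ = 1 ∧ Measurable b₁ ∧ Measurable b₂ ∧
    (∀ x, b₁ x ≤ -ε₁) ∧ (∀ x, ε₂ ≤ b₂ x) ∧
    (∀ n < M.N, ∀ Y ∈ M.Qd n, ∀ x a, (x, a) ∈ M.D n →
      ∫⁻ z, ENNReal.ofReal (-M.c n x a (M.T n x a z)) ∂(densMeasure (M.P n) Y)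
        ≤ ENNReal.ofReal (-b₁ x) ∧
      ∫⁻ z, ENNReal.ofReal (-b₁ (M.T n x a z)) ∂(densMeasure (M.P n) Y)
        ≤ ENNReal.ofReal (α * -b₁ x) ∧
      ∫⁻ z, ENNReal.ofReal (M.c n x a (M.T n x a z)) ∂(densMeasure (M.P n) Y)
        ≤ ENNReal.ofReal (b₂ x) ∧
      ∫⁻ z, ENNReal.ofReal (b₂ (M.T n x a z)) ∂(densMeasure (M.P n) Y)
        ≤ ENNReal.ofReal (α * b₂ x)) ∧
    (∀ x, b₁ x ≤ M.cN x ∧ M.cN x ≤ b₂ x) ∧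
    (∀ n < M.N, ∀ y ∈ M.D n, ∃ s ∈ 𝓝 y, ∃ Θ₁ Θ₂ : Z → ℝ,
      Measurable Θ₁ ∧ Measurable Θ₂ ∧ MemLp Θ₁ p (M.P n) ∧ MemLp Θ₂ p (M.P n) ∧
      ∀ x a, (x, a) ∈ s → (x, a) ∈ M.D n → ∀ z,
        |M.c n x a (M.T n x a z)| ≤ Θ₁ z ∧ b₂ (M.T n x a z) - b₁ (M.T n x a z) ≤ Θ₂ z)
  normBounded : ∃ K : ℝ≥0, ∀ n < M.N, ∀ Y ∈ M.Qd n, eLpNorm Y q (M.P n) ≤ K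

/-- Continuity, compactness and monotonicity assumptions for the real state space. -/
structure RealAssumption [TopologicalSpace A] (M : Model A Z q) : Prop where
  compact_D : ∀ n < M.N, ∀ x, IsCompact {a | (x, a) ∈ M.D n}
  usc_D : ∀ n < M.N, ∀ (x : ℝ) (xs : ℕ → ℝ) (as : ℕ → A), Tendsto xs atTop (𝓝 x) →
    (∀ k, (xs k, as k) ∈ M.D n) → ∃ a, (x, a) ∈ M.D n ∧ MapClusterPt a atTop as
  lsc_T : ∀ n < M.N, ∀ z, LowerSemicontinuousOn (fun y : ℝ × A => M.T n y.1 y.2 z) (M.D n)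
  lsc_c : ∀ n < M.N, LowerSemicontinuousOn
    (fun y : (ℝ × A) × ℝ => M.c n y.1.1 y.1.2 y.2) (M.D n ×ˢ univ)
  lsc_cN : LowerSemicontinuous M.cN
  decreasing_D : ∀ n < M.N, ∀ x x', x ≤ x' → {a | (x', a) ∈ M.D n} ⊆ {a | (x, a) ∈ M.D n}
  mono_T : ∀ n < M.N, ∀ x x' a z, x ≤ x' → (x, a) ∈ M.D n → (x', a) ∈ M.D n →
    M.T n x a z ≤ M.T n x' a z
  mono_c : ∀ n < M.N, ∀ x x' a y y', x ≤ x' → y ≤ y' → (x, a) ∈ M.D n → (x', a) ∈ M.D n →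
    M.c n x a y ≤ M.c n x' a y'
  mono_cN : Monotone M.cN

/-- The set of densities at stage `n` is law invariant. -/
def LawInvariant (M : Model A Z q) (n : ℕ) : Prop :=
  ∀ Y₁ ∈ M.Qd n, ∀ Y₂ : Lp ℝ q (M.P n), (M.P n).map Y₂ = (M.P n).map Y₁ → Y₂ ∈ M.Qd n

/-- `Y` is a greatest element of the set of densities at stage `n` in convex order. -/
def IsConvexGreatest (M : Model A Z q) (n : ℕ) (Y : Lp ℝ q (M.P n)) : Prop :=
  Y ∈ M.Qd n ∧ ∀ Y' ∈ M.Qd n, ConvexOrderLE (M.P n) Y' Y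

/-- All assumptions at once: bounding, real state space, separable atomless reference measures, law
invariant density sets with greatest elements `Ystar n` in convex order. -/
structure StandingAssumptions [TopologicalSpace A] (M : Model A Z q) (p : ℝ≥0∞)
    (Ystar : (n : ℕ) → Lp ℝ q (M.P n)) : Prop where
  bounding : M.BoundingAssumption p
  real : M.RealAssumption
  separable : ∀ n < M.N, MeasureTheory.IsSeparable (M.P n)
  atomless : ∀ n < M.N, Atomless (M.P n)
  lawInvariant : ∀ n < M.N, M.LawInvariant n
  greatest : ∀ n < M.N, M.IsConvexGreatest n (Ystar n)

/-- The spectrum `φ(u) = q⁺_Y(u)` of a density `Y` at stage `n`. -/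
def spectrum (M : Model A Z q) {n : ℕ} (Y : Lp ℝ q (M.P n)) (u : ℝ) : ℝ :=
  upperQuantile ((M.P n).map Y) u

/-- The set `𝔔` of disturbance laws `⨂ Q_n` with `dQ_n = Y_n dP_n`, where the densities
`Y_n ∈ L^q` are dominated by `R n` in convex order. -/
def coherentSet (M : Model A Z q) (R : ℕ → Z → ℝ) : Set (ℕ → ProbabilityMeasure Z) :=
  {Q | ∀ n < M.N, ∃ Y : Lp ℝ q (M.P n), 0 ≤ᵐ[M.P n] Y ∧ ConvexOrderLE (M.P n) Y (R n) ∧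
    (Q n : Measure Z) = densMeasure (M.P n) Y}

end Model

end RobustMDP

end

/-! The argument combines a rearrangement theorem for nature's one-stage problem with dynamic
programming for the controller.

One stage. Let `φ` be the upper quantile function of the convex-order greatest density `Ystar`, and
let `U` be a distributional transform of a cost `X`. The tail sets of `X` are also upper level sets
of `φ(U)` up to null sets, so `∫_E (Y - k) ≤ ∫ (Y - k)⁺ ≤ ∫ (Ystar - k)⁺ = ∫_E (φ(U) - k)` for a
tail set `E` and a suitable threshold `k`. Hence `φ(U)` gives `X` heavier tails than any density `Y`
with smaller stop-loss transforms, and `E[XY] ≤ E[X φ(U)] = ρ_φ(X)` (`StopLossLE.integral_mul_le`,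
`IsDistribTransform.integral_mul_le`). Since `φ(U)` has the law of `Ystar`, law invariance places it
in the ambiguity set. So the supremum is attained and equals `ρ_φ(X)`, and coherence follows because
`ρ_φ` is a maximum of expectations.

One answer for all costs. The stage cost plus the value of the future is increasing in the next
state, and a distributional transform of a variable also serves all its increasing functions
(`IsDistribTransform.comp_monotone`). So a transform of `T n x a` alone determines nature's reply,
whatever the future value is. If `T n x a` increases in `z`, a transform of the disturbance itself
works for all `(x, a)` at once, and nature's reply is constant.

Existence and measurability. On a separable atomless space there is a real `V` without atoms.
Ranking points lexicographically by `(X, V)` gives a transform of `X` (`isDistribTransform_lexRank`)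
that is jointly measurable in a parameter. Measurability of nature's rule for the weak* Borel sets
is reduced to countably many pairings (`measurable_weakStarBorel`).

Dynamic programming. `bellmanValue` solves the recursion with `ρ_φ`. By backward induction it is
increasing, lower semicontinuous and bounded by a multiple of `b`, so minimizers exist and can be
selected measurably (`exists_bellman_policy`). A policy of minimizers costs at most `bellmanValue`
against every rule with densities dominated by `Ystar`. A rule that attains the risk costs every
policy at least `bellmanValue`. These two bounds (`expectedCost_le_bellmanValue`,
`bellmanValue_le_expectedCost`) form a saddle point and identify all the values in question. The
upper bound needs only stop-loss domination, not membership in the ambiguity set, so it covers the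
set `𝔔` as well. -/

namespace RobustMDP

/-! ### Quantile functions -/

section Quantile

variable {ν : Measure ℝ} {u x : ℝ}

lemma bddBelow_le_cdf (hu : 0 < u) : BddBelow {x : ℝ | u ≤ cdf ν x} := by
  obtain ⟨y, hy⟩ := ((tendsto_cdf_atBot ν).eventually (gt_mem_nhds hu)).exists
  refine ⟨y, fun z hz => ?_⟩
  by_contra h
  exact absurd (hz.trans (monotone_cdf ν (not_le.1 h).le)) (not_le.2 hy)

lemma nonempty_lt_cdf (hu : u < 1) : {x : ℝ | u < cdf ν x}.Nonempty :=
  ((tendsto_cdf_atTop ν).eventually (lt_mem_nhds hu)).exists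

lemma setOf_lt_cdf_subset : {x : ℝ | u < cdf ν x} ⊆ {x : ℝ | u ≤ cdf ν x} := fun x hx =>
  le_of_lt (show u < cdf ν x from hx)

/-- Right continuity of the distribution function makes the infimum attained. This Galois connection
is how lower quantiles are handled throughout. -/
lemma lowerQuantile_le_iff (hu : u ∈ Ioo (0 : ℝ) 1) : lowerQuantile ν u ≤ x ↔ u ≤ cdf ν x := by
  constructor
  · intro h
    have hright := (cdf ν).right_continuous x
    have hmem : ∀ y, x < y → u ≤ cdf ν y := by
      intro y hy
      obtain ⟨z, hz, hzy⟩ := exists_lt_of_csInf_lt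
        ((nonempty_lt_cdf (ν := ν) hu.2).mono setOf_lt_cdf_subset) (h.trans_lt hy)
      exact hz.trans (monotone_cdf ν hzy.le)
    exact ge_of_tendsto (hright.tendsto.mono_left (nhdsWithin_mono x Ioi_subset_Ici_self))
      (eventually_nhdsWithin_of_forall hmem)
  · exact fun h => csInf_le (bddBelow_le_cdf hu.1) h

lemma le_upperQuantile (hu : u < 1) (h : ∀ y < x, cdf ν y ≤ u) : x ≤ upperQuantile ν u := by
  refine le_csInf (nonempty_lt_cdf hu) fun y hy => ?_
  by_contra hlt
  exact absurd (h y (not_le.1 hlt)) (not_le.2 hy)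

lemma upperQuantile_le (hu : 0 < u) (h : u < cdf ν x) : upperQuantile ν u ≤ x :=
  csInf_le ((bddBelow_le_cdf hu).mono setOf_lt_cdf_subset) h

lemma monotoneOn_lowerQuantile : MonotoneOn (lowerQuantile ν) (Ioo 0 1) := fun _ hu _ hv huv =>
  (lowerQuantile_le_iff hu).2 (huv.trans ((lowerQuantile_le_iff hv).1 le_rfl))

lemma monotoneOn_upperQuantile : MonotoneOn (upperQuantile ν) (Ioo 0 1) := by
  intro u hu v hv huv
  exact csInf_le_csInf ((bddBelow_le_cdf hu.1).mono setOf_lt_cdf_subset)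
    (nonempty_lt_cdf hv.2) fun x hx => lt_of_le_of_lt huv hx

/-- The uniform distribution on `(0,1)`. -/
noncomputable abbrev unif : Measure ℝ := (volume : Measure ℝ).restrict (Ioo 0 1)

instance : IsProbabilityMeasure unif := ⟨by simp⟩

lemma ae_unif_mem : ∀ᵐ u ∂unif, u ∈ Ioo (0 : ℝ) 1 := ae_restrict_mem measurableSet_Ioo

lemma unif_real_Iic (hu : u ∈ Icc (0 : ℝ) 1) : unif.real (Iic u) = u := by
  have : (Iic u ∩ Ioo 0 1 : Set ℝ) =ᵐ[volume] (Ioc 0 u : Set ℝ) := by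
    have h1 : ∀ᵐ x ∂(volume : Measure ℝ), x ≠ 1 := by simp [ae_iff]
    filter_upwards [h1] with x hx
    refine propext ⟨fun h => ⟨h.2.1, h.1⟩, fun h => ⟨h.2, h.1, lt_of_le_of_ne (h.2.trans hu.2) hx⟩⟩
  rw [measureReal_def, Measure.restrict_apply measurableSet_Iic, measure_congr this]
  simp [hu.1]

/-- If the two quantiles differ at `u`, then the distribution function equals `u` at any rational
strictly between them. So the exceptional `u` lie in a countable set. -/
lemma ae_unif_lowerQuantile_eq_upperQuantile :
    ∀ᵐ u ∂unif, lowerQuantile ν u = upperQuantile ν u := by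
  have hc : (range fun r : ℚ => cdf ν (r : ℝ)).Countable := countable_range _
  have h0 : ∀ᵐ u ∂unif, u ∉ range fun r : ℚ => cdf ν (r : ℝ) :=
    measure_eq_zero_iff_ae_notMem.1 (hc.measure_zero _)
  filter_upwards [h0, ae_unif_mem] with u hu hmem
  refine le_antisymm ((lowerQuantile_le_iff hmem).2 ?_) ?_
  · have : lowerQuantile ν u ≤ upperQuantile ν u :=
      le_upperQuantile hmem.2 fun y hy => by
        by_contra h
        exact absurd ((lowerQuantile_le_iff hmem).2 (not_le.1 h).le) (not_le.2 hy)
    exact (lowerQuantile_le_iff hmem).1 this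
  · by_contra h
    obtain ⟨r, hr1, hr2⟩ := exists_rat_btwn (not_le.1 h)
    refine hu ⟨r, le_antisymm ?_ ((lowerQuantile_le_iff hmem).1 hr1.le)⟩
    by_contra h'
    exact absurd (upperQuantile_le hmem.1 (not_le.1 h')) (not_le.2 hr2)

/-- A monotone function on `(0,1)` with law `ν` lies between the quantile functions of `ν`. -/
lemma quantile_bounds {g : ℝ → ℝ} (hg : MonotoneOn g (Ioo 0 1)) (hu : u ∈ Ioo (0 : ℝ) 1) :
    lowerQuantile (unif.map g) u ≤ g u ∧ g u ≤ upperQuantile (unif.map g) u := by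
  have hgm : AEMeasurable g unif := aemeasurable_restrict_of_monotoneOn measurableSet_Ioo hg
  have : IsProbabilityMeasure (unif.map g) := Measure.isProbabilityMeasure_map hgm
  have hF : ∀ x, cdf (unif.map g) x = unif.real {v | g v ≤ x} := fun x => by
    rw [cdf_eq_real, map_measureReal_apply_of_aemeasurable hgm measurableSet_Iic]; rfl
  have hmono : ∀ {s t : Set ℝ}, (∀ v ∈ Ioo (0 : ℝ) 1, v ∈ s → v ∈ t) → unif.real s ≤ unif.real t :=
    fun h => ENNReal.toReal_mono (measure_ne_top _ _) (measure_mono_ae (ae_unif_mem.mono h))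
  have hI := unif_real_Iic ⟨hu.1.le, hu.2.le⟩
  constructor
  -- By monotonicity `{g ≤ g u}` contains `(0, u]`, while `{g ≤ y}` is contained in it for every `y
  -- < g u`.
  · refine (lowerQuantile_le_iff hu).2 (hI.symm.le.trans ?_)
    rw [hF]
    exact hmono fun v hv hvu => hg hv hu hvu
  · refine le_upperQuantile hu.2 fun y hy => ?_
    rw [hF]
    refine le_trans (hmono fun v hv hvy => ?_) hI.le
    by_contra h
    exact absurd ((hg hu hv (not_le.1 h).le).trans hvy) (not_le.2 hy)

lemma ae_quantile_eq {g : ℝ → ℝ} (hg : MonotoneOn g (Ioo 0 1)) :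
    ∀ᵐ u ∂unif, lowerQuantile (unif.map g) u = g u ∧ upperQuantile (unif.map g) u = g u := by
  filter_upwards [ae_unif_mem, ae_unif_lowerQuantile_eq_upperQuantile (ν := unif.map g)] with u hu h
  have := quantile_bounds hg hu
  exact ⟨le_antisymm this.1 (h ▸ this.2), le_antisymm (h ▸ this.1) this.2⟩

lemma aemeasurable_lowerQuantile : AEMeasurable (lowerQuantile ν) unif :=
  aemeasurable_restrict_of_monotoneOn measurableSet_Ioo monotoneOn_lowerQuantile

lemma aemeasurable_upperQuantile : AEMeasurable (upperQuantile ν) unif :=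
  aemeasurable_restrict_of_monotoneOn measurableSet_Ioo monotoneOn_upperQuantile

variable [IsProbabilityMeasure ν]

/-- By the Galois connection `{q⁻ ≤ x}` is `{u ≤ F(x)}` within `(0,1)`, which has mass `F(x)`. -/
lemma map_lowerQuantile : unif.map (lowerQuantile ν) = ν := by
  have := Measure.isProbabilityMeasure_map (aemeasurable_lowerQuantile (ν := ν))
  refine Measure.eq_of_cdf _ _ (StieltjesFunction.ext fun x => ?_)
  rw [cdf_eq_real, map_measureReal_apply_of_aemeasurable aemeasurable_lowerQuantile
    measurableSet_Iic, ← unif_real_Iic ⟨cdf_nonneg ν x, cdf_le_one ν x⟩]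
  refine measureReal_congr ?_
  filter_upwards [ae_unif_mem] with u hu
  exact propext (lowerQuantile_le_iff hu)

lemma map_upperQuantile : unif.map (upperQuantile ν) = ν := by
  rw [← Measure.map_congr (ae_unif_lowerQuantile_eq_upperQuantile (ν := ν)), map_lowerQuantile]

end Quantile

/-! ### Distributional transforms -/

section Transform

variable {Ω : Type*} [MeasurableSpace Ω] {μ : Measure Ω}

/-- Monotone transformations keep distributional transforms. -/
lemma IsDistribTransform.of_monotoneOn {X U : Ω → ℝ} (hU : Measurable U) (hlaw : μ.map U = unif)
    {g : ℝ → ℝ} (hg : MonotoneOn g (Ioo 0 1)) (hX : X =ᵐ[μ] fun ω => g (U ω)) :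
    IsDistribTransform μ X U := by
  have hgm : AEMeasurable g unif := aemeasurable_restrict_of_monotoneOn measurableSet_Ioo hg
  have hmap : μ.map X = unif.map g := by
    rw [Measure.map_congr hX, ← hlaw, AEMeasurable.map_map_of_aemeasurable (hlaw ▸ hgm)
      hU.aemeasurable]; rfl
  refine ⟨hU, hlaw, ?_⟩
  have := ae_of_ae_map hU.aemeasurable (hlaw ▸ ae_quantile_eq hg)
  filter_upwards [this, hX] with ω h1 h2
  rw [hmap, h2, ← hlaw]
  exact h1

/-- `f(X) = f(q⁻(U))` is again an increasing function of `U`. This lets nature's reply depend on the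
next state only and not on the cost attached to it. -/
lemma IsDistribTransform.comp_monotone {X U : Ω → ℝ} (h : IsDistribTransform μ X U) {f : ℝ → ℝ}
    (hf : Monotone f) : IsDistribTransform μ (fun ω => f (X ω)) U :=
  .of_monotoneOn h.measurable h.uniform (hf.comp_monotoneOn (monotoneOn_lowerQuantile (ν := μ.map X)))
    (h.quantile.mono fun ω hω => by simp [hω.1])

/-- A separable atomless space carries a real random variable whose law has no atoms. -/
lemma exists_measurable_measure_fiber_eq_zero [IsFiniteMeasure μ] [MeasureTheory.IsSeparable μ]
    (hμ : Atomless μ) :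
    ∃ V : Ω → ℝ, Measurable V ∧ ∀ v, μ {ω | V ω = v} = 0 := by
  obtain ⟨𝒜, hc, hd⟩ := exists_countable_measureDense μ
  obtain ⟨B, hB⟩ := hc.exists_eq_range hd.nonempty
  have hBm : ∀ k, MeasurableSet (B k) := fun k => hd.measurable _ (hB ▸ mem_range_self k)
  classical
  -- `V` is a real code for the sequence of memberships in a countable dense family of sets.
  let f : Ω → ℕ → Bool := fun ω k => decide (ω ∈ B k)
  have hf : Measurable f := measurable_pi_lambda _ fun k =>
    measurable_to_bool (by convert hBm k using 1; ext ω; simp [f])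
  have he := measurableEmbedding_embeddingReal (ℕ → Bool)
  refine ⟨fun ω => embeddingReal (ℕ → Bool) (f ω), he.measurable.comp hf, fun v => ?_⟩
  by_contra hne
  set s := {ω | embeddingReal (ℕ → Bool) (f ω) = v}
  have hs : MeasurableSet s := (he.measurable.comp hf) (measurableSet_singleton v)
  obtain ⟨t, hts, ht, ht0, htlt⟩ := hμ s hs (pos_iff_ne_zero.2 hne)
  have hdiff : 0 < μ (s \ t) := by
    rw [measure_sdiff hts ht.nullMeasurableSet (measure_ne_top _ _)]
    exact tsub_pos_of_lt htlt
  obtain ⟨ε, hε0, hε⟩ : ∃ ε : ℝ, 0 < ε ∧ ENNReal.ofReal ε ≤ min (μ t) (μ (s \ t)) := by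
    refine ⟨(min (μ t) (μ (s \ t))).toReal, ENNReal.toReal_pos (lt_min ht0 hdiff).ne'
      (ne_top_of_le_ne_top (measure_ne_top μ t) (min_le_left _ _)), ENNReal.ofReal_toReal_le⟩
  obtain ⟨C, hC, hCε⟩ := hd.approx t ht (measure_ne_top _ _) ε hε0
  rw [hB] at hC
  obtain ⟨k, rfl⟩ := hC
  -- The code is constant on the fibre `s`, so every `B k` contains `s` or misses it. It then
  -- differs from `t` by at least `s \ t` or `t`, and cannot approximate `t`.
  have hsame : ∀ ω ∈ s, ∀ ω' ∈ s, ω ∈ B k → ω' ∈ B k := by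
    intro ω hω ω' hω' h
    have : f ω = f ω' := he.injective (hω.trans hω'.symm)
    have := congrFun this k
    simp only [f, decide_eq_decide] at this
    exact this.1 h
  refine absurd hCε (not_lt.2 (hε.trans ?_))
  by_cases hk : ∃ ω ∈ s, ω ∈ B k
  · obtain ⟨ω, hω, hωk⟩ := hk
    refine (min_le_right _ _).trans (measure_mono fun ω' hω' => ?_)
    exact .inr ⟨hsame ω hω ω' hω'.1 hωk, hω'.2⟩
  · push Not at hk
    refine (min_le_left _ _).trans (measure_mono fun ω' hω' => ?_)
    exact .inl ⟨hω', hk ω' (hts hω')⟩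

/-- The rank of `ω` in the lexicographic order of `(X, V)`. -/
noncomputable def lexRank (μ : Measure Ω) (X V : Ω → ℝ) (ω : Ω) : ℝ :=
  μ.real {ω' | X ω' < X ω ∨ X ω' = X ω ∧ V ω' ≤ V ω}

variable [IsProbabilityMeasure μ]

lemma measurable_lexRank_uncurry {β : Type*} [MeasurableSpace β] {X : β → Ω → ℝ}
    (hX : Measurable fun y : β × Ω => X y.1 y.2) {V : Ω → ℝ} (hV : Measurable V) :
    Measurable fun y : β × Ω => lexRank μ (X y.1) V y.2 := by
  have h1 : Measurable fun w : (β × Ω) × Ω => X w.1.1 w.2 :=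
    hX.comp ((measurable_fst.comp measurable_fst).prodMk measurable_snd)
  have h2 : Measurable fun w : (β × Ω) × Ω => X w.1.1 w.1.2 := hX.comp measurable_fst
  have h3 : Measurable fun w : (β × Ω) × Ω => V w.1.2 :=
    hV.comp (measurable_snd.comp measurable_fst)
  have hs : MeasurableSet {w : (β × Ω) × Ω |
      X w.1.1 w.2 < X w.1.1 w.1.2 ∨ X w.1.1 w.2 = X w.1.1 w.1.2 ∧ V w.2 ≤ V w.1.2} :=
    (measurableSet_lt h1 h2).union
      ((measurableSet_eq_fun h1 h2).inter (measurableSet_le (hV.comp measurable_snd) h3))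
  exact (measurable_measure_prodMk_left (ν := μ) hs).ennreal_toReal

lemma measurable_lexRank {X V : Ω → ℝ} (hX : Measurable X) (hV : Measurable V) :
    Measurable (lexRank μ X V) :=
  (measurable_lexRank_uncurry (μ := μ) (β := Unit) (X := fun _ => X) (hX.comp measurable_snd)
    hV).comp (measurable_const (a := ()).prodMk measurable_id)

/-- For a measurable total preorder whose down-sets all have mass at most `u` on a set `A` that is
closed downwards, `A` has mass at most `u`. -/
lemma measure_le_of_forall_downset_le {r : Ω → Ω → Prop} (hr : MeasurableSet {y : Ω × Ω | r y.1 y.2})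
    (htot : ∀ x y, r x y ∨ r y x) (htrans : ∀ x y z, r x y → r y z → r x z) {A : Set Ω}
    (hA : MeasurableSet A) {u : ℝ} (hu : 0 ≤ u) (h : ∀ y ∈ A, μ.real {x | r x y} ≤ u) :
    μ.real A ≤ u := by
  rcases A.eq_empty_or_nonempty with rfl | hne
  · simpa
  have hI : ∀ y, MeasurableSet {x | r x y} := fun y => measurable_prodMk_right hr
  set S := (fun y => μ.real {x | r x y}) '' A
  have hbdd : BddAbove S := ⟨u, by rintro _ ⟨y, hy, rfl⟩; exact h y hy⟩
  -- The down-sets of points of `A` are a possibly uncountable chain. A sequence whose masses tend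
  -- to the supremum has a union `B` that exhausts `A` up to a null set.
  obtain ⟨s, -, hs, hsS⟩ := exists_seq_tendsto_sSup (hne.image _) hbdd
  choose w hwA hw using hsS
  set B := ⋃ k, {x | r x (w k)}
  have hBm : MeasurableSet B := .iUnion fun k => hI _
  have hdir : Directed (· ⊆ ·) fun k => {x | r x (w k)} := fun i j => by
    rcases htot (w i) (w j) with hij | hij
    · exact ⟨j, fun x hx => htrans _ _ _ hx hij, subset_rfl⟩
    · exact ⟨i, subset_rfl, fun x hx => htrans _ _ _ hx hij⟩
  have hBu : μ.real B ≤ u := by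
    refine ENNReal.toReal_le_of_le_ofReal hu ?_
    rw [hdir.measure_iUnion]
    refine iSup_le fun k => ?_
    rw [← ofReal_measureReal]
    exact ENNReal.ofReal_le_ofReal (h _ (hwA k))
  have hSB : sSup S ≤ μ.real B := le_of_tendsto' hs fun k => by
    rw [← hw k]; exact measureReal_mono (subset_iUnion (fun k => {x | r x (w k)}) k)
  -- A point of the remainder `R` lies above all `w k`, so its down-set contains `B`. The mass of
  -- the down-set is at most that of `B`, so it adds only a null set.
  set R := A \ B
  have hRm : MeasurableSet R := hA.diff hBm
  have hnull : ∀ y ∈ R, μ {x | x ∈ R ∧ r x y} = 0 := by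
    intro y hy
    have hsub : B ⊆ {x | r x y} := iUnion_subset fun k x hx => by
      rcases htot (w k) y with h1 | h1
      · exact htrans _ _ _ hx h1
      · exact absurd (mem_iUnion.2 ⟨k, h1⟩) hy.2
    have h1 : μ.real {x | r x y} ≤ μ.real B := (le_csSup hbdd ⟨y, hy.1, rfl⟩).trans hSB
    have h2 : μ.real ({x | r x y} \ B) = 0 := by
      rw [measureReal_sdiff hsub hBm]
      exact le_antisymm (sub_nonpos.2 h1) (sub_nonneg.2 (measureReal_mono hsub))
    refine measure_mono_null ?_ ((measureReal_eq_zero_iff).1 h2)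
    exact fun x hx => ⟨hx.2, hx.1.2⟩
  have hpm : MeasurableSet {y : Ω × Ω | y.1 ∈ R ∧ y.2 ∈ R ∧ r y.1 y.2} :=
    (measurable_fst hRm).inter ((measurable_snd hRm).inter hr)
  have hp0 : (μ.prod μ) {y : Ω × Ω | y.1 ∈ R ∧ y.2 ∈ R ∧ r y.1 y.2} = 0 := by
    rw [Measure.prod_apply_symm hpm, lintegral_eq_zero_iff (measurable_measure_prodMk_right hpm)]
    refine .of_forall fun y => ?_
    by_cases hy : y ∈ R
    · refine measure_mono_null ?_ (hnull y hy)
      exact fun x hx => ⟨hx.1, hx.2.2⟩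
    · simp [hy]
  have hp1 : (μ.prod μ) {y : Ω × Ω | y.1 ∈ R ∧ y.2 ∈ R ∧ r y.2 y.1} = 0 := by
    rw [← Measure.prod_swap, Measure.map_apply measurable_swap]
    · refine measure_mono_null ?_ hp0
      exact fun y hy => ⟨hy.2.1, hy.1, hy.2.2⟩
    · exact (measurable_fst hRm).inter ((measurable_snd hRm).inter (measurable_swap hr))
  -- By totality the relation and its transpose cover `R ×ˢ R`. Both parts are null by Fubini,
  -- because the sections are null.
  have hRR : (μ.prod μ) (R ×ˢ R) = 0 := by
    refine measure_mono_null (fun y hy => ?_) (measure_union_null hp0 hp1)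
    rcases htot y.1 y.2 with h1 | h1
    · exact .inl ⟨hy.1, hy.2, h1⟩
    · exact .inr ⟨hy.1, hy.2, h1⟩
  have hR0 : μ R = 0 := by simpa [Measure.prod_prod] using hRR
  have : μ.real A ≤ μ.real (B ∪ R) := measureReal_mono (by rw [union_sdiff_self]; exact subset_union_right)
  refine this.trans ((measureReal_union_le _ _).trans ?_)
  simpa [measureReal_def, hR0] using hBu

/-- The lexicographic down-set of `ω` and its down-set in the reversed order cover the space and
overlap only inside `{V = V ω}`, which is null. -/
lemma lexRank_add_lexRank_neg {X V : Ω → ℝ} (hX : Measurable X) (hV : Measurable V)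
    (hV0 : ∀ v, μ {ω | V ω = v} = 0) (ω : Ω) :
    lexRank μ X V ω + lexRank μ (fun ω => -X ω) (fun ω => -V ω) ω = 1 := by
  have hm : MeasurableSet {ω' | X ω' < X ω ∨ X ω' = X ω ∧ V ω' ≤ V ω} :=
    (measurableSet_lt hX measurable_const).union
      ((measurableSet_eq_fun hX measurable_const).inter (measurableSet_le hV measurable_const))
  rw [← probReal_add_probReal_compl (μ := μ) hm]
  unfold lexRank
  congr 1
  refine measureReal_congr ?_
  filter_upwards [measure_eq_zero_iff_ae_notMem.1 (hV0 (V ω))] with ω' h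
  have h' : V ω' ≠ V ω := h
  refine propext ?_
  change (-X ω' < -X ω ∨ -X ω' = -X ω ∧ -V ω' ≤ -V ω) ↔ ¬(X ω' < X ω ∨ X ω' = X ω ∧ V ω' ≤ V ω)
  grind

/-- Each point of this set has a lexicographic down-set of mass below `u`. Ties need no control
here; they enter only when the opposite bound is derived by reversing the order. -/
lemma measureReal_lexRank_lt_le {X V : Ω → ℝ} (hX : Measurable X) (hV : Measurable V) {u : ℝ}
    (hu : 0 ≤ u) : μ.real {ω | lexRank μ X V ω < u} ≤ u := by
  refine measure_le_of_forall_downset_le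
    (r := fun x y => X x < X y ∨ X x = X y ∧ V x ≤ V y) ?_ ?_ ?_
    (measurableSet_lt (measurable_lexRank hX hV) measurable_const) hu
    (fun y hy => le_of_lt hy)
  · exact (measurableSet_lt (hX.comp measurable_fst) (hX.comp measurable_snd)).union
      ((measurableSet_eq_fun (hX.comp measurable_fst) (hX.comp measurable_snd)).inter
        (measurableSet_le (hV.comp measurable_fst) (hV.comp measurable_snd)))
  · intro x y; grind
  · intro x y z; grind

lemma map_lexRank {X V : Ω → ℝ} (hX : Measurable X) (hV : Measurable V)
    (hV0 : ∀ v, μ {ω | V ω = v} = 0) : μ.map (lexRank μ X V) = unif := by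
  have hm := measurable_lexRank (μ := μ) hX hV
  have hkey : ∀ u ∈ Icc (0 : ℝ) 1, μ.real {ω | lexRank μ X V ω ≤ u} = u := by
    intro u hu
    refine le_antisymm (le_of_forall_pos_le_add fun ε hε => ?_) ?_
    · refine (measureReal_mono ?_).trans
        (measureReal_lexRank_lt_le hX hV (add_nonneg hu.1 hε.le))
      exact fun ω hω => lt_of_le_of_lt hω (lt_add_of_pos_right u hε)
    · have h1 := measureReal_lexRank_lt_le (μ := μ) hX.neg hV.neg (sub_nonneg.2 hu.2)
      -- The lower bound is the upper bound for the reversed order: a rank above `u` is a reversed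
      -- rank below `1 - u`.
      have h2 : {ω | lexRank μ X V ω ≤ u}ᶜ
          = {ω | lexRank μ (-X) (-V) ω < 1 - u} := by
        ext ω
        have : _ + lexRank μ (-X) (-V) ω = 1 := lexRank_add_lexRank_neg hX hV hV0 ω
        simp only [mem_compl_iff, mem_ofPred_eq, not_le]
        constructor <;> intro <;> linarith
      have h3 := probReal_add_probReal_compl (μ := μ) (measurableSet_le hm (measurable_const (a := u)))
      rw [h2] at h3
      linarith
  have := Measure.isProbabilityMeasure_map (μ := μ) hm.aemeasurable
  refine Measure.eq_of_cdf _ _ (StieltjesFunction.ext fun u => ?_)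
  rw [cdf_eq_real, cdf_eq_real, map_measureReal_apply hm measurableSet_Iic]
  change μ.real {ω | lexRank μ X V ω ≤ u} = _
  rcases lt_or_ge u 0 with h0 | h0
  · have e1 : {ω | lexRank μ X V ω ≤ u} = ∅ :=
      eq_empty_of_forall_notMem fun ω hω => absurd (measureReal_nonneg.trans hω) (not_le.2 h0)
    have e2 : unif (Iic u) = 0 := by
      rw [Measure.restrict_apply measurableSet_Iic]
      convert measure_empty (μ := volume)
      exact eq_empty_of_forall_notMem fun x hx => absurd (hx.2.1.le.trans hx.1) (not_le.2 h0)
    rw [e1, measureReal_def, measureReal_def, e2]; simp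
  rcases lt_or_ge 1 u with h1 | h1
  · have e1 : {ω | lexRank μ X V ω ≤ u} = univ :=
      eq_univ_of_forall fun ω => (measureReal_le_one : lexRank μ X V ω ≤ 1).trans h1.le
    have e2 : Iic u ∩ Ioo (0 : ℝ) 1 = Ioo 0 1 :=
      inter_eq_right.2 fun x hx => (hx.2.trans h1).le
    rw [e1, measureReal_def, measureReal_def, Measure.restrict_apply measurableSet_Iic, e2]; simp
  · rw [hkey u ⟨h0, h1⟩, unif_real_Iic ⟨h0, h1⟩]

/-- The down-set of `ω` lies between `{X < X ω}` and `{X ≤ X ω}`. Hence `q⁻(U) ≤ X ≤ q⁺(U)`, and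
both quantiles agree at almost every value of the uniform rank. -/
lemma isDistribTransform_lexRank {X V : Ω → ℝ} (hX : Measurable X) (hV : Measurable V)
    (hV0 : ∀ v, μ {ω | V ω = v} = 0) : IsDistribTransform μ X (lexRank μ X V) := by
  have hm := measurable_lexRank (μ := μ) hX hV
  have hlaw := map_lexRank hX hV hV0
  have := Measure.isProbabilityMeasure_map (μ := μ) hX.aemeasurable
  refine ⟨hm, hlaw, ?_⟩
  have h1 := ae_of_ae_map hm.aemeasurable (hlaw ▸ ae_unif_mem)
  have h2 := ae_of_ae_map hm.aemeasurable
    (hlaw ▸ ae_unif_lowerQuantile_eq_upperQuantile (ν := μ.map X))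
  have hF : ∀ x, cdf (μ.map X) x = μ.real {ω | X ω ≤ x} := fun x => by
    rw [cdf_eq_real, map_measureReal_apply hX measurableSet_Iic]; rfl
  filter_upwards [h1, h2] with ω hu heq
  have hle : lowerQuantile (μ.map X) (lexRank μ X V ω) ≤ X ω := by
    rw [lowerQuantile_le_iff hu, hF]
    exact measureReal_mono fun ω' h => h.elim le_of_lt fun h => h.1.le
  have hge : X ω ≤ upperQuantile (μ.map X) (lexRank μ X V ω) := by
    refine le_upperQuantile hu.2 fun y hy => ?_
    rw [hF]
    exact measureReal_mono fun ω' h => .inl (lt_of_le_of_lt h hy)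
  exact ⟨le_antisymm hle (heq ▸ hge), le_antisymm (heq ▸ hle) hge⟩

end Transform

/-! ### Expectations under a density -/

section Density

variable {Ω : Type*} [MeasurableSpace Ω] {μ : Measure Ω} {Y : Ω → ℝ}

lemma integral_densMeasure (hY : AEMeasurable Y μ) (h0 : 0 ≤ᵐ[μ] Y) (f : Ω → ℝ) :
    ∫ ω, f ω ∂(densMeasure μ Y) = ∫ ω, f ω * Y ω ∂μ := by
  rw [densMeasure, integral_withDensity_eq_integral_toReal_smul₀ hY.ennreal_ofReal (by simp)]
  refine integral_congr_ae ?_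
  filter_upwards [h0] with ω hω
  simp only [Pi.zero_apply] at hω
  rw [ENNReal.toReal_ofReal hω, smul_eq_mul, mul_comm]

lemma integrable_densMeasure (hY : AEMeasurable Y μ) (h0 : 0 ≤ᵐ[μ] Y) {f : Ω → ℝ} :
    Integrable f (densMeasure μ Y) ↔ Integrable (fun ω => f ω * Y ω) μ := by
  rw [densMeasure, integrable_withDensity_iff_integrable_smul₀' hY.ennreal_ofReal (by simp)]
  refine integrable_congr ?_
  filter_upwards [h0] with ω hω
  simp only [Pi.zero_apply] at hω
  rw [ENNReal.toReal_ofReal hω, smul_eq_mul, mul_comm]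

lemma densMeasure_real_apply (hY : Integrable Y μ) (h0 : 0 ≤ᵐ[μ] Y) {s : Set Ω}
    (hs : MeasurableSet s) : (densMeasure μ Y).real s = ∫ ω in s, Y ω ∂μ := by
  rw [measureReal_def, densMeasure, withDensity_apply _ hs,
    ← ofReal_integral_eq_lintegral_ofReal hY.integrableOn (ae_restrict_of_ae h0),
    ENNReal.toReal_ofReal (integral_nonneg_of_ae (ae_restrict_of_ae h0))]

/-- First order stochastic dominance orders expectations. -/
lemma integral_le_integral_of_tail_le {m₁ m₂ : Measure Ω} [IsProbabilityMeasure m₁]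
    [IsProbabilityMeasure m₂] {X : Ω → ℝ} (hX : Measurable X) (h₁ : Integrable X m₁)
    (h₂ : Integrable X m₂) (h : ∀ s : ℝ, m₁.real {ω | s < X ω} ≤ m₂.real {ω | s < X ω}) :
    ∫ ω, X ω ∂m₁ ≤ ∫ ω, X ω ∂m₂ := by
  have key : ∀ {m n : Measure Ω} {f : Ω → ℝ}, (∀ ω, 0 ≤ f ω) → Measurable f →
      (∀ s, 0 < s → m {ω | s ≤ f ω} ≤ n {ω | s ≤ f ω}) →
      ∫⁻ ω, ENNReal.ofReal (f ω) ∂m ≤ ∫⁻ ω, ENNReal.ofReal (f ω) ∂n := by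
    intro m n f h0 hf hmn
    rw [lintegral_eq_lintegral_meas_le _ (.of_forall h0) hf.aemeasurable,
      lintegral_eq_lintegral_meas_le _ (.of_forall h0) hf.aemeasurable]
    exact setLIntegral_mono' measurableSet_Ioi fun s hs => hmn s hs
  -- Both layer-cake formulas are needed: the positive part uses the strict tails `{s < X}`, and the
  -- negative part uses their complements, which are closed level sets of `-X`.
  have key' : ∀ {m n : Measure Ω} {f : Ω → ℝ}, (∀ ω, 0 ≤ f ω) → Measurable f →
      (∀ s, 0 < s → m {ω | s < f ω} ≤ n {ω | s < f ω}) →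
      ∫⁻ ω, ENNReal.ofReal (f ω) ∂m ≤ ∫⁻ ω, ENNReal.ofReal (f ω) ∂n := by
    intro m n f h0 hf hmn
    rw [lintegral_eq_lintegral_meas_lt _ (.of_forall h0) hf.aemeasurable,
      lintegral_eq_lintegral_meas_lt _ (.of_forall h0) hf.aemeasurable]
    exact setLIntegral_mono' measurableSet_Ioi fun s hs => hmn s hs
  have h' : ∀ s : ℝ, m₁ {ω | s < X ω} ≤ m₂ {ω | s < X ω} := fun s =>
    (ENNReal.toReal_le_toReal (measure_ne_top _ _) (measure_ne_top _ _)).1 (h s)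
  have hc : ∀ s : ℝ, m₂ {ω | X ω ≤ s} ≤ m₁ {ω | X ω ≤ s} := fun s => by
    have hs : MeasurableSet {ω | s < X ω} := measurableSet_lt measurable_const hX
    have e : {ω | X ω ≤ s} = {ω | s < X ω}ᶜ := by ext; simp
    rw [e, prob_compl_eq_one_sub hs, prob_compl_eq_one_sub hs]
    exact tsub_le_tsub_left (h' s) 1
  have e1 : ∀ x : ℝ, ENNReal.ofReal x = ENNReal.ofReal (max x 0) := fun x => by
    rcases le_total x 0 with hx | hx
    · rw [max_eq_right hx, ENNReal.ofReal_of_nonpos hx, ENNReal.ofReal_zero]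
    · rw [max_eq_left hx]
  rw [integral_eq_lintegral_pos_part_sub_lintegral_neg_part h₁,
    integral_eq_lintegral_pos_part_sub_lintegral_neg_part h₂]
  refine sub_le_sub (ENNReal.toReal_mono h₂.lintegral_lt_top.ne ?_)
    (ENNReal.toReal_mono h₁.neg.lintegral_lt_top.ne ?_)
  · simp_rw [e1 (X _)]
    refine key' (fun ω => le_max_right _ _) (hX.max measurable_const) fun s hs => ?_
    have : {ω | s < max (X ω) 0} = {ω | s < X ω} := by
      ext ω; simp [hs.le]
    rw [this]; exact h' s
  · simp_rw [e1 (-X _)]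
    refine key (fun ω => le_max_right _ _) (hX.neg.max measurable_const) fun s hs => ?_
    have : {ω | s ≤ max (-X ω) 0} = {ω | X ω ≤ -s} := by
      ext ω; simp [hs, le_neg]
    rw [this]; exact hc _

/-- `Y` is a density whose stop-loss transforms are dominated by those of `W`. -/
structure StopLossLE (μ : Measure Ω) (Y W : Ω → ℝ) : Prop where
  isDensity : IsDensity μ Y
  stopLoss_le : ∀ k : ℝ, ∫ ω, max (Y ω - k) 0 ∂μ ≤ ∫ ω, max (W ω - k) 0 ∂μ

/-- If `X` and `W` are comonotone, then `E[XY] ≤ E[XW]` for all densities `Y` below `W`. -/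
lemma StopLossLE.integral_mul_le {X W : Ω → ℝ} [IsFiniteMeasure μ] (h : StopLossLE μ Y W)
    (hX : Measurable X)
    (hW : IsDensity μ W) (hXY : Integrable (fun ω => X ω * Y ω) μ)
    (hXW : Integrable (fun ω => X ω * W ω) μ) {S : Set Ω} (hS : ∀ᵐ ω ∂μ, ω ∈ S)
    (hco : ∀ ω ∈ S, ∀ ω' ∈ S, X ω < X ω' → W ω ≤ W ω') :
    ∫ ω, X ω * Y ω ∂μ ≤ ∫ ω, X ω * W ω ∂μ := by
  have hY := h.isDensity
  have := hY.isProbabilityMeasure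
  have := hW.isProbabilityMeasure
  have aY := hY.integrable.aemeasurable
  have aW := hW.integrable.aemeasurable
  rw [← integral_densMeasure aY hY.1, ← integral_densMeasure aW hW.1]
  refine integral_le_integral_of_tail_le hX ((integrable_densMeasure aY hY.1).2 hXY)
    ((integrable_densMeasure aW hW.1).2 hXW) fun s => ?_
  have hE : MeasurableSet {ω | s < X ω} := measurableSet_lt measurable_const hX
  set E := {ω | s < X ω}
  -- If `E` is null or of full measure, the tail comparison is trivial. Otherwise the set `K` below
  -- is nonempty and bounded above.
  by_cases hup : ∃ ω ∈ S, s < X ω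
  swap
  · have h0 : μ E = 0 := by
      refine measure_eq_zero_iff_ae_notMem.2 ?_
      filter_upwards [hS] with ω hω hs using hup ⟨ω, hω, hs⟩
    have : (densMeasure μ Y).real E = 0 := by
      rw [measureReal_def, densMeasure, withDensity_absolutelyContinuous _ _ h0]; rfl
    rw [this]; exact measureReal_nonneg
  by_cases hdown : ∃ ω ∈ S, X ω ≤ s
  swap
  · have h0 : μ Eᶜ = 0 := by
      refine measure_eq_zero_iff_ae_notMem.2 ?_
      filter_upwards [hS] with ω hω hs using hdown ⟨ω, hω, not_lt.1 hs⟩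
    have : (densMeasure μ W).real E = 1 := by
      have h1 : densMeasure μ W Eᶜ = 0 := withDensity_absolutelyContinuous _ _ h0
      rw [measureReal_def, (prob_compl_eq_zero_iff hE).1 h1]; rfl
    rw [this]; exact measureReal_le_one
  obtain ⟨ω₁, h1S, h1⟩ := hup
  obtain ⟨ω₀, h0S, h0⟩ := hdown
  -- Comonotonicity separates the values of `W`: with `k` the supremum of `W` where `X ≤ s`, one has
  -- `W ≤ k` off `E` and `k ≤ W` on `E`. So `(W - k)⁺` integrates exactly to `∫_E (W - k)`.
  set K := W '' {ω | ω ∈ S ∧ X ω ≤ s}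
  set k := sSup K
  have hk1 : ∀ ω ∈ S, s < X ω → k ≤ W ω := by
    intro ω hω hs
    refine csSup_le ⟨W ω₀, ω₀, ⟨h0S, h0⟩, rfl⟩ ?_
    rintro _ ⟨ω', ⟨hS', hs'⟩, rfl⟩
    exact hco _ hS' _ hω (hs'.trans_lt hs)
  have hk0 : ∀ ω ∈ S, X ω ≤ s → W ω ≤ k := by
    intro ω hω hs
    refine le_csSup ⟨W ω₁, ?_⟩ ⟨ω, ⟨hω, hs⟩, rfl⟩
    rintro _ ⟨ω', ⟨hS', hs'⟩, rfl⟩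
    exact hco _ hS' _ h1S (hs'.trans_lt h1)
  have ik : ∀ {f : Ω → ℝ}, Integrable f μ → Integrable (fun ω => f ω - k) μ := fun hf =>
    hf.sub (integrable_const k)
  have imax : ∀ {f : Ω → ℝ}, Integrable f μ → Integrable (fun ω => max (f ω - k) 0) μ := fun hf =>
    (ik hf).pos_part
  have e1 : ∀ {f : Ω → ℝ}, Integrable f μ →
      ∫ ω in E, f ω ∂μ = ∫ ω in E, (f ω - k) ∂μ + ∫ ω in E, k ∂μ := fun hf => by
    rw [← integral_add (ik hf).integrableOn (integrable_const k).integrableOn]; simp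
  rw [densMeasure_real_apply hY.integrable hY.1 hE, densMeasure_real_apply hW.integrable hW.1 hE,
    e1 hY.integrable, e1 hW.integrable]
  gcongr ?_ + _
  calc ∫ ω in E, (Y ω - k) ∂μ
      ≤ ∫ ω in E, max (Y ω - k) 0 ∂μ :=
        integral_mono (ik hY.integrable).integrableOn (imax hY.integrable).integrableOn
          fun ω => le_max_left _ _
    _ ≤ ∫ ω, max (Y ω - k) 0 ∂μ :=
        setIntegral_le_integral (imax hY.integrable) (.of_forall fun ω => le_max_right _ _)
    _ ≤ ∫ ω, max (W ω - k) 0 ∂μ := h.stopLoss_le k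
    _ = ∫ ω in E, max (W ω - k) 0 ∂μ := by
        refine (setIntegral_eq_integral_of_ae_compl_eq_zero ?_).symm
        filter_upwards [hS] with ω hω hs
        exact max_eq_right (sub_nonpos.2 (hk0 ω hω (not_lt.1 hs)))
    _ = ∫ ω in E, (W ω - k) ∂μ := by
        refine setIntegral_congr_ae hE ?_
        filter_upwards [hS] with ω hω hs
        exact max_eq_left (sub_nonneg.2 (hk1 ω hω hs))

lemma convexOn_stopLoss (k : ℝ) : ConvexOn ℝ univ fun y : ℝ => max (y - k) 0 :=
  ((convexOn_id convex_univ).sub (concaveOn_const k convex_univ)).sup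
    (convexOn_const 0 convex_univ)

/-- The convex functions `y` and `-y` force equal means, so `Y` automatically has total mass one.
The functions `(y - k)⁺` give the stop-loss inequalities. -/
lemma ConvexOrderLE.stopLossLE [IsFiniteMeasure μ] {W : Ω → ℝ} (h : ConvexOrderLE μ Y W)
    (hY : Integrable Y μ) (h0 : 0 ≤ᵐ[μ] Y) (hW : IsDensity μ W) : StopLossLE μ Y W := by
  have i1 : ∀ (k : ℝ) {f : Ω → ℝ}, Integrable f μ → Integrable (fun ω => max (f ω - k) 0) μ :=
    fun k f hf => (hf.sub (integrable_const k)).pos_part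
  refine ⟨⟨h0, ?_⟩, fun k => h _ (convexOn_stopLoss k) (i1 k hY) (i1 k hW.integrable)⟩
  have h1 := h _ (convexOn_id convex_univ) hY hW.integrable
  have h2 := h _ (concaveOn_id convex_univ).neg hY.neg hW.integrable.neg
  simp only [id, Pi.neg_apply, integral_neg, hW.2] at h1 h2
  linarith

end Density

/-! ### Spectral risk measures -/

section Spectral

variable {Ω : Type*} [MeasurableSpace Ω] {μ : Measure Ω} {W X U : Ω → ℝ}

lemma aemeasurable_upperQuantile_comp {ν : Measure ℝ} (hU : Measurable U) (hlaw : μ.map U = unif) :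
    AEMeasurable (fun ω => upperQuantile ν (U ω)) μ :=
  AEMeasurable.comp_measurable (g := upperQuantile ν) (hlaw ▸ aemeasurable_upperQuantile) hU

lemma map_upperQuantile_comp {ν : Measure ℝ} [IsProbabilityMeasure ν] (hU : Measurable U)
    (hlaw : μ.map U = unif) : μ.map (fun ω => upperQuantile ν (U ω)) = ν := by
  have := AEMeasurable.map_map_of_aemeasurable (μ := μ) (f := U) (g := upperQuantile ν)
    (hlaw ▸ aemeasurable_upperQuantile) hU.aemeasurable
  rw [hlaw, map_upperQuantile] at this
  exact this.symm

/-- `ρ_φ(X) = E[X φ(U)]` for every distributional transform `U` of `X`. -/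
lemma IsDistribTransform.spectralRisk_eq (h : IsDistribTransform μ X U) (ν : Measure ℝ) :
    spectralRisk (upperQuantile ν) μ X = ∫ ω, X ω * upperQuantile ν (U ω) ∂μ := by
  have hm : AEStronglyMeasurable (fun u => lowerQuantile (μ.map X) u * upperQuantile ν u)
      (μ.map U) := by
    rw [h.uniform]
    exact (aemeasurable_lowerQuantile.mul aemeasurable_upperQuantile).aestronglyMeasurable
  rw [spectralRisk, ← h.uniform, integral_map h.measurable.aemeasurable hm]
  exact integral_congr_ae (h.quantile.mono fun ω hω => by simp only [hω.1])

lemma IsDistribTransform.integrableOn_iff (h : IsDistribTransform μ X U) (ν : Measure ℝ) :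
    IntegrableOn (fun u => lowerQuantile (μ.map X) u * upperQuantile ν u) (Ioo 0 1) ↔
      Integrable (fun ω => X ω * upperQuantile ν (U ω)) μ := by
  have hm : AEStronglyMeasurable (fun u => lowerQuantile (μ.map X) u * upperQuantile ν u)
      (μ.map U) := by
    rw [h.uniform]
    exact (aemeasurable_lowerQuantile.mul aemeasurable_upperQuantile).aestronglyMeasurable
  rw [IntegrableOn, ← h.uniform, integrable_map_measure hm h.measurable.aemeasurable]
  exact integrable_congr (h.quantile.mono fun ω hω => by simp only [Function.comp, hω.1])

lemma spectralRisk_congr {φ : ℝ → ℝ} {X' : Ω → ℝ} (h : X =ᵐ[μ] X') :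
    spectralRisk φ μ X = spectralRisk φ μ X' := by
  rw [spectralRisk, spectralRisk, Measure.map_congr h]

variable [IsProbabilityMeasure μ]

lemma IsDensity.nonneg_of_lt_cdf (hW : IsDensity μ W) {u : ℝ} (hu : 0 ≤ u) :
    {x : ℝ | u < cdf (μ.map W) x} ⊆ Ici 0 := by
  have hm := hW.integrable.aemeasurable
  have := Measure.isProbabilityMeasure_map hm
  intro x hx
  by_contra h
  have hx' : u < cdf (μ.map W) x := hx
  rw [cdf_eq_real, map_measureReal_apply_of_aemeasurable hm measurableSet_Iic] at hx'
  have h0 : μ (W ⁻¹' Iic x) = 0 := by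
    refine measure_eq_zero_iff_ae_notMem.2 ?_
    filter_upwards [hW.1] with ω hω hmem
    exact h (le_trans hω hmem)
  rw [measureReal_def, h0, ENNReal.toReal_zero] at hx'
  exact absurd hx' (not_lt.2 hu)

/-- The upper quantile function of a density is a spectrum. -/
lemma IsDensity.isSpectrum (hW : IsDensity μ W) : IsSpectrum (upperQuantile (μ.map W)) := by
  have hm := hW.integrable.aemeasurable
  have := Measure.isProbabilityMeasure_map hm
  have hb : ∀ {u : ℝ}, 0 ≤ u → BddBelow {x : ℝ | u < cdf (μ.map W) x} := fun hu =>
    ⟨0, fun x hx => hW.nonneg_of_lt_cdf hu hx⟩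
  have hmono : MonotoneOn (upperQuantile (μ.map W)) (Ico 0 1) := fun u hu v hv huv =>
    csInf_le_csInf (hb hu.1) (nonempty_lt_cdf hv.2) fun x hx => lt_of_le_of_lt huv hx
  refine ⟨fun u hu => le_csInf (nonempty_lt_cdf hu.2) fun x hx => hW.nonneg_of_lt_cdf hu.1 hx,
    hmono, fun u hu => ?_, ?_, ?_⟩
  · rw [ContinuousWithinAt, tendsto_order]
    refine ⟨fun a ha => ?_, fun a ha => ?_⟩
    · filter_upwards [self_mem_nhdsWithin, nhdsWithin_le_nhds (Iio_mem_nhds hu.2)] with v hv hv1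
      exact ha.trans_le (hmono hu ⟨hu.1.trans hv, hv1⟩ hv)
    -- The strict inequality `u < F(x)` persists for `v` slightly above `u`, so the same `x` bounds
    -- all these quantiles.
    · obtain ⟨x, hx, hxa⟩ := exists_lt_of_csInf_lt (nonempty_lt_cdf hu.2) ha
      filter_upwards [self_mem_nhdsWithin, nhdsWithin_le_nhds (Iio_mem_nhds hx)] with v hv hvx
      exact lt_of_le_of_lt (csInf_le (hb (hu.1.trans hv)) hvx) hxa
  -- Integrability and total mass depend only on the law, and `q⁺` under the uniform distribution
  -- has the law of `W`.
  · have : Integrable id (unif.map (upperQuantile (μ.map W))) := by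
      rw [map_upperQuantile]
      exact (integrable_map_measure aestronglyMeasurable_id hm).2 hW.integrable
    exact (integrable_map_measure aestronglyMeasurable_id aemeasurable_upperQuantile).1 this
  · refine Eq.trans ?_ hW.2
    rw [← integral_map (f := fun x => x) aemeasurable_upperQuantile aestronglyMeasurable_id,
      map_upperQuantile, integral_map (f := fun x => x) hm aestronglyMeasurable_id]

/-- The rearrangement `φ(U)` of a density `W`, where `φ` is the quantile function of `W`. -/
lemma identDistrib_rearrangement (hW : IsDensity μ W) (hU : Measurable U)
    (hlaw : μ.map U = unif) :
    IdentDistrib (fun ω => upperQuantile (μ.map W) (U ω)) W μ μ := by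
  have := Measure.isProbabilityMeasure_map hW.integrable.aemeasurable
  exact ⟨aemeasurable_upperQuantile_comp hU hlaw, hW.integrable.aemeasurable,
    map_upperQuantile_comp hU hlaw⟩

lemma IsDensity.rearrangement (hW : IsDensity μ W) (hU : Measurable U) (hlaw : μ.map U = unif) :
    IsDensity μ fun ω => upperQuantile (μ.map W) (U ω) := by
  refine ⟨?_, (identDistrib_rearrangement hW hU hlaw).integral_eq.trans hW.2⟩
  filter_upwards [ae_of_ae_map hU.aemeasurable (hlaw ▸ ae_unif_mem)] with ω hω
  exact hW.isSpectrum.nonneg _ ⟨hω.1.le, hω.2⟩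

/-- Stop-loss transforms depend on `W` only through its law, which the rearrangement `φ(U)` shares.
Domination can thus be tested against whichever rearrangement is comonotone to the cost at hand. -/
lemma StopLossLE.rearrangement {Y : Ω → ℝ} (hW : IsDensity μ W) (hU : Measurable U)
    (hlaw : μ.map U = unif) :
    StopLossLE μ Y (fun ω => upperQuantile (μ.map W) (U ω)) ↔ StopLossLE μ Y W := by
  have : ∀ k : ℝ, ∫ ω, max (upperQuantile (μ.map W) (U ω) - k) 0 ∂μ
      = ∫ ω, max (W ω - k) 0 ∂μ := fun k =>
    ((identDistrib_rearrangement hW hU hlaw).comp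
      (u := fun y => max (y - k) 0) (by fun_prop)).integral_eq
  exact ⟨fun h => ⟨h.1, fun k => this k ▸ h.2 k⟩, fun h => ⟨h.1, fun k => (this k).symm ▸ h.2 k⟩⟩

/-- The expectation of `X` under a density below `W` is at most `ρ_φ(X)`. -/
lemma IsDistribTransform.integral_mul_le (h : IsDistribTransform μ X U) (hX : Measurable X)
    (hW : IsDensity μ W) {Y : Ω → ℝ} (hY : StopLossLE μ Y W)
    (hXY : Integrable (fun ω => X ω * Y ω) μ)
    (hXW : Integrable (fun ω => X ω * upperQuantile (μ.map W) (U ω)) μ) :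
    ∫ ω, X ω * Y ω ∂μ ≤ spectralRisk (upperQuantile (μ.map W)) μ X := by
  rw [h.spectralRisk_eq]
  have hU : ∀ᵐ ω ∂μ, U ω ∈ Ioo (0 : ℝ) 1 :=
    ae_of_ae_map h.measurable.aemeasurable (by rw [h.uniform]; exact ae_unif_mem)
  refine ((StopLossLE.rearrangement hW h.measurable h.uniform).2 hY).integral_mul_le hX
    (hW.rearrangement h.measurable h.uniform) hXY hXW
    (S := {ω | lowerQuantile (μ.map X) (U ω) = X ω ∧ U ω ∈ Ioo (0 : ℝ) 1}) ?_ ?_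
  · filter_upwards [h.quantile, hU] with ω h1 h2 using ⟨h1.1, h2⟩
  -- `X = q⁻(U)` with `q⁻` increasing, so `X ω < X ω'` forces `U ω ≤ U ω'`, and `φ` preserves this
  -- order.
  · rintro ω ⟨h1, h2⟩ ω' ⟨h1', h2'⟩ hlt
    rw [← h1, ← h1'] at hlt
    refine monotoneOn_upperQuantile h2 h2' ?_
    by_contra hc
    exact absurd (monotoneOn_lowerQuantile h2' h2 (not_le.1 hc).le) (not_le.2 hlt)

end Spectral

/-! ### Measurability with respect to the weak* Borel σ-algebra -/

section WeakStar

variable {Ω : Type*} [MeasurableSpace Ω] {μ : Measure Ω} {p q : ℝ≥0∞}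

/-- On norm bounded sets the weak* topology is induced by countably many pairings, as `L^p` is
separable. So a norm bounded map is Borel measurable if all its pairings are. -/
lemma measurable_weakStarBorel [ENNReal.HolderConjugate p q] [Fact (1 ≤ p)] [Fact (p ≠ ∞)]
    [Fact (1 ≤ q)] [MeasureTheory.IsSeparable μ] {β : Type*} [MeasurableSpace β]
    {f : β → Lp ℝ q μ} {K : ℝ≥0} (hK : ∀ b, eLpNorm (f b) q μ ≤ K)
    (hf : ∀ X : Lp ℝ p μ, Measurable fun b => ∫ ω, X ω * f b ω ∂μ) :
    @Measurable _ _ _ (weakStarBorel p q μ) f := by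
  have hnorm : ∀ b, ‖f b‖ ≤ K := fun b => by
    rw [Lp.norm_def]; exact ENNReal.toReal_le_coe_of_le_coe (hK b)
  let B := (ContinuousLinearMap.mul ℝ ℝ).lpPairing μ p q
  have hB : ∀ X Y, B X Y = ∫ ω, X ω * Y ω ∂μ := fun X Y =>
    (ContinuousLinearMap.mul ℝ ℝ).lpPairing_eq_integral X Y
  let d := TopologicalSpace.denseSeq (Lp ℝ p μ)
  let e : β → ℕ → ℝ := fun b i => B (d i) (f b)
  have he : Measurable e := measurable_pi_lambda _ fun i => by
    simp only [hB, e]; exact hf _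
  -- `β` receives the topology pulled back from `ℝ^ℕ` by the countably many pairings. Its open sets
  -- are preimages under the measurable map `e`, so continuity of `f` for it suffices.
  let t : TopologicalSpace β := TopologicalSpace.induced e inferInstance
  have hcont : ∀ X : Lp ℝ p μ, Continuous fun b => B X (f b) := by
    intro X
    refine continuous_of_uniform_approx_of_continuous fun u hu => ?_
    obtain ⟨ε, hε, hεu⟩ := Metric.mem_uniformity_dist.1 hu
    -- Replacing `X` by `d i` changes the pairing by at most `‖B‖ * K * ‖X - d i‖`, uniformly in
    -- `b`. The summand `1` only keeps `C` positive.
    set C := ‖B‖ * K + 1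
    have hC : 0 < C := by positivity
    obtain ⟨i, hi⟩ := (TopologicalSpace.denseRange_denseSeq (Lp ℝ p μ)).exists_dist_lt X
      (div_pos hε hC)
    refine ⟨fun b => B (d i) (f b), (continuous_apply (A := fun _ : ℕ => ℝ) i).comp
      (continuous_induced_dom : Continuous e), fun b => ?_⟩
    refine hεu ?_
    rw [dist_eq_norm, ← sub_apply, ← map_sub]
    have h1 := B.le_opNorm₂ (X - d i) (f b)
    rw [dist_eq_norm, lt_div_iff₀ hC] at hi
    calc ‖B (X - d i) (f b)‖ ≤ ‖B‖ * ‖X - d i‖ * ‖f b‖ := h1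
      _ ≤ ‖B‖ * ‖X - d i‖ * K := by gcongr; exact hnorm b
      _ ≤ ‖X - d i‖ * C := by
        have := norm_nonneg (X - d i)
        simp only [C]; nlinarith
      _ < ε := hi
  let τ := weakStarTopology p q μ
  have hfc : @Continuous _ _ t τ f := by
    refine continuous_iInf_rng.2 fun X => continuous_induced_rng.2 ?_
    simpa only [Function.comp_def, hB] using hcont X
  let mτ : MeasurableSpace (Lp ℝ q μ) := weakStarBorel p q μ
  have : BorelSpace (Lp ℝ q μ) := ⟨rfl⟩
  refine measurable_of_isOpen fun O hO => ?_
  obtain ⟨O', hO', hOO'⟩ := isOpen_induced_iff.1 (hfc.isOpen_preimage O hO)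
  rw [← hOO']
  exact he hO'.measurableSet

end WeakStar

/-- Quantile functions are controlled only on `(0,1)`. Cutting them off outside gives a measurable
function on all of `ℝ`, as joint measurability in state, action and disturbance requires. -/
lemma measurable_indicator_upperQuantile (ν : Measure ℝ) :
    Measurable ((Ioo (0 : ℝ) 1).indicator (upperQuantile ν)) := by
  refine measurable_of_restrict_of_restrict_compl (s := Ioo (0 : ℝ) 1) measurableSet_Ioo ?_ ?_
  · have hm : Monotone (upperQuantile ν ∘ ((↑) : Ioo (0 : ℝ) 1 → ℝ)) :=
      fun x y hxy => monotoneOn_upperQuantile x.2 y.2 hxy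
    convert hm.measurable using 1
    ext x
    exact indicator_of_mem x.2 _
  · convert (measurable_const (a := (0 : ℝ)) : Measurable fun _ : ↥(Ioo (0 : ℝ) 1)ᶜ => (0 : ℝ))
      using 1
    ext x
    exact indicator_of_notMem x.2 _

/-! ### Spectral risk measures of the stages and nature's worst-case rule -/

namespace Model

variable {A Z : Type*} [MeasurableSpace A] [MeasurableSpace Z] {p q : ℝ≥0∞}
  {M : Model A Z q} {Ystar : (n : ℕ) → Lp ℝ q (M.P n)} {n : ℕ}

lemma integral_mul_Lp (Y : Lp ℝ q (M.P n)) (hY : 0 ≤ᵐ[M.P n] Y) (f : Z → ℝ) :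
    ∫ z, f z ∂(densMeasure (M.P n) Y) = ∫ z, f z * Y z ∂(M.P n) :=
  integral_densMeasure (Lp.stronglyMeasurable Y).measurable.aemeasurable hY f

lemma integrable_mul_Lp [ENNReal.HolderConjugate p q] (Y : Lp ℝ q (M.P n)) {f : Z → ℝ}
    (hf : MemLp f p (M.P n)) : Integrable (fun z => f z * Y z) (M.P n) :=
  hf.integrable_mul (Lp.memLp Y)

lemma spectralRisk_eq_integral {X U : Z → ℝ} (hU : IsDistribTransform (M.P n) X U)
    {Y : Lp ℝ q (M.P n)} (hY : Y =ᵐ[M.P n] fun z => M.spectrum (Ystar n) (U z)) :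
    spectralRisk (M.spectrum (Ystar n)) (M.P n) X = ∫ z, X z * Y z ∂(M.P n) :=
  (hU.spectralRisk_eq ((M.P n).map (Ystar n))).trans
    (integral_congr_ae (hY.mono fun z hz => by simp only [hz]; rfl))

variable [TopologicalSpace A]

namespace StandingAssumptions

variable (hM : M.StandingAssumptions p Ystar) (hn : n < M.N)
include hM hn

lemma isDensity_Ystar : IsDensity (M.P n) (Ystar n) :=
  M.isDensity_Qd n _ (hM.greatest n hn).1

lemma isSpectrum : IsSpectrum (M.spectrum (Ystar n)) := (hM.isDensity_Ystar hn).isSpectrum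

lemma exists_tieBreaker :
    ∃ V : Z → ℝ, Measurable V ∧ ∀ v, (M.P n) {z | V z = v} = 0 :=
  have := hM.separable n hn
  exists_measurable_measure_fiber_eq_zero (hM.atomless n hn)

lemma exists_isDistribTransform {X : Z → ℝ} (hX : Measurable X) :
    ∃ U, IsDistribTransform (M.P n) X U := by
  obtain ⟨V, hV, hV0⟩ := hM.exists_tieBreaker hn
  exact ⟨_, isDistribTransform_lexRank hX hV hV0⟩

lemma memLp_spectrum_comp {U : Z → ℝ} (hU : Measurable U) (hlaw : (M.P n).map U = unif) :
    MemLp (fun z => M.spectrum (Ystar n) (U z)) q (M.P n) :=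
  (identDistrib_rearrangement (hM.isDensity_Ystar hn) hU hlaw).memLp_iff.2 (Lp.memLp _)

/-- `φ(U)` has the law of `Ystar n`, so this is exactly where law invariance enters. -/
lemma toLp_spectrum_comp_mem {U : Z → ℝ} (hU : Measurable U) (hlaw : (M.P n).map U = unif) :
    (hM.memLp_spectrum_comp hn hU hlaw).toLp _ ∈ M.Qd n := by
  refine hM.lawInvariant n hn _ (hM.greatest n hn).1 _ ?_
  rw [Measure.map_congr (MemLp.coeFn_toLp _)]
  exact (identDistrib_rearrangement (hM.isDensity_Ystar hn) hU hlaw).map_eq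

lemma stopLossLE {Y : Lp ℝ q (M.P n)} (hY : Y ∈ M.Qd n) : StopLossLE (M.P n) Y (Ystar n) :=
  ((hM.greatest n hn).2 Y hY).stopLossLE (M.isDensity_Qd n Y hY).integrable
    (M.isDensity_Qd n Y hY).1 (hM.isDensity_Ystar hn)

/-- The density is `φ(U)` for a transform `U` of `X`. Together with the upper bound
`integral_mul_le_spectralRisk` this makes `ρ_φ` a maximum of expectations; monotonicity,
subadditivity and homogeneity below all follow by choosing the maximizer for one side. -/
lemma exists_spectralRisk_eq {X : Z → ℝ} (hX : Measurable X) :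
    ∃ Y ∈ M.Qd n, spectralRisk (M.spectrum (Ystar n)) (M.P n) X = ∫ z, X z * Y z ∂(M.P n) := by
  obtain ⟨U, hU⟩ := hM.exists_isDistribTransform hn hX
  exact ⟨_, hM.toLp_spectrum_comp_mem hn hU.measurable hU.uniform,
    spectralRisk_eq_integral hU (MemLp.coeFn_toLp _)⟩

lemma spectralRisk_const (m : ℝ) :
    spectralRisk (M.spectrum (Ystar n)) (M.P n) (fun _ => m) = m := by
  obtain ⟨Y, hY, e⟩ := hM.exists_spectralRisk_eq hn (measurable_const (a := m))
  rw [e, integral_const_mul, (M.isDensity_Qd n Y hY).2, mul_one]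

lemma spectralRisk_Lp_const (m : ℝ) :
    spectralRisk (M.spectrum (Ystar n)) (M.P n) (Lp.const p (M.P n) m : Lp ℝ p (M.P n)) = m := by
  rw [spectralRisk_congr (Lp.coeFn_const p (M.P n) m)]
  exact hM.spectralRisk_const hn m

variable [ENNReal.HolderConjugate p q] {X X' : Z → ℝ}

lemma integral_mul_le_spectralRisk (hX : Measurable X) (hXp : MemLp X p (M.P n))
    {Y : Lp ℝ q (M.P n)} (hY : StopLossLE (M.P n) Y (Ystar n)) :
    ∫ z, X z * Y z ∂(M.P n) ≤ spectralRisk (M.spectrum (Ystar n)) (M.P n) X := by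
  obtain ⟨U, hU⟩ := hM.exists_isDistribTransform hn hX
  refine hU.integral_mul_le hX (hM.isDensity_Ystar hn) hY (integrable_mul_Lp Y hXp) ?_
  exact hXp.integrable_mul (hM.memLp_spectrum_comp hn hU.measurable hU.uniform)

lemma isGreatest_spectralRisk (hX : Measurable X) (hXp : MemLp X p (M.P n)) :
    IsGreatest {r : ℝ | ∃ Y ∈ M.Qd n, r = ∫ z, X z * Y z ∂(M.P n)}
      (spectralRisk (M.spectrum (Ystar n)) (M.P n) X) := by
  refine ⟨hM.exists_spectralRisk_eq hn hX, ?_⟩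
  rintro _ ⟨Y, hY, rfl⟩
  exact hM.integral_mul_le_spectralRisk hn hX hXp (hM.stopLossLE hn hY)

lemma integrableOn_lowerQuantile_mul_spectrum (hX : Measurable X) (hXp : MemLp X p (M.P n)) :
    IntegrableOn (fun u => lowerQuantile ((M.P n).map X) u * M.spectrum (Ystar n) u)
      (Ioo 0 1) := by
  obtain ⟨U, hU⟩ := hM.exists_isDistribTransform hn hX
  exact (hU.integrableOn_iff _).2
    (hXp.integrable_mul (hM.memLp_spectrum_comp hn hU.measurable hU.uniform))

lemma spectralRisk_mono (hX : Measurable X) (hXp : MemLp X p (M.P n)) (hX' : Measurable X')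
    (hXp' : MemLp X' p (M.P n)) (h : X ≤ᵐ[M.P n] X') :
    spectralRisk (M.spectrum (Ystar n)) (M.P n) X
      ≤ spectralRisk (M.spectrum (Ystar n)) (M.P n) X' := by
  obtain ⟨Y, hY, e⟩ := hM.exists_spectralRisk_eq hn hX
  refine e.trans_le (le_trans ?_
    (hM.integral_mul_le_spectralRisk hn hX' hXp' (hM.stopLossLE hn hY)))
  refine integral_mono_ae (integrable_mul_Lp Y hXp) (integrable_mul_Lp Y hXp') ?_
  filter_upwards [h, (M.isDensity_Qd n Y hY).1] with z h1 h2
  exact mul_le_mul_of_nonneg_right h1 h2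

lemma spectralRisk_subadd (X X' : Lp ℝ p (M.P n)) :
    spectralRisk (M.spectrum (Ystar n)) (M.P n) (X + X' : Lp ℝ p (M.P n))
      ≤ spectralRisk (M.spectrum (Ystar n)) (M.P n) X
        + spectralRisk (M.spectrum (Ystar n)) (M.P n) X' := by
  obtain ⟨Y, hY, e⟩ := hM.exists_spectralRisk_eq hn (Lp.stronglyMeasurable (X + X')).measurable
  rw [e]
  have h1 := hM.integral_mul_le_spectralRisk hn (Lp.stronglyMeasurable X).measurable (Lp.memLp X)
    (hM.stopLossLE hn hY)
  have h2 := hM.integral_mul_le_spectralRisk hn (Lp.stronglyMeasurable X').measurable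
    (Lp.memLp X') (hM.stopLossLE hn hY)
  refine le_trans (le_of_eq ?_) (add_le_add h1 h2)
  rw [← integral_add (integrable_mul_Lp Y (Lp.memLp X)) (integrable_mul_Lp Y (Lp.memLp X'))]
  refine integral_congr_ae ?_
  filter_upwards [Lp.coeFn_add X X'] with z hz
  rw [hz, Pi.add_apply, add_mul]

lemma spectralRisk_smul (X : Lp ℝ p (M.P n)) {t : ℝ} (ht : 0 ≤ t) :
    spectralRisk (M.spectrum (Ystar n)) (M.P n) (t • X : Lp ℝ p (M.P n))
      = t * spectralRisk (M.spectrum (Ystar n)) (M.P n) X := by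
  have key : ∀ Y : Lp ℝ q (M.P n), ∫ z, (t • X : Lp ℝ p (M.P n)) z * Y z ∂(M.P n)
      = t * ∫ z, X z * Y z ∂(M.P n) := fun Y => by
    rw [← integral_const_mul]
    refine integral_congr_ae ?_
    filter_upwards [Lp.coeFn_smul t X] with z hz
    rw [hz, Pi.smul_apply, smul_eq_mul, mul_assoc]
  refine le_antisymm ?_ ?_
  · obtain ⟨Y, hY, e⟩ := hM.exists_spectralRisk_eq hn (Lp.stronglyMeasurable (t • X)).measurable
    rw [e, key]
    exact mul_le_mul_of_nonneg_left (hM.integral_mul_le_spectralRisk hn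
      (Lp.stronglyMeasurable X).measurable (Lp.memLp X) (hM.stopLossLE hn hY)) ht
  · obtain ⟨Y, hY, e⟩ := hM.exists_spectralRisk_eq hn (Lp.stronglyMeasurable X).measurable
    rw [e, ← key]
    exact hM.integral_mul_le_spectralRisk hn (Lp.stronglyMeasurable _).measurable (Lp.memLp _)
      (hM.stopLossLE hn hY)

lemma isCoherent : IsCoherent (fun X : Lp ℝ p (M.P n) =>
    spectralRisk (M.spectrum (Ystar n)) (M.P n) X) where
  monotone X Y h := hM.spectralRisk_mono hn (Lp.stronglyMeasurable X).measurable (Lp.memLp X)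
    (Lp.stronglyMeasurable Y).measurable (Lp.memLp Y) ((Lp.coeFn_le _ _).2 h)
  -- Subadditivity, applied to adding `m` and then `-m`, gives both inequalities because the risk of
  -- a constant is that constant.
  translation X m := by
    have h1 := hM.spectralRisk_subadd hn X (Lp.const p (M.P n) m)
    have h2 := hM.spectralRisk_subadd hn (X + Lp.const p (M.P n) m) (Lp.const p (M.P n) (-m))
    rw [hM.spectralRisk_Lp_const hn] at h1 h2
    rw [map_neg, add_neg_cancel_right] at h2
    exact le_antisymm h1 (by linarith)
  posHomogeneous X _ ht := hM.spectralRisk_smul hn X ht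
  subadditive := hM.spectralRisk_subadd hn

omit hn

/-- Nature's worst-case strategy: rearrange the spectrum comonotonically to the next state. -/
lemma exists_worstCase_nature (hq : 1 < q) :
    ∃ g : M.MarkovNaturePolicy p, ∀ n < M.N, ∀ x a, (x, a) ∈ M.D n →
      ∃ U, IsDistribTransform (M.P n) (M.T n x a) U ∧
        g.γ n (x, a) =ᵐ[M.P n] fun z => M.spectrum (Ystar n) (U z) := by
  classical
  have hp1 : Fact (1 ≤ p) := ⟨ENNReal.HolderConjugate.one_le p q⟩
  have hq1 : Fact (1 ≤ q) := ⟨hq.le⟩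
  -- `1 < q` excludes `p = ∞`, and for finite `p` the space `L^p` over a separable measure is
  -- separable.
  have hpt : Fact (p ≠ ∞) :=
    ⟨fun h => hq.ne' ((ENNReal.HolderConjugate.eq_top_iff_eq_one p q).1 h)⟩
  obtain ⟨K, hK⟩ := hM.bounding.normBounded
  have key : ∀ n, ∃ γ : ℝ × A → Lp ℝ q (M.P n), (∀ y, γ y ∈ M.Qd n) ∧
      @Measurable _ _ _ (weakStarBorel p q (M.P n)) γ ∧
      (n < M.N → ∀ x a, ∃ U, IsDistribTransform (M.P n) (M.T n x a) U ∧
        γ (x, a) =ᵐ[M.P n] fun z => M.spectrum (Ystar n) (U z)) := by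
    intro n
    by_cases hn : n < M.N
    swap
    · obtain ⟨Y, hY⟩ := M.nonempty_Qd n
      exact ⟨fun _ => Y, fun _ => hY, measurable_const, fun h => absurd h hn⟩
    -- One tie-breaker serves all `(x, a)`, so the ranks are jointly measurable in `(x, a)` and `z`.
    obtain ⟨V, hV, hV0⟩ := hM.exists_tieBreaker hn
    have hT : ∀ y : ℝ × A, Measurable (M.T n y.1 y.2) := fun y =>
      (M.measurable_T n).comp (measurable_const.prodMk measurable_id)
    have hU : ∀ y : ℝ × A,
        IsDistribTransform (M.P n) (M.T n y.1 y.2) (lexRank (M.P n) (M.T n y.1 y.2) V) :=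
      fun y => isDistribTransform_lexRank (hT y) hV hV0
    have hmem := fun y => hM.toLp_spectrum_comp_mem hn (hU y).measurable (hU y).uniform
    refine ⟨_, hmem, ?_, fun _ x a => ⟨_, hU (x, a), MemLp.coeFn_toLp _⟩⟩
    have := hM.separable n hn
    refine measurable_weakStarBorel (K := K) (fun y => hK n hn _ (hmem y)) fun X => ?_
    have hjoint : StronglyMeasurable fun w : (ℝ × A) × Z => X w.2 *
        (Ioo (0 : ℝ) 1).indicator (M.spectrum (Ystar n))
          (lexRank (M.P n) (M.T n w.1.1 w.1.2) V w.2) :=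
      (((Lp.stronglyMeasurable X).measurable.comp measurable_snd).mul
        ((measurable_indicator_upperQuantile _).comp
          (measurable_lexRank_uncurry (X := fun y : ℝ × A => M.T n y.1 y.2)
            (M.measurable_T n) hV))).stronglyMeasurable
    convert (hjoint.integral_prod_right' (ν := M.P n)).measurable using 2 with y
    refine integral_congr_ae ?_
    have h01 : ∀ᵐ z ∂(M.P n), lexRank (M.P n) (M.T n y.1 y.2) V z ∈ Ioo (0 : ℝ) 1 :=
      ae_of_ae_map (hU y).measurable.aemeasurable (by rw [(hU y).uniform]; exact ae_unif_mem)
    filter_upwards [MemLp.coeFn_toLp (hM.memLp_spectrum_comp hn (hU y).measurable (hU y).uniform),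
      h01] with z h1 h2
    rw [h1, indicator_of_mem h2]
  choose γ hγ hγm hγU using key
  exact ⟨⟨γ, hγ, hγm⟩, fun n hn x a _ => hγU n hn x a⟩

end StandingAssumptions

end Model

/-! ### Measurable selection from compact-valued maps -/

section Selection

variable {A β : Type*} [TopologicalSpace A] [MeasurableSpace β]

/-- Nonempty compact-valued maps for which the preimages of closed sets are measurable. -/
structure CompactMeasurable (S : β → Set A) : Prop where
  compact : ∀ x, IsCompact (S x)
  nonempty : ∀ x, (S x).Nonempty
  measurableSet : ∀ F, IsClosed F → MeasurableSet {x | (S x ∩ F).Nonempty}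

/-- The minimizers of `g x` on `S x`. -/
def argminOn (S : β → Set A) (g : β → A → ℝ) (x : β) : Set A := {a ∈ S x | IsMinOn (g x) (S x) a}

/-- Minimizers meet a closed `F` iff the minimum over `S x ∩ F` is no larger than that over `S x`.
This is tested on rational levels: every level reached on `S x` is also reached on `S x ∩ F`. -/
lemma CompactMeasurable.argminOn {S : β → Set A} (h : CompactMeasurable S) {g : β → A → ℝ}
    (hg : ∀ x, LowerSemicontinuousOn (g x) (S x))
    (hm : ∀ F, IsClosed F → ∀ r : ℝ, MeasurableSet {x | ∃ a ∈ S x ∩ F, g x a ≤ r}) :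
    CompactMeasurable (argminOn S g) := by
  have hne : ∀ x, (RobustMDP.argminOn S g x).Nonempty := fun x => by
    obtain ⟨a, ha, hmin⟩ := (hg x).exists_isMinOn (h.nonempty x) (h.compact x)
    exact ⟨a, ha, hmin⟩
  refine ⟨fun x => ?_, hne, fun F hF => ?_⟩
  · obtain ⟨a, ha, hmin⟩ := hne x
    convert (hg x).isCompact_inter_preimage_Iic (h.compact x) (g x a) using 1
    ext a'
    refine ⟨fun h' => ⟨h'.1, h'.2 ha⟩, fun h' => ⟨h'.1, fun b hb =>
      show g x a' ≤ g x b from le_trans h'.2 (hmin hb)⟩⟩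
  · have e : {x | (RobustMDP.argminOn S g x ∩ F).Nonempty} = ⋂ r : ℚ,
        ({x | ∃ a ∈ S x ∩ univ, g x a ≤ r}ᶜ ∪ {x | ∃ a ∈ S x ∩ F, g x a ≤ r}) := by
      ext x
      simp only [mem_iInter]
      constructor
      · rintro ⟨a, ⟨haS, hmin⟩, haF⟩ r
        by_cases hr : ∃ b ∈ S x ∩ univ, g x b ≤ r
        · obtain ⟨b, hb, hbr⟩ := hr
          exact .inr ⟨a, ⟨haS, haF⟩, (hmin hb.1).trans hbr⟩
        · exact .inl hr
      · intro hx
        obtain ⟨a, ha, hmin⟩ := hne x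
        have hx' : ∀ r : ℚ, g x a < r → ∃ b ∈ S x ∩ F, g x b ≤ r := fun r hr =>
          (hx r).resolve_left fun hn => hn ⟨a, ⟨ha, trivial⟩, hr.le⟩
        obtain ⟨r, hr⟩ := exists_rat_gt (g x a)
        obtain ⟨b, hb, -⟩ := hx' r hr
        obtain ⟨c, hc, hcmin⟩ := ((hg x).mono inter_subset_left).exists_isMinOn ⟨b, hb⟩
          ((h.compact x).inter_right hF)
        refine ⟨c, ⟨hc.1, fun d hd =>
          show g x c ≤ g x d from le_trans ?_ (hmin hd)⟩, hc.2⟩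
        by_contra hlt
        obtain ⟨s, hs1, hs2⟩ := exists_rat_btwn (not_le.1 hlt)
        obtain ⟨d, hd, hds⟩ := hx' s hs1
        exact absurd ((hcmin hd).trans hds) (not_le.2 hs2)
    rw [e]
    exact .iInter fun r => ((hm _ isClosed_univ r).compl).union (hm F hF r)

lemma CompactMeasurable.argminOn_continuous {S : β → Set A} (h : CompactMeasurable S) {g : A → ℝ}
    (hg : Continuous g) : CompactMeasurable (RobustMDP.argminOn S fun _ => g) := by
  refine h.argminOn (fun x => hg.lowerSemicontinuous.lowerSemicontinuousOn _) fun F hF r => ?_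
  convert h.measurableSet (F ∩ g ⁻¹' Iic r) (hF.inter (isClosed_Iic.preimage hg)) using 1
  ext x
  exact ⟨fun ⟨a, ha, har⟩ => ⟨a, ha.1, ha.2, har⟩, fun ⟨a, ha, haF, har⟩ => ⟨a, ⟨ha, haF⟩, har⟩⟩

variable [TopologicalSpace.MetrizableSpace A] [SecondCountableTopology A] [MeasurableSpace A]
  [BorelSpace A]

/-- Minimize the distances to a dense sequence lexicographically. -/
theorem CompactMeasurable.exists_measurable_selection {S : β → Set A} (h : CompactMeasurable S) :
    ∃ d : β → A, Measurable d ∧ ∀ x, d x ∈ S x := by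
  rcases isEmpty_or_nonempty β with hβ | ⟨⟨x₀⟩⟩
  · exact ⟨fun x => hβ.elim x, measurable_of_empty _, fun x => hβ.elim x⟩
  have : Nonempty A := (h.nonempty x₀).to_type
  let _ := TopologicalSpace.metrizableSpaceMetric A
  let e := TopologicalSpace.denseSeq A
  let R : ℕ → β → Set A := fun k =>
    Nat.rec S (fun i s => RobustMDP.argminOn s fun _ a => dist a (e i)) k
  have hR : ∀ k, CompactMeasurable (R k) := fun k => by
    induction k with
    | zero => exact h
    | succ i ih => exact ih.argminOn_continuous (continuous_id.dist continuous_const)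
  have hsub : ∀ k x, R (k + 1) x ⊆ R k x := fun k x a ha => ha.1
  -- Cantor's intersection theorem for the nested compact sets `R k x ∩ F`.
  have hcap : ∀ F, IsClosed F → ∀ x, (∀ k, (R k x ∩ F).Nonempty) → (⋂ k, R k x ∩ F).Nonempty :=
    fun F hF x hne => IsCompact.nonempty_iInter_of_sequence_nonempty_isCompact_isClosed _
      (fun k => inter_subset_inter_left _ (hsub k x)) hne (((hR 0).compact x).inter_right hF)
      fun k => (((hR k).compact x).inter_right hF).isClosed
  have hpoint : ∀ x, ∃ a, ∀ k, a ∈ R k x := fun x => by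
    obtain ⟨a, ha⟩ := hcap univ isClosed_univ x fun k => by simpa using (hR k).nonempty x
    exact ⟨a, fun k => (mem_iInter.1 ha k).1⟩
  -- Points surviving all minimizations have equal distances to every point of a dense sequence,
  -- hence coincide.
  have huniq : ∀ x a b, (∀ k, a ∈ R k x) → (∀ k, b ∈ R k x) → a = b := by
    intro x a b ha hb
    have hd : ∀ i, dist a (e i) = dist b (e i) := fun i =>
      le_antisymm ((ha (i + 1)).2 (hb i)) ((hb (i + 1)).2 (ha i))
    refine dist_le_zero.1 (le_of_forall_pos_le_add fun ε hε => ?_)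
    obtain ⟨i, hi⟩ := (TopologicalSpace.denseRange_denseSeq A).exists_dist_lt a (half_pos hε)
    have h1 : dist a (e i) < ε / 2 := hi
    have h2 := dist_triangle_right a b (e i)
    rw [← hd i] at h2
    linarith
  choose d hd using hpoint
  refine ⟨d, measurable_of_isClosed fun F hF => ?_, fun x => hd x 0⟩
  have e1 : d ⁻¹' F = ⋂ k, {x | (R k x ∩ F).Nonempty} := by
    ext x
    simp only [mem_iInter]
    refine ⟨fun hx k => ⟨d x, hd x k, hx⟩, fun hx => ?_⟩
    obtain ⟨a, ha⟩ := hcap F hF x hx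
    have : d x = a := huniq x _ _ (hd x) fun k => (mem_iInter.1 ha k).1
    exact (this ▸ (mem_iInter.1 ha 0).2 : d x ∈ F)
  rw [e1]
  exact .iInter fun k => (hR k).measurableSet F hF

end Selection

namespace Model

variable {A Z : Type*} [MeasurableSpace A] [MeasurableSpace Z] {p q : ℝ≥0∞}
  {M : Model A Z q} {Ystar : (n : ℕ) → Lp ℝ q (M.P n)} {n : ℕ}

/-! ### One stage of the decision model -/

lemma measurable_T_apply (M : Model A Z q) (n : ℕ) (x : ℝ) (a : A) : Measurable (M.T n x a) :=
  (M.measurable_T n).comp (measurable_const.prodMk measurable_id : Measurable fun z => ((x, a), z))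

/-- The cost of one stage when the future is valued by `w`. -/
def stageCost (M : Model A Z q) (n : ℕ) (w : ℝ → ℝ) (x : ℝ) (a : A) (z : Z) : ℝ :=
  M.c n x a (M.T n x a z) + w (M.T n x a z)

lemma integrable_densMeasure_of_memLp [ENNReal.HolderConjugate p q] {Y : Lp ℝ q (M.P n)}
    {f : Z → ℝ} (hf : MemLp f p (M.P n))
    (h0 : 0 ≤ᵐ[M.P n] Y) : Integrable f (densMeasure (M.P n) Y) :=
  (integrable_densMeasure (Lp.stronglyMeasurable Y).measurable.aemeasurable h0).2
    (integrable_mul_Lp Y hf)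

variable [TopologicalSpace A]

/-- The integrability assumptions in terms of a single bounding function `b`. -/
structure HasBound (M : Model A Z q) (p : ℝ≥0∞) (α : ℝ) (b : ℝ → ℝ) : Prop where
  alpha_nonneg : 0 ≤ α
  measurable : Measurable b
  one_le : ∀ x, 1 ≤ b x
  cost_le : ∀ n < M.N, ∀ Y ∈ M.Qd n, ∀ x a, (x, a) ∈ M.D n →
    ∫ z, |M.c n x a (M.T n x a z)| ∂(densMeasure (M.P n) Y) ≤ b x
  next_le : ∀ n < M.N, ∀ Y ∈ M.Qd n, ∀ x a, (x, a) ∈ M.D n →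
    ∫ z, b (M.T n x a z) ∂(densMeasure (M.P n) Y) ≤ α * b x
  terminal_le : ∀ x, |M.cN x| ≤ b x
  dominated : ∀ n < M.N, ∀ y ∈ M.D n, ∃ s ∈ 𝓝 y, ∃ Θ : Z → ℝ, MemLp Θ p (M.P n) ∧
    ∀ x a, (x, a) ∈ s → (x, a) ∈ M.D n → ∀ z,
      |M.c n x a (M.T n x a z)| ≤ Θ z ∧ b (M.T n x a z) ≤ Θ z

lemma HasBound.nonneg {α : ℝ} {b : ℝ → ℝ} (h : M.HasBound p α b) (x : ℝ) : 0 ≤ b x :=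
  zero_le_one.trans (h.one_le x)

lemma RealAssumption.measurable_cost (hR : M.RealAssumption) (hn : n < M.N) {x : ℝ} {a : A}
    (hxa : (x, a) ∈ M.D n) : Measurable (M.c n x a) :=
  Monotone.measurable fun _ _ h => hR.mono_c n hn x x a _ _ le_rfl h hxa hxa

/-- `b = b₂ - b₁` works; `ε₁ + ε₂ = 1` gives `b ≥ 1`. The lower and upper estimates of the positive
and negative parts add up. -/
lemma BoundingAssumption.exists_hasBound (hB : M.BoundingAssumption p) (hR : M.RealAssumption) :
    ∃ α b, M.HasBound p α b := by
  obtain ⟨α, ε₁, ε₂, b₁, b₂, hα, -, h1, h2, h12, hm1, hm2, hb1, hb2, hst, hN, hdom⟩ := hB.bounds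
  have n1 : ∀ x, 0 ≤ -b₁ x := fun x => by linarith [hb1 x]
  have n2 : ∀ x, 0 ≤ b₂ x := fun x => h2.trans (hb2 x)
  have ofReal_sum : ∀ {s t : ℝ}, 0 ≤ s → 0 ≤ t →
      ENNReal.ofReal t + ENNReal.ofReal s = ENNReal.ofReal (t + s) := fun hs ht =>
    (ENNReal.ofReal_add ht hs).symm
  refine ⟨α, fun x => b₂ x - b₁ x, hα, hm2.sub hm1, fun x => by linarith [hb1 x, hb2 x],
    fun n hn Y hY x a hxa => ?_, fun n hn Y hY x a hxa => ?_, fun x => ?_, fun n hn y hy => ?_⟩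
  · have hc : Measurable fun z => M.c n x a (M.T n x a z) :=
      (hR.measurable_cost hn hxa).comp (M.measurable_T_apply n x a)
    obtain ⟨e1, -, e2, -⟩ := hst n hn Y hY x a hxa
    rw [integral_eq_lintegral_of_nonneg_ae (.of_forall fun _ => abs_nonneg _)
      (hc.norm.aestronglyMeasurable)]
    refine ENNReal.toReal_le_of_le_ofReal (by linarith [n1 x, n2 x]) ?_
    calc ∫⁻ z, ENNReal.ofReal |M.c n x a (M.T n x a z)| ∂(densMeasure (M.P n) Y)
        ≤ ∫⁻ z, (ENNReal.ofReal (M.c n x a (M.T n x a z))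
            + ENNReal.ofReal (-M.c n x a (M.T n x a z))) ∂(densMeasure (M.P n) Y) := by
          refine lintegral_mono fun z => ?_
          rcases abs_cases (M.c n x a (M.T n x a z)) with ⟨h, -⟩ | ⟨h, -⟩ <;> rw [h]
          · exact le_self_add
          · exact le_add_self
      _ ≤ ENNReal.ofReal (b₂ x) + ENNReal.ofReal (-b₁ x) := by
          rw [lintegral_add_left hc.ennreal_ofReal]
          exact add_le_add e2 e1
      _ = ENNReal.ofReal (b₂ x - b₁ x) := by rw [ofReal_sum (n1 x) (n2 x), sub_eq_add_neg]
  · obtain ⟨-, e1, -, e2⟩ := hst n hn Y hY x a hxa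
    have hT := M.measurable_T_apply n x a
    have hm : Measurable fun z => b₂ (M.T n x a z) - b₁ (M.T n x a z) :=
      (hm2.comp hT).sub (hm1.comp hT)
    rw [integral_eq_lintegral_of_nonneg_ae (.of_forall fun z => by
      simp only [Pi.zero_apply]; linarith [n1 (M.T n x a z), n2 (M.T n x a z)])
      hm.aestronglyMeasurable]
    refine ENNReal.toReal_le_of_le_ofReal
      (mul_nonneg hα (by linarith [n1 x, n2 x])) ?_
    calc ∫⁻ z, ENNReal.ofReal (b₂ (M.T n x a z) - b₁ (M.T n x a z)) ∂(densMeasure (M.P n) Y)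
        = ∫⁻ z, (ENNReal.ofReal (b₂ (M.T n x a z))
            + ENNReal.ofReal (-b₁ (M.T n x a z))) ∂(densMeasure (M.P n) Y) := by
          refine lintegral_congr fun z => ?_
          rw [ofReal_sum (n1 _) (n2 _), sub_eq_add_neg]
      _ ≤ ENNReal.ofReal (α * b₂ x) + ENNReal.ofReal (α * -b₁ x) := by
          have hm2' : Measurable fun z => ENNReal.ofReal (b₂ (M.T n x a z)) :=
            (hm2.comp hT).ennreal_ofReal
          rw [lintegral_add_left hm2']
          exact add_le_add e2 e1
      _ = ENNReal.ofReal (α * (b₂ x - b₁ x)) := by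
          rw [ofReal_sum (mul_nonneg hα (n1 x)) (mul_nonneg hα (n2 x))]; congr 1; ring
  · have := hN x
    exact abs_le.2 ⟨by linarith [n2 x], by linarith [n1 x]⟩
  · obtain ⟨s, hs, Θ₁, Θ₂, -, -, hL1, hL2, hle⟩ := hdom n hn y hy
    refine ⟨s, hs, fun z => |Θ₁ z| + |Θ₂ z|, hL1.norm.add hL2.norm, fun x a hxs hxa z => ?_⟩
    obtain ⟨k1, k2⟩ := hle x a hxs hxa z
    exact ⟨by linarith [le_abs_self (Θ₁ z), abs_nonneg (Θ₂ z)],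
      by linarith [le_abs_self (Θ₂ z), abs_nonneg (Θ₁ z)]⟩

namespace StandingAssumptions

variable (hM : M.StandingAssumptions p Ystar) (hn : n < M.N) {α C : ℝ} {b w : ℝ → ℝ}
  (hb : M.HasBound p α b) {x : ℝ} {a : A} (hxa : (x, a) ∈ M.D n)

include hM hn hxa in
lemma measurable_stageCost (hw : Measurable w) : Measurable (M.stageCost n w x a) :=
  ((hM.real.measurable_cost hn hxa).comp (M.measurable_T_apply n x a)).add
    (hw.comp (M.measurable_T_apply n x a))

include hM hn hb hxa

lemma memLp_cost : MemLp (fun z => M.c n x a (M.T n x a z)) p (M.P n) := by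
  obtain ⟨s, hs, Θ, hΘ, hle⟩ := hb.dominated n hn _ hxa
  refine hΘ.mono ((hM.real.measurable_cost hn hxa).comp
    (M.measurable_T_apply n x a)).aestronglyMeasurable (.of_forall fun z => ?_)
  exact ((hle x a (mem_of_mem_nhds hs) hxa z).1).trans (le_abs_self _)

omit hM in
lemma memLp_next (hw : Measurable w) (hC : ∀ x, |w x| ≤ C * b x) :
    MemLp (fun z => w (M.T n x a z)) p (M.P n) := by
  obtain ⟨s, hs, Θ, hΘ, hle⟩ := hb.dominated n hn _ hxa
  have hbT : MemLp (fun z => b (M.T n x a z)) p (M.P n) := by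
    refine hΘ.mono (hb.measurable.comp
      (M.measurable_T_apply n x a)).aestronglyMeasurable (.of_forall fun z => ?_)
    rw [Real.norm_of_nonneg (hb.nonneg _)]
    exact ((hle x a (mem_of_mem_nhds hs) hxa z).2).trans (le_abs_self _)
  refine (hbT.const_mul C).mono (hw.comp
    (M.measurable_T_apply n x a)).aestronglyMeasurable (.of_forall fun z => ?_)
  exact (hC _).trans (le_abs_self _)

lemma memLp_stageCost (hw : Measurable w) (hC : ∀ x, |w x| ≤ C * b x) :
    MemLp (M.stageCost n w x a) p (M.P n) :=
  (hM.memLp_cost hn hb hxa).add (memLp_next hn hb hxa hw hC)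

variable [ENNReal.HolderConjugate p q] {Y : Lp ℝ q (M.P n)}

/-- The bound is assumed only for densities in the ambiguity set. It extends to all dominated ones
because their expectations are at most the spectral risk, which a member of the set attains. -/
lemma integral_abs_cost_le (hY : StopLossLE (M.P n) Y (Ystar n)) :
    ∫ z, |M.c n x a (M.T n x a z)| ∂(densMeasure (M.P n) Y) ≤ b x := by
  have hm : Measurable fun z => |M.c n x a (M.T n x a z)| :=
    ((hM.real.measurable_cost hn hxa).comp (M.measurable_T_apply n x a)).norm
  obtain ⟨Y', hY', e⟩ := hM.exists_spectralRisk_eq hn hm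
  rw [integral_mul_Lp Y hY.isDensity.1]
  refine (hM.integral_mul_le_spectralRisk hn hm (hM.memLp_cost hn hb hxa).norm hY).trans ?_
  rw [e, ← integral_mul_Lp Y' (M.isDensity_Qd n Y' hY').1]
  exact hb.cost_le n hn Y' hY' x a hxa

lemma integral_next_le (hY : StopLossLE (M.P n) Y (Ystar n)) :
    ∫ z, b (M.T n x a z) ∂(densMeasure (M.P n) Y) ≤ α * b x := by
  have hm : Measurable fun z => b (M.T n x a z) :=
    hb.measurable.comp (M.measurable_T_apply n x a)
  obtain ⟨Y', hY', e⟩ := hM.exists_spectralRisk_eq hn hm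
  rw [integral_mul_Lp Y hY.isDensity.1]
  refine (hM.integral_mul_le_spectralRisk hn hm (memLp_next hn hb hxa (C := 1) hb.measurable
    fun x => ?_) hY).trans ?_
  · rw [one_mul, abs_of_nonneg (hb.nonneg x)]
  rw [e, ← integral_mul_Lp Y' (M.isDensity_Qd n Y' hY').1]
  exact hb.next_le n hn Y' hY' x a hxa

lemma abs_integral_stageCost_le (hY : StopLossLE (M.P n) Y (Ystar n)) (hw : Measurable w)
    (hC0 : 0 ≤ C) (hC : ∀ x, |w x| ≤ C * b x) :
    |∫ z, M.stageCost n w x a z ∂(densMeasure (M.P n) Y)| ≤ (1 + C * α) * b x := by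
  have i1 := integrable_densMeasure_of_memLp (hM.memLp_cost hn hb hxa) hY.isDensity.1
  have i2 := integrable_densMeasure_of_memLp (memLp_next hn hb hxa (C := 1) hb.measurable
    fun x => by rw [one_mul, abs_of_nonneg (hb.nonneg x)]) hY.isDensity.1
  calc |∫ z, M.stageCost n w x a z ∂(densMeasure (M.P n) Y)|
      ≤ ∫ z, |M.stageCost n w x a z| ∂(densMeasure (M.P n) Y) := abs_integral_le_integral_abs
    _ ≤ ∫ z, (|M.c n x a (M.T n x a z)| + C * b (M.T n x a z)) ∂(densMeasure (M.P n) Y) := by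
        refine integral_mono (integrable_densMeasure_of_memLp
          (hM.memLp_stageCost hn hb hxa hw hC) hY.isDensity.1).abs
          (i1.abs.add (i2.const_mul C)) fun z => ?_
        exact (abs_add_le _ _).trans (add_le_add_right (hC _) _)
    _ ≤ b x + C * (α * b x) := by
        rw [integral_add i1.abs (i2.const_mul C), integral_const_mul]
        exact add_le_add (hM.integral_abs_cost_le hn hb hxa hY)
          (mul_le_mul_of_nonneg_left (hM.integral_next_le hn hb hxa hY) hC0)
    _ = (1 + C * α) * b x := by ring

end StandingAssumptions

/-! ### The Bellman operator -/

/-- The risk of taking the action `a` in state `x` when the future is valued by `v`. -/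
noncomputable def bellmanObjective (M : Model A Z q) (Ystar : (n : ℕ) → Lp ℝ q (M.P n)) (n : ℕ)
    (v : ℝ → ℝ) (x : ℝ) (a : A) : ℝ :=
  spectralRisk (M.spectrum (Ystar n)) (M.P n) (M.stageCost n v x a)

/-- Monotone lower semicontinuous functions of growth at most `b`. -/
structure IsValueLike (b v : ℝ → ℝ) : Prop where
  mono : Monotone v
  lsc : LowerSemicontinuous v
  bound : ∃ C, 0 ≤ C ∧ ∀ x, |v x| ≤ C * b x

/-- Upper semicontinuity of `D` yields a convergent subsequence of the actions, and lower
semicontinuity keeps the limit in the sublevel set. This gives lower semicontinuity of value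
functions as well as the measurability needed for selections. -/
lemma RealAssumption.isClosed_exists_le [FirstCountableTopology A] (hR : M.RealAssumption)
    (hn : n < M.N) {G : ℝ × A → ℝ} (hG : LowerSemicontinuousOn G (M.D n)) {F : Set A}
    (hF : IsClosed F) (r : ℝ) :
    IsClosed {x | ∃ a ∈ {a | (x, a) ∈ M.D n} ∩ F, G (x, a) ≤ r} := by
  refine IsSeqClosed.isClosed fun xs x hxs hx => ?_
  choose as has hle using hxs
  obtain ⟨a, ha, hcl⟩ := hR.usc_D n hn x xs as hx fun k => (has k).1
  obtain ⟨ψ, hψ, hlim⟩ := hcl.tendsto_subseq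
  refine ⟨a, ⟨ha, hF.mem_of_tendsto hlim (.of_forall fun k => (has _).2)⟩, ?_⟩
  have ht : Tendsto (fun k => (xs (ψ k), as (ψ k))) atTop (𝓝[M.D n] (x, a)) :=
    tendsto_nhdsWithin_iff.2 ⟨(hx.comp hψ.tendsto_atTop).prodMk_nhds hlim,
      .of_forall fun k => (has _).1⟩
  exact lowerSemicontinuousOn_iff_frequently.1 hG _ ha r
    (ht.frequently (Eventually.of_forall fun k => hle (ψ k)).frequently)

/-- Stage costs are lower semicontinuous in state and action, for every disturbance. -/
lemma RealAssumption.eventually_lt_stageCost (hR : M.RealAssumption) (hn : n < M.N) {v : ℝ → ℝ}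
    (hmono : Monotone v) (hlsc : LowerSemicontinuous v) {y : ℝ × A} (hy : y ∈ M.D n) (z : Z)
    {r : ℝ} (hr : r < M.stageCost n v y.1 y.2 z) :
    ∀ᶠ y' in 𝓝[M.D n] y, r < M.stageCost n v y'.1 y'.2 z := by
  set T₀ := M.T n y.1 y.2 z
  set δ := (M.stageCost n v y.1 y.2 z - r) / 2
  have hδ : 0 < δ := half_pos (sub_pos.2 hr)
  -- `T` is only lower semicontinuous, but its minimum with `T₀` converges. Replacing the next state
  -- by this minimum can only lower the cost and the value, as both are increasing.
  have hmin : Tendsto (fun y' : ℝ × A => min (M.T n y'.1 y'.2 z) T₀) (𝓝[M.D n] y) (𝓝 T₀) := by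
    refine tendsto_order.2 ⟨fun s hs => ?_, fun s hs => .of_forall fun y' =>
      (min_le_right _ _).trans_lt hs⟩
    filter_upwards [hR.lsc_T n hn z y hy s hs] with y' h' using lt_min h' hs
  have h1 : ∀ᶠ y' in 𝓝[M.D n] y, v T₀ - δ < v (M.T n y'.1 y'.2 z) := by
    filter_upwards [hmin.eventually (hlsc T₀ (v T₀ - δ) (by linarith))] with y' h'
    exact h'.trans_le (hmono (min_le_left _ _))
  have hpair : Tendsto (fun y' : ℝ × A => (y', min (M.T n y'.1 y'.2 z) T₀)) (𝓝[M.D n] y)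
      (𝓝[M.D n ×ˢ univ] (y, T₀)) := by
    refine tendsto_nhdsWithin_iff.2 ⟨(tendsto_id.mono_left nhdsWithin_le_nhds).prodMk_nhds hmin, ?_⟩
    filter_upwards [self_mem_nhdsWithin] with y' h' using ⟨h', trivial⟩
  have h2 : ∀ᶠ y' in 𝓝[M.D n] y,
      M.c n y.1 y.2 T₀ - δ < M.c n y'.1 y'.2 (M.T n y'.1 y'.2 z) := by
    have hlt : M.c n y.1 y.2 T₀ - δ < M.c n y.1 y.2 T₀ := by linarith
    filter_upwards [hpair.eventually (hR.lsc_c n hn (y, T₀) ⟨hy, trivial⟩ _ hlt),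
      self_mem_nhdsWithin] with y' h' hD
    exact h'.trans_le (hR.mono_c n hn _ _ _ _ _ le_rfl (min_le_left _ _) hD hD)
  filter_upwards [h1, h2] with y' k1 k2
  have e : M.stageCost n v y.1 y.2 z = M.c n y.1 y.2 T₀ + v T₀ := rfl
  have e' : M.stageCost n v y'.1 y'.2 z
    = M.c n y'.1 y'.2 (M.T n y'.1 y'.2 z) + v (M.T n y'.1 y'.2 z) := rfl
  have e'' : 2 * δ = M.stageCost n v y.1 y.2 z - r := by simp only [δ]; ring
  linarith

namespace StandingAssumptions

variable (hM : M.StandingAssumptions p Ystar) (hn : n < M.N) {α : ℝ} {b v : ℝ → ℝ}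
  (hb : M.HasBound p α b) (hv : IsValueLike b v) [ENNReal.HolderConjugate p q]
include hM hn hb hv

/-- Fix the density `Y` that attains the risk at `y`. At nearby points the risk is at least the
expectation under `Y`, and Fatou's lemma under this single measure passes to the limit. -/
lemma lowerSemicontinuousOn_bellmanObjective [FirstCountableTopology A] :
    LowerSemicontinuousOn (fun y : ℝ × A => M.bellmanObjective Ystar n v y.1 y.2) (M.D n) := by
  obtain ⟨C, hC0, hC⟩ := hv.bound
  have hvm := hv.mono.measurable
  rw [lowerSemicontinuousOn_iff_frequently]
  intro y hy r hfreq
  obtain ⟨s, hs, Θ, hΘ, hle⟩ := hb.dominated n hn y hy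
  have hev : ∀ᶠ y' in 𝓝[M.D n] y, y' ∈ M.D n ∧ y' ∈ s := by
    filter_upwards [self_mem_nhdsWithin, mem_nhdsWithin_of_mem_nhds hs] with y' h1 h2 using ⟨h1, h2⟩
  have hfreq' := hfreq.and_eventually hev
  obtain ⟨ys, hys, hprop⟩ := exists_seq_forall_of_frequently hfreq'
  have hD : ∀ k, ys k ∈ M.D n := fun k => (hprop k).2.1
  obtain ⟨Y, hY, e⟩ := hM.exists_spectralRisk_eq hn (hM.measurable_stageCost hn hy hvm)
  have h0 := (M.isDensity_Qd n Y hY).1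
  set m := densMeasure (M.P n) Y
  -- Near `y` the cost is at most `Θ` in absolute value and the future value at most `C * Θ`. So
  -- adding `Θ'` makes the integrands nonnegative, as Fatou's lemma requires.
  set Θ' : Z → ℝ := fun z => (1 + C) * Θ z
  have hΘ' : Integrable Θ' m := integrable_densMeasure_of_memLp (hΘ.const_mul (1 + C)) h0
  have hpos : ∀ y' ∈ M.D n, y' ∈ s → ∀ z, 0 ≤ M.stageCost n v y'.1 y'.2 z + Θ' z := by
    intro y' hy' hys' z
    obtain ⟨k1, k2⟩ := hle y'.1 y'.2 hys' hy' z
    have k3 := (hC (M.T n y'.1 y'.2 z)).trans (mul_le_mul_of_nonneg_left k2 hC0)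
    have e1 : M.stageCost n v y'.1 y'.2 z
      = M.c n y'.1 y'.2 (M.T n y'.1 y'.2 z) + v (M.T n y'.1 y'.2 z) := rfl
    have e2 : Θ' z = Θ z + C * Θ z := by simp only [Θ']; ring
    linarith [neg_abs_le (M.c n y'.1 y'.2 (M.T n y'.1 y'.2 z)),
      neg_abs_le (v (M.T n y'.1 y'.2 z))]
  have hint : ∀ y' ∈ M.D n, Integrable (M.stageCost n v y'.1 y'.2) m := fun y' hy' =>
    integrable_densMeasure_of_memLp (hM.memLp_stageCost hn hb hy' hvm hC) h0
  have hlint : ∀ y' ∈ M.D n, y' ∈ s →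
      ∫⁻ z, ENNReal.ofReal (M.stageCost n v y'.1 y'.2 z + Θ' z) ∂m
        = ENNReal.ofReal (∫ z, M.stageCost n v y'.1 y'.2 z ∂m + ∫ z, Θ' z ∂m) := by
    intro y' hy' hys'
    rw [← integral_add (hint y' hy') hΘ']
    exact (ofReal_integral_eq_lintegral_ofReal ((hint y' hy').add hΘ')
      (.of_forall (hpos y' hy' hys'))).symm
  have hk : ∀ k, ∫ z, M.stageCost n v (ys k).1 (ys k).2 z ∂m ≤ r := fun k => by
    refine le_trans ?_ (hprop k).1
    rw [integral_mul_Lp Y h0]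
    exact hM.integral_mul_le_spectralRisk hn (hM.measurable_stageCost hn (hD k) hvm)
      (hM.memLp_stageCost hn hb (hD k) hvm hC) (hM.stopLossLE hn hY)
  -- Needed to undo `ENNReal.ofReal` after the limit.
  have hr0 : 0 ≤ r + ∫ z, Θ' z ∂m := by
    have : 0 ≤ ∫ z, (M.stageCost n v (ys 0).1 (ys 0).2 z + Θ' z) ∂m :=
      integral_nonneg (hpos _ (hD 0) (hprop 0).2.2)
    rw [integral_add (hint _ (hD 0)) hΘ'] at this
    linarith [hk 0]
  have hfatou : ∫⁻ z, ENNReal.ofReal (M.stageCost n v y.1 y.2 z + Θ' z) ∂m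
      ≤ ENNReal.ofReal (r + ∫ z, Θ' z ∂m) := by
    calc ∫⁻ z, ENNReal.ofReal (M.stageCost n v y.1 y.2 z + Θ' z) ∂m
        ≤ ∫⁻ z, liminf (fun k =>
            ENNReal.ofReal (M.stageCost n v (ys k).1 (ys k).2 z + Θ' z)) atTop ∂m := by
          refine lintegral_mono fun z => le_of_forall_lt_imp_le_of_dense fun c hc => ?_
          have hc' : c = ENNReal.ofReal c.toReal := (ENNReal.ofReal_toReal hc.ne_top).symm
          rw [hc'] at hc ⊢
          have hlt := (ENNReal.ofReal_lt_ofReal_iff_of_nonneg ENNReal.toReal_nonneg).1 hc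
          refine le_liminf_of_le (by isBoundedDefault) ?_
          filter_upwards [hys.eventually (hM.real.eventually_lt_stageCost hn hv.mono hv.lsc hy z
            (sub_lt_iff_lt_add.2 hlt))] with k hk'
          exact ENNReal.ofReal_le_ofReal (sub_lt_iff_lt_add.1 hk').le
      _ ≤ liminf (fun k => ∫⁻ z,
            ENNReal.ofReal (M.stageCost n v (ys k).1 (ys k).2 z + Θ' z) ∂m) atTop :=
          lintegral_liminf_le' fun k => ((hint _ (hD k)).add hΘ').aemeasurable.ennreal_ofReal
      _ ≤ liminf (fun _ : ℕ => ENNReal.ofReal (r + ∫ z, Θ' z ∂m)) atTop := by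
          refine liminf_le_liminf (.of_forall fun k => ?_)
          rw [hlint _ (hD k) (hprop k).2.2]
          exact ENNReal.ofReal_le_ofReal (add_le_add_left (hk k) _)
      _ = ENNReal.ofReal (r + ∫ z, Θ' z ∂m) := liminf_const _
  rw [hlint y hy (mem_of_mem_nhds hs), ENNReal.ofReal_le_ofReal_iff hr0] at hfatou
  have e' : M.bellmanObjective Ystar n v y.1 y.2 = ∫ z, M.stageCost n v y.1 y.2 z ∂m := by
    rw [integral_mul_Lp Y h0]; exact e
  rw [e']
  linarith

end StandingAssumptions

end Model

namespace Model

variable {A Z : Type*} [MeasurableSpace A] [MeasurableSpace Z] {p q : ℝ≥0∞}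
  {M : Model A Z q} {Ystar : (n : ℕ) → Lp ℝ q (M.P n)} {n : ℕ}

/-! ### The Bellman recursion -/

lemma exists_mem_D (M : Model A Z q) (n : ℕ) (x : ℝ) : ∃ a, (x, a) ∈ M.D n := by
  obtain ⟨d, -, hd⟩ := M.exists_selector n
  exact ⟨d x, hd x⟩

/-- The solution of the Bellman equation. -/
noncomputable def bellmanValue (M : Model A Z q) (Ystar : (n : ℕ) → Lp ℝ q (M.P n)) (n : ℕ)
    (x : ℝ) : ℝ :=
  if n < M.N then
    sInf ((fun a => M.bellmanObjective Ystar n (fun y => M.bellmanValue Ystar (n + 1) y) x a) ''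
      {a | (x, a) ∈ M.D n})
  else M.cN x
termination_by M.N - n

lemma bellmanValue_of_lt (hn : n < M.N) (x : ℝ) : M.bellmanValue Ystar n x =
    sInf ((fun a => M.bellmanObjective Ystar n (M.bellmanValue Ystar (n + 1)) x a) ''
      {a | (x, a) ∈ M.D n}) := by
  rw [bellmanValue, if_pos hn]

lemma bellmanValue_horizon (x : ℝ) : M.bellmanValue Ystar M.N x = M.cN x := by
  rw [bellmanValue, if_neg (lt_irrefl _)]

/-- Backward induction over the stages `0, …, N`. -/
lemma backward_induction {N : ℕ} {P : ℕ → Prop} (hN : P N)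
    (hstep : ∀ n < N, P (n + 1) → P n) : ∀ n ≤ N, P n := fun _ hn =>
  Nat.decreasingInduction (motive := fun k _ => P k) (fun k hk => hstep k hk) hN hn

variable [TopologicalSpace A]

namespace StandingAssumptions

variable (hM : M.StandingAssumptions p Ystar) {α : ℝ} {b v : ℝ → ℝ}
  (hb : M.HasBound p α b) [ENNReal.HolderConjugate p q]
include hM hb

section Step

variable [FirstCountableTopology A] (hn : n < M.N)
include hn

lemma exists_isLeast_bellmanObjective (hv : IsValueLike b v) (x : ℝ) :
    ∃ a, (x, a) ∈ M.D n ∧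
      IsLeast ((fun a => M.bellmanObjective Ystar n v x a) '' {a | (x, a) ∈ M.D n})
        (M.bellmanObjective Ystar n v x a) := by
  have hl : LowerSemicontinuousOn (fun a => M.bellmanObjective Ystar n v x a)
      {a | (x, a) ∈ M.D n} :=
    (hM.lowerSemicontinuousOn_bellmanObjective hn hb hv).comp
      (g := fun a => (x, a)) (by fun_prop) fun a ha => ha
  obtain ⟨a, ha, hmin⟩ := hl.exists_isMinOn (M.exists_mem_D n x) (hM.real.compact_D n hn x)
  exact ⟨a, ha, ⟨a, ha, rfl⟩, by rintro _ ⟨a', ha', rfl⟩; exact hmin ha'⟩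

lemma isLeast_bellmanValue (hv : IsValueLike b (M.bellmanValue Ystar (n + 1))) (x : ℝ) :
    IsLeast ((fun a => M.bellmanObjective Ystar n (M.bellmanValue Ystar (n + 1)) x a) ''
      {a | (x, a) ∈ M.D n}) (M.bellmanValue Ystar n x) := by
  obtain ⟨a, -, ha⟩ := hM.exists_isLeast_bellmanObjective hb hn hv x
  rwa [bellmanValue_of_lt hn, ha.csInf_eq]

/-- Monotonicity: as `D` decreases, the minimizer at a larger state is admissible at a smaller one
and costs no more there. Sublevel sets are projections covered by `isClosed_exists_le`, and the
growth constant evolves as `C ↦ 1 + C * α`. -/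
lemma isValueLike_step (hv : IsValueLike b (M.bellmanValue Ystar (n + 1))) :
    IsValueLike b (M.bellmanValue Ystar n) := by
  have hvm := hv.mono.measurable
  obtain ⟨C, hC0, hC⟩ := hv.bound
  have hleast := hM.isLeast_bellmanValue hb hn hv
  refine ⟨fun x x' hxx' => ?_, ?_, 1 + C * α,
    add_nonneg zero_le_one (mul_nonneg hC0 hb.alpha_nonneg), fun x => ?_⟩
  · obtain ⟨⟨a, ha, e⟩, -⟩ := hleast x'
    have ha' : (x, a) ∈ M.D n := hM.real.decreasing_D n hn x x' hxx' ha
    rw [← e]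
    refine ((hleast x).2 ⟨a, ha', rfl⟩).trans ?_
    refine hM.spectralRisk_mono hn (hM.measurable_stageCost hn ha' hvm)
      (hM.memLp_stageCost hn hb ha' hvm hC) (hM.measurable_stageCost hn ha hvm)
      (hM.memLp_stageCost hn hb ha hvm hC) (.of_forall fun z => ?_)
    have hT := hM.real.mono_T n hn x x' a z hxx' ha' ha
    exact add_le_add (hM.real.mono_c n hn x x' a _ _ hxx' hT ha' ha) (hv.mono hT)
  · rw [lowerSemicontinuous_iff_isClosed_preimage]
    intro r
    convert hM.real.isClosed_exists_le hn
      (hM.lowerSemicontinuousOn_bellmanObjective hn hb hv) isClosed_univ r using 1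
    ext x
    constructor
    · intro hx
      obtain ⟨⟨a, ha, e⟩, -⟩ := hleast x
      exact ⟨a, ⟨ha, trivial⟩, e.trans_le hx⟩
    · rintro ⟨a, ha, har⟩
      exact ((hleast x).2 ⟨a, ha.1, rfl⟩).trans har
  · obtain ⟨⟨a, ha, e⟩, -⟩ := hleast x
    obtain ⟨Y, hY, eY⟩ := hM.exists_spectralRisk_eq hn (hM.measurable_stageCost hn ha hvm)
    have : M.bellmanValue Ystar n x = ∫ z, M.stageCost n (M.bellmanValue Ystar (n + 1)) x a z
        ∂(densMeasure (M.P n) Y) := by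
      rw [← e, integral_mul_Lp Y (M.isDensity_Qd n Y hY).1]; exact eY
    rw [this]
    exact hM.abs_integral_stageCost_le hn hb ha (hM.stopLossLE hn hY) hvm hC0 hC

end Step

lemma isValueLike_bellmanValue [FirstCountableTopology A] :
    ∀ n ≤ M.N, IsValueLike b (M.bellmanValue Ystar n) := by
  refine backward_induction ?_ fun n hn h => hM.isValueLike_step hb hn h
  have : M.bellmanValue Ystar M.N = M.cN := funext bellmanValue_horizon
  rw [this]
  exact ⟨hM.real.mono_cN, hM.real.lsc_cN, 1, zero_le_one, fun x => by
    rw [one_mul]; exact hb.terminal_le x⟩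

variable [TopologicalSpace.MetrizableSpace A] [SecondCountableTopology A] [BorelSpace A]

/-- There is a Markov policy that attains the minimum in the Bellman equation at all stages. -/
lemma exists_bellman_policy : ∃ π : M.MarkovPolicy, ∀ n < M.N, ∀ x,
    M.bellmanObjective Ystar n (M.bellmanValue Ystar (n + 1)) x (π.d n x)
      = M.bellmanValue Ystar n x := by
  have key : ∀ n, ∃ d : ℝ → A, Measurable d ∧ (∀ x, (x, d x) ∈ M.D n) ∧
      (n < M.N → ∀ x, M.bellmanObjective Ystar n (M.bellmanValue Ystar (n + 1)) x (d x)
        = M.bellmanValue Ystar n x) := by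
    intro n
    by_cases hn : n < M.N
    swap
    · obtain ⟨d, hd, hd'⟩ := M.exists_selector n
      exact ⟨d, hd, hd', fun h => absurd h hn⟩
    have hv := hM.isValueLike_bellmanValue hb (n + 1) hn
    have hlsc := hM.lowerSemicontinuousOn_bellmanObjective hn hb hv
    have hS : CompactMeasurable fun x => {a | (x, a) ∈ M.D n} := by
      refine ⟨hM.real.compact_D n hn, M.exists_mem_D n, fun F hF => ?_⟩
      convert (hM.real.isClosed_exists_le hn (G := fun _ => 0)
        lowerSemicontinuousOn_const hF 0).measurableSet using 1
      ext x
      exact ⟨fun ⟨a, ha⟩ => ⟨a, ha, le_rfl⟩, fun ⟨a, ha, _⟩ => ⟨a, ha⟩⟩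
    obtain ⟨d, hd, hmin⟩ := (hS.argminOn
      (g := fun x a => M.bellmanObjective Ystar n (M.bellmanValue Ystar (n + 1)) x a)
      (fun x => hlsc.comp (g := fun a => (x, a)) (by fun_prop) fun a ha => ha)
      fun F hF r => (hM.real.isClosed_exists_le hn hlsc hF r).measurableSet).exists_measurable_selection
    refine ⟨d, hd, fun x => (hmin x).1, fun _ x => ?_⟩
    have hleast := hM.isLeast_bellmanValue hb hn hv x
    obtain ⟨a, ha, e⟩ := hleast.1
    exact le_antisymm (e ▸ (hmin x).2 ha) (hleast.2 ⟨d x, (hmin x).1, rfl⟩)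
  choose d hd hdD hdmin using key
  exact ⟨⟨d, hd, hdD⟩, fun n hn => hdmin n hn⟩

end StandingAssumptions

end Model

/-! ### Extending histories by one step -/

section History

variable {A : Type*} [MeasurableSpace A] {n : ℕ}

/-- The history `(h_n, a_n, x_{n+1})`. -/
def History.snoc (h : History A n) (w : A × ℝ) : History A (n + 1) :=
  IicProdIoc (X := Coord A) n (n + 1) (h, MeasurableEquiv.piSingleton (X := Coord A) n w)

lemma History.snoc_of_le (h : History A n) (w : A × ℝ) {k : ℕ} (hk : k ≤ n) :
    h.snoc w ⟨k, Finset.mem_Iic.2 (hk.trans n.le_succ)⟩ = h ⟨k, Finset.mem_Iic.2 hk⟩ :=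
  dif_pos hk

lemma History.snoc_last (h : History A n) (w : A × ℝ) :
    h.snoc w ⟨n + 1, Finset.mem_Iic.2 le_rfl⟩ = w :=
  (dif_neg (by simp : ¬ n + 1 ≤ n)).trans rfl

lemma History.state_snoc (h : History A n) (w : A × ℝ) : (h.snoc w).state = w.2 := by
  rw [History.state, History.snoc_last]

lemma History.measurable_snoc (h : History A n) : Measurable h.snoc :=
  (measurable_IicProdIoc.comp measurable_prodMk_left).comp
    (MeasurableEquiv.piSingleton (X := Coord A) n).measurable

/-- Measurable singletons of histories allow almost sure statements to be read off a Dirac measure.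
-/
instance instMeasurableSingletonClassPrevAct [MeasurableSingletonClass A] :
    ∀ i, MeasurableSingletonClass (PrevAct A i)
  | 0 => (inferInstance : MeasurableSingletonClass PUnit)
  | _ + 1 => (inferInstance : MeasurableSingletonClass A)

end History

namespace Model

variable {A Z : Type*} [MeasurableSpace A] [MeasurableSpace Z] {p q : ℝ≥0∞}
  {M : Model A Z q} {n : ℕ}

lemma Feasible.snoc {h : History A n} (hh : M.Feasible h) {w : A × ℝ}
    (hw : (h.state, w.1) ∈ M.D n) : M.Feasible (h.snoc w) := by
  intro k hk
  rcases Nat.lt_succ_iff_lt_or_eq.1 hk with hk' | rfl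
  · rw [History.snoc_of_le h w hk'.le, History.snoc_of_le h w hk']
    exact hh k hk'
  · rw [History.snoc_of_le h w le_rfl, History.snoc_last]
    exact hw

/-! ### One step of the law of motion -/

section Step

variable (κ : Kernel (History A n) A) [IsMarkovKernel κ] (η : Kernel (History A n × A) Z)
  [IsMarkovKernel η] (h : History A n)

/-- The joint law of the action and the next state. -/
noncomputable def stepMeasure (M : Model A Z q) (κ : Kernel (History A n) A)
    (η : Kernel (History A n × A) Z) (h : History A n) : Measure (A × ℝ) :=
  (κ ⊗ₖ M.stateKernel η) h

lemma stateKernel_apply (a : A) :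
    M.stateKernel η (h, a) = (η (h, a)).map (M.T n h.state a) := by
  rw [stateKernel, Kernel.map_apply _ (M.measurable_transition n), Kernel.prod_apply,
    Kernel.id_apply, Measure.dirac_prod, Measure.map_map (M.measurable_transition n)
      measurable_prodMk_left]
  rfl

lemma lintegral_stepMeasure {F : A × ℝ → ℝ≥0∞} (hF : Measurable F) :
    ∫⁻ w, F w ∂(M.stepMeasure κ η h)
      = ∫⁻ a, ∫⁻ z, F (a, M.T n h.state a z) ∂(η (h, a)) ∂(κ h) := by
  rw [stepMeasure, Kernel.lintegral_compProd _ _ _ hF]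
  refine lintegral_congr fun a => ?_
  have hFa : Measurable fun y => F (a, y) := hF.comp measurable_prodMk_left
  rw [stateKernel_apply, lintegral_map hFa (M.measurable_T_apply n h.state a)]

lemma integral_stepMeasure {F : A × ℝ → ℝ} (hF : Measurable F)
    (hi : Integrable F (M.stepMeasure κ η h)) :
    Integrable (fun a => ∫ z, F (a, M.T n h.state a z) ∂(η (h, a))) (κ h) ∧
    ∫ w, F w ∂(M.stepMeasure κ η h)
      = ∫ a, ∫ z, F (a, M.T n h.state a z) ∂(η (h, a)) ∂(κ h) := by
  have e : ∀ a, ∫ y, F (a, y) ∂(M.stateKernel η (h, a))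
      = ∫ z, F (a, M.T n h.state a z) ∂(η (h, a)) := fun a => by
    have hFa : Measurable fun y => F (a, y) := hF.comp measurable_prodMk_left
    rw [stateKernel_apply, integral_map (M.measurable_T_apply n h.state a).aemeasurable
      hFa.aestronglyMeasurable]
  have h1 := Integrable.integral_compProd (κ := κ) (η := M.stateKernel η) hi
  have h2 := ProbabilityTheory.integral_compProd (κ := κ) (η := M.stateKernel η) hi
  simp_rw [e] at h1 h2
  exact ⟨h1, h2⟩

omit [IsMarkovKernel κ] [IsMarkovKernel η] in
lemma ae_stepMeasure_fst {Q : A → Prop} (hQ : MeasurableSet {a | Q a}) (hae : ∀ᵐ a ∂(κ h), Q a) :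
    ∀ᵐ w ∂(M.stepMeasure κ η h), Q w.1 := by
  refine Kernel.ae_compProd_of_ae_ae (measurable_fst hQ) ?_
  filter_upwards [hae] with a ha using .of_forall fun _ => ha

end Step

/-! ### The law of motion -/

section Law

variable (π : M.RandPolicy) (η : (n : ℕ) → Kernel (History A n × A) Z)
  [∀ n, IsMarkovKernel (η n)] (h : History A n)

/-- The law of the trajectory from time `n` on. -/
noncomputable def law (n : ℕ) (h : History A n) : Measure ((i : ℕ) → Coord A i) :=
  Kernel.traj (fun k => M.stepKernel k (π.ker k) (η k)) n h

instance : IsProbabilityMeasure (law π η n h) :=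
  inferInstanceAs (IsProbabilityMeasure (Kernel.traj _ n h))

lemma partialTraj_succ_apply :
    Kernel.partialTraj (fun k => M.stepKernel k (π.ker k) (η k)) n (n + 1) h
      = (M.stepMeasure (π.ker n) (η n) h).map h.snoc := by
  have hm := (MeasurableEquiv.piSingleton (X := Coord A) n).measurable
  rw [Kernel.partialTraj_succ_self, Kernel.map_apply _ (measurable_IicProdIoc (X := Coord A)), Kernel.prod_apply,
    Kernel.id_apply, Kernel.map_apply _ hm, Measure.dirac_prod,
    Measure.map_map measurable_prodMk_left hm, Measure.map_map
      (measurable_IicProdIoc (X := Coord A)) (measurable_prodMk_left.comp hm)]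
  rfl

/-- The Markov structure of the Ionescu-Tulcea law: run one step, then restart from the longer
history. The tower properties below and all backward inductions on expected costs rest on it. -/
lemma law_eq_comp : law π η n h =
    (Kernel.traj (fun k => M.stepKernel k (π.ker k) (η k)) (n + 1) ∘ₖ
      Kernel.partialTraj (fun k => M.stepKernel k (π.ker k) (η k)) n (n + 1)) h := by
  rw [Kernel.traj_comp_partialTraj n.le_succ, law]

lemma lintegral_law {f : ((i : ℕ) → Coord A i) → ℝ≥0∞} (hf : Measurable f) :
    ∫⁻ ω, f ω ∂(law π η n h)
      = ∫⁻ w, ∫⁻ ω, f ω ∂(law π η (n + 1) (h.snoc w)) ∂(M.stepMeasure (π.ker n) (η n) h) := by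
  rw [law_eq_comp, Kernel.lintegral_comp _ _ _ hf, partialTraj_succ_apply,
    lintegral_map hf.lintegral_kernel h.measurable_snoc]
  rfl

lemma integral_law {f : ((i : ℕ) → Coord A i) → ℝ} (hf : Measurable f)
    (hi : Integrable f (law π η n h)) :
    Integrable (fun w => ∫ ω, f ω ∂(law π η (n + 1) (h.snoc w)))
        (M.stepMeasure (π.ker n) (η n) h) ∧
    ∫ ω, f ω ∂(law π η n h)
      = ∫ w, ∫ ω, f ω ∂(law π η (n + 1) (h.snoc w)) ∂(M.stepMeasure (π.ker n) (η n) h) := by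
  rw [law_eq_comp] at hi
  have hm : StronglyMeasurable fun h' : History A (n + 1) =>
      ∫ ω, f ω ∂(Kernel.traj (fun k => M.stepKernel k (π.ker k) (η k)) (n + 1) h') :=
    hf.stronglyMeasurable.integral_kernel
  have h1 := hi.integral_comp
  rw [partialTraj_succ_apply, integrable_map_measure hm.aestronglyMeasurable
    h.measurable_snoc.aemeasurable] at h1
  refine ⟨h1, ?_⟩
  rw [law_eq_comp, Kernel.integral_comp hi, partialTraj_succ_apply,
    integral_map h.measurable_snoc.aemeasurable hm.aestronglyMeasurable]
  rfl

lemma ae_law {Q : ((i : ℕ) → Coord A i) → Prop} (hQ : MeasurableSet {ω | Q ω})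
    (hae : ∀ᵐ w ∂(M.stepMeasure (π.ker n) (η n) h), ∀ᵐ ω ∂(law π η (n + 1) (h.snoc w)), Q ω) :
    ∀ᵐ ω ∂(law π η n h), Q ω := by
  rw [law_eq_comp]
  refine Kernel.ae_comp_of_ae_ae hQ ?_
  rw [partialTraj_succ_apply, ae_map_iff h.measurable_snoc.aemeasurable]
  · exact hae
  · exact (Kernel.measurable_coe _ hQ.compl) (measurableSet_singleton 0)

/-- The trajectory starts with the given history. -/
lemma ae_law_eq [MeasurableSingletonClass A] :
    ∀ᵐ ω ∂(law π η n h), ∀ k (hk : k ≤ n), ω k = h ⟨k, Finset.mem_Iic.2 hk⟩ := by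
  have hmap : (law π η n h).map (Preorder.frestrictLe n) = Measure.dirac h := by
    rw [law, Kernel.traj_map_frestrictLe_apply, Kernel.partialTraj_self, Kernel.id_apply]
  have hae : ∀ᵐ h' ∂((law π η n h).map (Preorder.frestrictLe n)), h' = h := by
    rw [hmap, ae_dirac_eq]; rfl
  filter_upwards [ae_of_ae_map (Preorder.measurable_frestrictLe n).aemeasurable hae] with ω hω k hk
  exact congrFun hω ⟨k, Finset.mem_Iic.2 hk⟩

omit [∀ n, IsMarkovKernel (η n)] in
lemma ae_mem_D {h : History A n} (hh : M.Feasible h) :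
    ∀ᵐ w ∂(M.stepMeasure (π.ker n) (η n) h), (h.state, w.1) ∈ M.D n := by
  have hm : MeasurableSet {a | (h.state, a) ∈ M.D n} :=
    measurable_prodMk_left (M.measurableSet_D n)
  exact ae_stepMeasure_fst _ _ _ hm ((prob_compl_eq_zero_iff hm).2 (π.admissible n h hh))

end Law

end Model

namespace Model

variable {A Z : Type*} [MeasurableSpace A] [MeasurableSpace Z] {p q : ℝ≥0∞}
  {M : Model A Z q} {Ystar : (n : ℕ) → Lp ℝ q (M.P n)} {n : ℕ}

/-! ### Expected total costs -/

/-- The cost function, extended by zero outside of `D n`. -/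
noncomputable def costExt (M : Model A Z q) (n : ℕ) : (ℝ × A) × ℝ → ℝ :=
  (M.D n ×ˢ univ).indicator fun w => M.c n w.1.1 w.1.2 w.2

lemma costExt_apply {x : ℝ} {a : A} (hxa : (x, a) ∈ M.D n) (y : ℝ) :
    M.costExt n ((x, a), y) = M.c n x a y :=
  indicator_of_mem (s := M.D n ×ˢ univ) (mk_mem_prod hxa (mem_univ y)) _

/-- The total cost, with the cost functions extended by zero outside of `D n`. -/
noncomputable def totalCostExt (M : Model A Z q) (n : ℕ) (ω : (i : ℕ) → Coord A i) : ℝ :=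
  (∑ k ∈ Finset.Ico n M.N, M.costExt k (((ω k).2, (ω (k + 1)).1), (ω (k + 1)).2))
    + M.cN (ω M.N).2

lemma totalCostExt_of_lt (hn : n < M.N) (ω : (i : ℕ) → Coord A i) :
    M.totalCostExt n ω = M.costExt n (((ω n).2, (ω (n + 1)).1), (ω (n + 1)).2)
      + M.totalCostExt (n + 1) ω := by
  rw [totalCostExt, Finset.sum_eq_sum_Ico_succ_bot hn, add_assoc]
  rfl

lemma totalCostExt_horizon (ω : (i : ℕ) → Coord A i) :
    M.totalCostExt M.N ω = M.cN (ω M.N).2 := by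
  simp [totalCostExt]

/-- The rules `η` of nature are given by densities of stop-loss order at most `Ystar`. -/
def DominatedRules (M : Model A Z q) (Ystar : (n : ℕ) → Lp ℝ q (M.P n))
    (η : (n : ℕ) → Kernel (History A n × A) Z) : Prop :=
  ∀ n < M.N, ∀ y, ∃ Y : Lp ℝ q (M.P n), StopLossLE (M.P n) Y (Ystar n) ∧
    η n y = densMeasure (M.P n) Y

lemma measurable_stateAction (k : ℕ) : Measurable fun ω : (i : ℕ) → Coord A i =>
    (((ω k).2, (ω (k + 1)).1) : ℝ × A) :=
  (measurable_snd.comp (measurable_pi_apply k)).prodMk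
    (measurable_fst.comp (measurable_pi_apply (k + 1)) :
      Measurable fun ω : (i : ℕ) → Coord A i => ((ω (k + 1)).1 : A))

section

variable (π : M.RandPolicy) (η : (n : ℕ) → Kernel (History A n × A) Z)
  [∀ n, IsMarkovKernel (η n)]

/-- Backward induction from time `k`: admissibility settles that step, and at earlier times
feasibility passes to almost every one-step extension. -/
lemma ae_law_mem_D [MeasurableSingletonClass A] (k : ℕ) :
    ∀ n ≤ k, ∀ h : History A n, M.Feasible h →
      ∀ᵐ ω ∂(law π η n h), (((ω k).2, (ω (k + 1)).1) : ℝ × A) ∈ M.D k := by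
  have hm : MeasurableSet {ω : (i : ℕ) → Coord A i |
      (((ω k).2, (ω (k + 1)).1) : ℝ × A) ∈ M.D k} :=
    measurable_stateAction k (M.measurableSet_D k)
  refine backward_induction (fun h hh => ?_) fun n hn ih h hh => ?_
  · refine ae_law π η h hm ?_
    filter_upwards [ae_mem_D π η hh] with w hw
    filter_upwards [ae_law_eq π η (h.snoc w)] with ω hω
    rw [hω k k.le_succ, hω (k + 1) le_rfl, History.snoc_of_le h w le_rfl, History.snoc_last]
    exact hw
  · refine ae_law π η h hm ?_
    filter_upwards [ae_mem_D π η hh] with w hw using ih _ (hh.snoc hw)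

/-- Trajectories from a feasible history almost surely use admissible actions only, so the
measurable extension of the costs may replace the original ones. -/
lemma expectedCost_eq_integral [MeasurableSingletonClass A] {h : History A n}
    (hh : M.Feasible h) :
    M.expectedCost π η n h = ∫ ω, M.totalCostExt n ω ∂(law π η n h) := by
  refine integral_congr_ae ?_
  have hae : ∀ᵐ ω ∂(law π η n h), ∀ k, n ≤ k →
      (((ω k).2, (ω (k + 1)).1) : ℝ × A) ∈ M.D k :=
    ae_all_iff.2 fun k => by
      by_cases hk : n ≤ k
      · filter_upwards [ae_law_mem_D π η k n hk h hh] with ω hω _ using hω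
      · exact .of_forall fun ω h => absurd h hk
  filter_upwards [hae] with ω hω
  refine congrArg (· + M.cN (ω M.N).2) (Finset.sum_congr rfl fun k hk => ?_)
  exact (costExt_apply (hω k (Finset.mem_Ico.1 hk).1) _).symm

lemma expectedCost_horizon [MeasurableSingletonClass A] {h : History A M.N} (hh : M.Feasible h) :
    M.expectedCost π η M.N h = M.cN h.state := by
  rw [expectedCost_eq_integral π η hh]
  calc _ = ∫ _, M.cN h.state ∂(law π η M.N h) := by
        refine integral_congr_ae ?_
        filter_upwards [ae_law_eq π η h] with ω hω
        rw [totalCostExt_horizon, hω _ le_rfl]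
        rfl
    _ = _ := by simp

end

variable [TopologicalSpace A] [SecondCountableTopology A] [BorelSpace A]

/-- The costs are lower semicontinuous, hence measurable, only over `D n`. This is the reason for
extending them by zero. -/
lemma RealAssumption.measurable_costExt (hR : M.RealAssumption) (hn : n < M.N) :
    Measurable (M.costExt n) := by
  have hD : MeasurableSet (M.D n ×ˢ (univ : Set ℝ)) := (M.measurableSet_D n).prod .univ
  refine measurable_of_restrict_of_restrict_compl hD ?_ ?_
  · have h1 : Measurable ((M.D n ×ˢ univ).domRestrict fun w : (ℝ × A) × ℝ => M.c n w.1.1 w.1.2 w.2) :=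
      (lowerSemicontinuous_restrict_iff.2 (hR.lsc_c n hn)).measurable
    convert h1 using 1
    exact funext fun w => indicator_of_mem w.2 fun w : (ℝ × A) × ℝ => M.c n w.1.1 w.1.2 w.2
  · convert (measurable_const : Measurable fun _ : ((M.D n ×ˢ (univ : Set ℝ))ᶜ : Set _) => (0 : ℝ))
      using 1
    exact funext fun w => indicator_of_notMem w.2 fun w : (ℝ × A) × ℝ => M.c n w.1.1 w.1.2 w.2

lemma RealAssumption.measurable_totalCostExt (hR : M.RealAssumption) (n : ℕ) :
    Measurable (M.totalCostExt n) := by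
  refine .add (Finset.measurable_sum _ fun k hk => ?_)
    (hR.mono_cN.measurable.comp (measurable_snd.comp (measurable_pi_apply M.N)))
  exact (hR.measurable_costExt (Finset.mem_Ico.1 hk).2).comp ((measurable_stateAction k).prodMk
    (measurable_snd.comp (measurable_pi_apply (k + 1))))

namespace StandingAssumptions

variable (hM : M.StandingAssumptions p Ystar) {α C : ℝ} {b w : ℝ → ℝ}
  (hb : M.HasBound p α b) [ENNReal.HolderConjugate p q] (π : M.RandPolicy)
  {η : (n : ℕ) → Kernel (History A n × A) Z} [∀ n, IsMarkovKernel (η n)]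
  (hη : M.DominatedRules Ystar η)
include hM hb hη

/-- Stated with lower Lebesgue integrals so that it can prove integrability of the total cost rather
than presuppose it. -/
lemma lintegral_step_le (hn : n < M.N) (hC0 : 0 ≤ C) {h : History A n} (hh : M.Feasible h) :
    ∫⁻ w, (‖M.costExt n ((h.state, w.1), w.2)‖ₑ + ENNReal.ofReal (C * b w.2))
        ∂(M.stepMeasure (π.ker n) (η n) h)
      ≤ ENNReal.ofReal ((1 + C * α) * b h.state) := by
  have hm : Measurable fun w : A × ℝ =>
      ‖M.costExt n ((h.state, w.1), w.2)‖ₑ + ENNReal.ofReal (C * b w.2) :=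
    ((hM.real.measurable_costExt hn).comp
      ((measurable_const.prodMk measurable_fst).prodMk measurable_snd)).enorm.add
      ((hb.measurable.comp measurable_snd).const_mul C).ennreal_ofReal
  rw [lintegral_stepMeasure _ _ _ hm]
  have hD : ∀ᵐ a ∂(π.ker n h), (h.state, a) ∈ M.D n :=
    (prob_compl_eq_zero_iff (measurable_prodMk_left (M.measurableSet_D n))).2
      (π.admissible n h hh)
  calc _ ≤ ∫⁻ _, ENNReal.ofReal ((1 + C * α) * b h.state) ∂(π.ker n h) := by
        refine lintegral_mono_ae ?_
        filter_upwards [hD] with a hxa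
        obtain ⟨Y, hY, e⟩ := hη n hn (h, a)
        have i1 := integrable_densMeasure_of_memLp (hM.memLp_cost hn hb hxa) hY.isDensity.1
        have i2 := integrable_densMeasure_of_memLp
          (memLp_next hn hb hxa (C := 1) hb.measurable fun x => by
            rw [one_mul, abs_of_nonneg (hb.nonneg x)]) hY.isDensity.1
        have hpos : ∀ z, 0 ≤ |M.c n h.state a (M.T n h.state a z)| + C * b (M.T n h.state a z) :=
          fun z => add_nonneg (abs_nonneg _) (mul_nonneg hC0 (hb.nonneg _))
        rw [e]
        calc _ = ∫⁻ z, ENNReal.ofReal (|M.c n h.state a (M.T n h.state a z)|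
                + C * b (M.T n h.state a z)) ∂(densMeasure (M.P n) Y) := by
              refine lintegral_congr fun z => ?_
              rw [costExt_apply hxa, ENNReal.ofReal_add (abs_nonneg _)
                (mul_nonneg hC0 (hb.nonneg _)), Real.enorm_eq_ofReal_abs]
          _ = ENNReal.ofReal (∫ z, (|M.c n h.state a (M.T n h.state a z)|
                + C * b (M.T n h.state a z)) ∂(densMeasure (M.P n) Y)) :=
              (ofReal_integral_eq_lintegral_ofReal (i1.abs.add (i2.const_mul C))
                (.of_forall hpos)).symm
          _ ≤ _ := by
              refine ENNReal.ofReal_le_ofReal ?_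
              rw [integral_add i1.abs (i2.const_mul C), integral_const_mul]
              have := mul_le_mul_of_nonneg_left (hM.integral_next_le hn hb hxa hY) hC0
              linarith [hM.integral_abs_cost_le hn hb hxa hY]
    _ = _ := by simp

/-- One step of the law of motion, when the future is valued by `w`. -/
lemma integral_step (hn : n < M.N) (hw : Measurable w) (hC : ∀ x, |w x| ≤ C * b x)
    {h : History A n} (hh : M.Feasible h) :
    Integrable (fun y : A × ℝ => M.costExt n ((h.state, y.1), y.2) + w y.2)
        (M.stepMeasure (π.ker n) (η n) h) ∧
    Integrable (fun a => ∫ z, M.stageCost n w h.state a z ∂(η n (h, a))) (π.ker n h) ∧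
    ∫ y, (M.costExt n ((h.state, y.1), y.2) + w y.2) ∂(M.stepMeasure (π.ker n) (η n) h)
      = ∫ a, ∫ z, M.stageCost n w h.state a z ∂(η n (h, a)) ∂(π.ker n h) := by
  have hm : Measurable fun y : A × ℝ => M.costExt n ((h.state, y.1), y.2) + w y.2 :=
    ((hM.real.measurable_costExt hn).comp
      ((measurable_const.prodMk measurable_fst).prodMk measurable_snd)).add
      (hw.comp measurable_snd)
  have hi : Integrable (fun y : A × ℝ => M.costExt n ((h.state, y.1), y.2) + w y.2)
      (M.stepMeasure (π.ker n) (η n) h) := by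
    refine ⟨hm.aestronglyMeasurable, ?_⟩
    have hC0 : 0 ≤ C := nonneg_of_mul_nonneg_left ((abs_nonneg _).trans (hC 0))
      (zero_lt_one.trans_le (hb.one_le 0))
    refine lt_of_le_of_lt ?_ ((hM.lintegral_step_le hb π hη hn hC0 hh).trans_lt
      ENNReal.ofReal_lt_top)
    refine lintegral_mono fun y => (enorm_add_le _ _).trans (add_le_add_right ?_ _)
    rw [Real.enorm_eq_ofReal_abs]
    exact ENNReal.ofReal_le_ofReal (hC _)
  have hD : ∀ᵐ a ∂(π.ker n h), (h.state, a) ∈ M.D n :=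
    (prob_compl_eq_zero_iff (measurable_prodMk_left (M.measurableSet_D n))).2
      (π.admissible n h hh)
  have hae : (fun a => ∫ z, (M.costExt n ((h.state, a), M.T n h.state a z)
      + w (M.T n h.state a z)) ∂(η n (h, a))) =ᵐ[π.ker n h]
      fun a => ∫ z, M.stageCost n w h.state a z ∂(η n (h, a)) := by
    filter_upwards [hD] with a hxa
    simp_rw [costExt_apply hxa]
    rfl
  obtain ⟨h1, h2⟩ := integral_stepMeasure (π.ker n) (η n) h hm hi
  exact ⟨hi, h1.congr hae, h2.trans (integral_congr_ae hae)⟩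

variable [MeasurableSingletonClass A]

lemma exists_lintegral_totalCostExt_le : ∀ n ≤ M.N, ∃ C, 0 ≤ C ∧ ∀ h : History A n,
    M.Feasible h → ∫⁻ ω, ‖M.totalCostExt n ω‖ₑ ∂(law π η n h)
      ≤ ENNReal.ofReal (C * b h.state) := by
  refine backward_induction ⟨1, zero_le_one, fun h hh => ?_⟩ fun n hn ⟨C, hC0, hC⟩ =>
    ⟨1 + C * α, add_nonneg zero_le_one (mul_nonneg hC0 hb.alpha_nonneg), fun h hh => ?_⟩
  · calc _ ≤ ∫⁻ _, ENNReal.ofReal (1 * b h.state) ∂(law π η M.N h) := by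
          refine lintegral_mono_ae ?_
          filter_upwards [ae_law_eq π η h] with ω hω
          rw [totalCostExt_horizon, hω _ le_rfl, Real.enorm_eq_ofReal_abs, one_mul]
          exact ENNReal.ofReal_le_ofReal (hb.terminal_le _)
      _ = _ := by simp
  · rw [lintegral_law π η h (hM.real.measurable_totalCostExt n).enorm]
    refine le_trans (lintegral_mono_ae ?_) (hM.lintegral_step_le hb π hη hn hC0 hh)
    filter_upwards [ae_mem_D π η hh] with w hw
    have h1 := hC _ (hh.snoc hw)
    rw [History.state_snoc] at h1
    calc _ ≤ ∫⁻ ω, (‖M.costExt n ((h.state, w.1), w.2)‖ₑ + ‖M.totalCostExt (n + 1) ω‖ₑ)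
            ∂(law π η (n + 1) (h.snoc w)) := by
          refine lintegral_mono_ae ?_
          filter_upwards [ae_law_eq π η (h.snoc w)] with ω hω
          rw [totalCostExt_of_lt hn, hω n n.le_succ, hω (n + 1) le_rfl,
            History.snoc_of_le h w le_rfl, History.snoc_last]
          exact enorm_add_le _ _
      _ ≤ _ := by
          rw [lintegral_add_left measurable_const, lintegral_const, measure_univ, mul_one]
          exact add_le_add_right h1 _

lemma integrable_totalCostExt (hn : n ≤ M.N) {h : History A n} (hh : M.Feasible h) :
    Integrable (M.totalCostExt n) (law π η n h) := by
  obtain ⟨C, -, hC⟩ := hM.exists_lintegral_totalCostExt_le hb π hη n hn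
  exact ⟨(hM.real.measurable_totalCostExt n).aestronglyMeasurable,
    (hC h hh).trans_lt ENNReal.ofReal_lt_top⟩

/-- The tower property, after pulling the first stage cost out: given the extended history, it is
almost surely constant. -/
lemma expectedCost_succ (hn : n < M.N) {h : History A n} (hh : M.Feasible h) :
    Integrable (fun w : A × ℝ => M.costExt n ((h.state, w.1), w.2)
      + M.expectedCost π η (n + 1) (h.snoc w)) (M.stepMeasure (π.ker n) (η n) h) ∧
    M.expectedCost π η n h = ∫ w, (M.costExt n ((h.state, w.1), w.2)
      + M.expectedCost π η (n + 1) (h.snoc w)) ∂(M.stepMeasure (π.ker n) (η n) h) := by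
  obtain ⟨h1, h2⟩ := integral_law π η h (hM.real.measurable_totalCostExt n)
    (hM.integrable_totalCostExt hb π hη hn.le hh)
  have hae : (fun w => ∫ ω, M.totalCostExt n ω ∂(law π η (n + 1) (h.snoc w)))
      =ᵐ[M.stepMeasure (π.ker n) (η n) h] fun w : A × ℝ =>
        M.costExt n ((h.state, w.1), w.2) + M.expectedCost π η (n + 1) (h.snoc w) := by
    filter_upwards [ae_mem_D π η hh] with w hw
    rw [expectedCost_eq_integral π η (hh.snoc hw)]
    calc _ = ∫ ω, (M.costExt n ((h.state, w.1), w.2) + M.totalCostExt (n + 1) ω)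
          ∂(law π η (n + 1) (h.snoc w)) := by
          refine integral_congr_ae ?_
          filter_upwards [ae_law_eq π η (h.snoc w)] with ω hω
          rw [totalCostExt_of_lt hn, hω n n.le_succ, hω (n + 1) le_rfl,
            History.snoc_of_le h w le_rfl, History.snoc_last]
          rfl
      _ = _ := by
          rw [integral_add (integrable_const _)
            (hM.integrable_totalCostExt hb π hη hn (hh.snoc hw))]
          simp
  rw [expectedCost_eq_integral π η hh, h2]
  exact ⟨h1.congr hae, integral_congr_ae hae⟩

/-- Comparison of the expected cost with a solution of a Bellman inequality, multiplied by `σ`: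
the signs `σ = ±1` give upper and lower bounds. -/
lemma mul_expectedCost_le {v : ℕ → ℝ → ℝ} (σ : ℝ) (hv : ∀ n ≤ M.N, Measurable (v n))
    (hvC : ∀ n ≤ M.N, ∃ C, ∀ x, |v n x| ≤ C * b x) (hvN : v M.N = M.cN)
    (hstep : ∀ n < M.N, ∀ h : History A n, M.Feasible h → ∀ᵐ a ∂(π.ker n h),
      σ * ∫ z, M.stageCost n (v (n + 1)) h.state a z ∂(η n (h, a)) ≤ σ * v n h.state) :
    ∀ n ≤ M.N, ∀ h : History A n, M.Feasible h →
      σ * M.expectedCost π η n h ≤ σ * v n h.state := by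
  refine backward_induction (fun h hh => ?_) fun n hn ih h hh => ?_
  · rw [expectedCost_horizon π η hh, hvN]
  obtain ⟨C, hC⟩ := hvC (n + 1) hn
  obtain ⟨i1, e1⟩ := hM.expectedCost_succ hb π hη hn hh
  obtain ⟨i2, i3, e2⟩ := hM.integral_step hb π hη hn (hv _ hn) hC hh
  rw [e1]
  -- First the expected future cost is replaced by `v (n + 1)` through the induction hypothesis,
  -- then the one-step inequality is integrated over the randomized action.
  calc _ ≤ σ * ∫ y, (M.costExt n ((h.state, y.1), y.2) + v (n + 1) y.2)
          ∂(M.stepMeasure (π.ker n) (η n) h) := by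
        rw [← integral_const_mul, ← integral_const_mul]
        refine integral_mono_ae (i1.const_mul σ) (i2.const_mul σ) ?_
        filter_upwards [ae_mem_D π η hh] with w hw
        have := ih _ (hh.snoc hw)
        rw [History.state_snoc] at this
        simp only [mul_add]
        linarith
    _ ≤ ∫ _, σ * v n h.state ∂(π.ker n h) := by
        rw [e2, ← integral_const_mul]
        exact integral_mono_ae (i3.const_mul σ) (integrable_const _) (hstep n hn h hh)
    _ = _ := by simp

end StandingAssumptions

end Model

namespace Model

variable {A Z : Type*} [MeasurableSpace A] [MeasurableSpace Z] {p q : ℝ≥0∞}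
  {M : Model A Z q} {Ystar : (n : ℕ) → Lp ℝ q (M.P n)} {n : ℕ}

/-! ### Worst-case rules of nature -/

/-- Markov policies of nature that rearrange the spectrum comonotonically to the next state. -/
def IsWorstCase (M : Model A Z q) (Ystar : (n : ℕ) → Lp ℝ q (M.P n))
    (g : M.MarkovNaturePolicy p) : Prop :=
  ∀ n < M.N, ∀ x a, (x, a) ∈ M.D n → ∃ U, IsDistribTransform (M.P n) (M.T n x a) U ∧
    g.γ n (x, a) =ᵐ[M.P n] fun z => M.spectrum (Ystar n) (U z)

/-- The rules `η` of nature turn the expected stage costs into their spectral risk. -/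
def AttainsRisk (M : Model A Z q) (Ystar : (n : ℕ) → Lp ℝ q (M.P n))
    (η : (n : ℕ) → Kernel (History A n × A) Z) : Prop :=
  ∀ n < M.N, ∀ (h : History A n) (a : A), (h.state, a) ∈ M.D n →
    ∫ z, M.stageCost n (M.bellmanValue Ystar (n + 1)) h.state a z ∂(η n (h, a))
      = M.bellmanObjective Ystar n (M.bellmanValue Ystar (n + 1)) h.state a

lemma expectedCost_congr (π : M.RandPolicy) {η η' : (n : ℕ) → Kernel (History A n × A) Z}
    [∀ n, IsMarkovKernel (η n)] [∀ n, IsMarkovKernel (η' n)] (e : η = η') (h : History A n) :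
    M.expectedCost π η n h = M.expectedCost π η' n h := by
  subst e; rfl

lemma MarkovPolicy.toRand_ker_apply (π : M.MarkovPolicy) (h : History A n) :
    π.toRand.ker n h = Measure.dirac (π.d n h.state) :=
  Kernel.deterministic_apply ((π.measurable_d n).comp History.measurable_state) h

lemma dominatedRules_const {R : ℕ → ProbabilityMeasure Z}
    (hR : ∀ n < M.N, ∃ Y : Lp ℝ q (M.P n), StopLossLE (M.P n) Y (Ystar n) ∧
      (R n : Measure Z) = densMeasure (M.P n) Y) :
    M.DominatedRules Ystar fun n => Kernel.const (History A n × A) (R n : Measure Z) :=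
  fun n hn _ => hR n hn

lemma markovValue_of_lt {g : M.MarkovNaturePolicy p} (π : M.MarkovPolicy) (hn : n < M.N) (x : ℝ) :
    M.markovValue π g n x = ∫ z, M.stageCost n (M.markovValue π g (n + 1)) x (π.d n x) z
      ∂(densMeasure (M.P n) (g.γ n (x, π.d n x))) := by
  rw [markovValue, if_pos hn]; rfl

lemma markovValue_horizon {g : M.MarkovNaturePolicy p} (π : M.MarkovPolicy) :
    M.markovValue π g M.N = M.cN := funext fun x => by
  rw [markovValue, if_neg (lt_irrefl _)]

variable [TopologicalSpace A]

lemma RealAssumption.monotone_cost (hR : M.RealAssumption) (hn : n < M.N) {x : ℝ} {a : A}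
    (hxa : (x, a) ∈ M.D n) : Monotone (M.c n x a) :=
  fun _ _ h => hR.mono_c n hn x x a _ _ le_rfl h hxa hxa

namespace StandingAssumptions

section Stage

variable (hM : M.StandingAssumptions p Ystar) (hn : n < M.N) {x : ℝ} {a : A}
  (hxa : (x, a) ∈ M.D n)
include hM hn hxa

/-- The stage cost is an increasing function of the next state, so the transform `U` of `T n x a` is
one of the stage cost too. One density is thus worst for every increasing `w`. -/
lemma integral_stageCost_eq {w : ℝ → ℝ} (hw : Monotone w) {U : Z → ℝ}
    (hU : IsDistribTransform (M.P n) (M.T n x a) U) {Y : Lp ℝ q (M.P n)} (h0 : 0 ≤ᵐ[M.P n] Y)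
    (hY : Y =ᵐ[M.P n] fun z => M.spectrum (Ystar n) (U z)) :
    ∫ z, M.stageCost n w x a z ∂(densMeasure (M.P n) Y) = M.bellmanObjective Ystar n w x a := by
  rw [integral_mul_Lp Y h0]
  exact (spectralRisk_eq_integral (hU.comp_monotone ((hM.real.monotone_cost hn hxa).add hw))
    hY).symm

lemma integral_stageCost_le [ENNReal.HolderConjugate p q] {α : ℝ} {b w : ℝ → ℝ}
    (hb : M.HasBound p α b) (hw : IsValueLike b w) {Y : Lp ℝ q (M.P n)}
    (hY : StopLossLE (M.P n) Y (Ystar n)) :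
    ∫ z, M.stageCost n w x a z ∂(densMeasure (M.P n) Y) ≤ M.bellmanObjective Ystar n w x a := by
  obtain ⟨C, -, hC⟩ := hw.bound
  rw [integral_mul_Lp Y hY.isDensity.1]
  exact hM.integral_mul_le_spectralRisk hn (hM.measurable_stageCost hn hxa hw.mono.measurable)
    (hM.memLp_stageCost hn hb hxa hw.mono.measurable hC) hY

lemma integral_stageCost_mono [ENNReal.HolderConjugate p q] {α : ℝ} {b : ℝ → ℝ}
    (hb : M.HasBound p α b) {Y : Lp ℝ q (M.P n)} (h0 : 0 ≤ᵐ[M.P n] Y)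
    {w w' : ℝ → ℝ} {C C' : ℝ} (hw : Measurable w)
    (hC : ∀ x, |w x| ≤ C * b x) (hw' : Measurable w') (hC' : ∀ x, |w' x| ≤ C' * b x)
    (hle : ∀ x, w x ≤ w' x) :
    ∫ z, M.stageCost n w x a z ∂(densMeasure (M.P n) Y)
      ≤ ∫ z, M.stageCost n w' x a z ∂(densMeasure (M.P n) Y) :=
  integral_mono (integrable_densMeasure_of_memLp (hM.memLp_stageCost hn hb hxa hw hC) h0)
    (integrable_densMeasure_of_memLp (hM.memLp_stageCost hn hb hxa hw' hC') h0)
    fun _ => add_le_add_right (hle _) _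

end Stage

variable (hM : M.StandingAssumptions p Ystar)
include hM

lemma dominatedRules_nature (g : M.NaturePolicy p) :
    M.DominatedRules Ystar fun n => g.kernel n := fun n hn y =>
  ⟨g.γ n y, hM.stopLossLE hn (g.mem n y), rfl⟩

variable {α : ℝ} {b : ℝ → ℝ} (hb : M.HasBound p α b) [ENNReal.HolderConjugate p q]
include hb

lemma attainsRisk_nature [FirstCountableTopology A] {g : M.MarkovNaturePolicy p}
    (hg : M.IsWorstCase Ystar g) : M.AttainsRisk Ystar fun n => g.toNature.kernel n := by
  intro n hn h a hxa
  obtain ⟨U, hU, hY⟩ := hg n hn h.state a hxa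
  exact hM.integral_stageCost_eq hn hxa (hM.isValueLike_bellmanValue hb (n + 1) hn).mono hU
    (M.isDensity_Qd n _ (g.mem n _)).1 hY

variable [TopologicalSpace.MetrizableSpace A] [SecondCountableTopology A] [BorelSpace A]

section History

variable {η : (n : ℕ) → Kernel (History A n × A) Z} [∀ n, IsMarkovKernel (η n)]
  (hη : M.DominatedRules Ystar η)
include hη

/-- Lower half of the saddle point, the case `σ = -1`: each admissible action incurs its full risk,
which is at least the minimum in the Bellman equation. -/
lemma bellmanValue_le_expectedCost (hw : M.AttainsRisk Ystar η) (π : M.RandPolicy) (hn : n ≤ M.N)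
    {h : History A n} (hh : M.Feasible h) :
    M.bellmanValue Ystar n h.state ≤ M.expectedCost π η n h := by
  have hv := hM.isValueLike_bellmanValue hb
  have := hM.mul_expectedCost_le hb π hη (v := M.bellmanValue Ystar) (-1)
    (fun n hn => (hv n hn).mono.measurable)
    (fun n hn => let ⟨C, _, hC⟩ := (hv n hn).bound; ⟨C, hC⟩) (funext bellmanValue_horizon)
    (fun n hn h hh => by
      have hD : ∀ᵐ a ∂(π.ker n h), (h.state, a) ∈ M.D n :=
        (prob_compl_eq_zero_iff (measurable_prodMk_left (M.measurableSet_D n))).2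
          (π.admissible n h hh)
      filter_upwards [hD] with a ha
      rw [hw n hn h a ha]
      linarith [(hM.isLeast_bellmanValue hb hn (hv (n + 1) hn) h.state).2 ⟨a, ha, rfl⟩])
    n hn h hh
  linarith

/-- Upper half of the saddle point, the case `σ = 1`: no dominated density exceeds the risk. The
Bellman equation is required only at states of feasible histories, since that is all that can be
recovered from optimality of a policy. -/
lemma expectedCost_le_bellmanValue (π : M.MarkovPolicy)
    (hπ : ∀ n < M.N, ∀ h : History A n, M.Feasible h →
      M.bellmanObjective Ystar n (M.bellmanValue Ystar (n + 1)) h.state (π.d n h.state)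
        = M.bellmanValue Ystar n h.state) (hn : n ≤ M.N) {h : History A n} (hh : M.Feasible h) :
    M.expectedCost π.toRand η n h ≤ M.bellmanValue Ystar n h.state := by
  have hv := hM.isValueLike_bellmanValue hb
  have := hM.mul_expectedCost_le hb π.toRand hη (v := M.bellmanValue Ystar) 1
    (fun n hn => (hv n hn).mono.measurable)
    (fun n hn => let ⟨C, _, hC⟩ := (hv n hn).bound; ⟨C, hC⟩) (funext bellmanValue_horizon)
    (fun n hn h hh => by
      have hD : ∀ᵐ a ∂(π.toRand.ker n h), a = π.d n h.state := by
        rw [π.toRand_ker_apply, ae_dirac_eq]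
        rfl
      filter_upwards [hD] with a ha
      obtain ⟨Y, hY, e⟩ := hη n hn (h, a)
      rw [one_mul, one_mul, e, ← hπ n hn h hh, ha]
      exact hM.integral_stageCost_le hn (π.admissible n _) hb (hv (n + 1) hn) hY)
    n hn h hh
  linarith

/-- A Markov policy with optimal values against a worst-case nature solves the Bellman equation in
all reachable states. -/
lemma bellmanObjective_eq_of_expectedCost_eq (hw : M.AttainsRisk Ystar η) (π : M.MarkovPolicy)
    (hπ : ∀ n ≤ M.N, ∀ h : History A n, M.Feasible h →
      M.expectedCost π.toRand η n h = M.bellmanValue Ystar n h.state)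
    (hn : n < M.N) {h : History A n} (hh : M.Feasible h) :
    M.bellmanObjective Ystar n (M.bellmanValue Ystar (n + 1)) h.state (π.d n h.state)
      = M.bellmanValue Ystar n h.state := by
  have hv := hM.isValueLike_bellmanValue hb (n + 1) hn
  obtain ⟨C, -, hC⟩ := hv.bound
  obtain ⟨-, -, e2⟩ := hM.integral_step hb π.toRand hη hn hv.mono.measurable hC hh
  have e3 : ∫ a, ∫ z, M.stageCost n (M.bellmanValue Ystar (n + 1)) h.state a z ∂(η n (h, a))
      ∂(π.toRand.ker n h) = ∫ z, M.stageCost n (M.bellmanValue Ystar (n + 1)) h.state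
        (π.d n h.state) z ∂(η n (h, π.d n h.state)) := by
    rw [π.toRand_ker_apply, integral_dirac]
  -- Both sides become integrals over one step. Their integrands agree because the expected cost
  -- equals `bellmanValue` at the next stage.
  rw [← hw n hn h _ (π.admissible n _), ← e3, ← e2, ← hπ n hn.le h hh,
    (hM.expectedCost_succ hb π.toRand hη hn hh).2]
  refine integral_congr_ae ?_
  filter_upwards [ae_mem_D π.toRand η hh] with w hw
  rw [hπ (n + 1) hn _ (hh.snoc hw), History.state_snoc]

end History

/-! ### The Markovian value function -/

section Markov

omit [TopologicalSpace.MetrizableSpace A] in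
-- Values of arbitrary Markov pairs need not be monotone, so their measurability is derived from
-- that of integrals against the kernel induced by `g`.
lemma markovValue_bound (π : M.MarkovPolicy) (g : M.MarkovNaturePolicy p) : ∀ n ≤ M.N,
    Measurable (M.markovValue π g n) ∧ ∃ C, 0 ≤ C ∧ ∀ x, |M.markovValue π g n x| ≤ C * b x := by
  refine backward_induction ?_ fun n hn ⟨hm, C, hC0, hC⟩ => ⟨?_, 1 + C * α,
    add_nonneg zero_le_one (mul_nonneg hC0 hb.alpha_nonneg), fun x => ?_⟩
  · rw [markovValue_horizon]
    exact ⟨hM.real.mono_cN.measurable, 1, zero_le_one, fun x => by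
      rw [one_mul]; exact hb.terminal_le x⟩
  · have hd : Measurable fun x => (x, π.d n x) := measurable_id.prodMk (π.measurable_d n)
    let κ : Kernel ℝ Z :=
      ⟨fun x => densMeasure (M.P n) (g.γ n (x, π.d n x)), measurable_densMeasure p _
        ((g.measurable_γ n).comp hd) fun x => M.isDensity_Qd n _ (g.mem n _)⟩
    have hκ : IsMarkovKernel κ := ⟨fun x => (M.isDensity_Qd n _ (g.mem n _)).isProbabilityMeasure⟩
    have hT : Measurable fun y : ℝ × Z => M.T n y.1 (π.d n y.1) y.2 :=
      (M.measurable_T n).comp ((hd.comp measurable_fst).prodMk measurable_snd)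
    have hF : Measurable fun y : ℝ × Z => M.costExt n ((y.1, π.d n y.1), M.T n y.1 (π.d n y.1) y.2)
        + M.markovValue π g (n + 1) (M.T n y.1 (π.d n y.1) y.2) :=
      ((hM.real.measurable_costExt hn).comp ((hd.comp measurable_fst).prodMk hT)).add (hm.comp hT)
    convert (hF.stronglyMeasurable.integral_kernel_prod_right' (κ := κ)).measurable using 2 with x
    rw [markovValue_of_lt π hn]
    refine integral_congr_ae (.of_forall fun z => ?_)
    simp only [costExt_apply (π.admissible n x)]
    rfl
  · rw [markovValue_of_lt π hn]
    exact hM.abs_integral_stageCost_le hn hb (π.admissible n x)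
      (hM.stopLossLE hn (g.mem n _)) hm hC0 hC

lemma markovValue_le_bellmanValue (π : M.MarkovPolicy) (hπ : ∀ n < M.N, ∀ x,
    M.bellmanObjective Ystar n (M.bellmanValue Ystar (n + 1)) x (π.d n x)
      = M.bellmanValue Ystar n x) (g : M.MarkovNaturePolicy p) :
    ∀ n ≤ M.N, ∀ x, M.markovValue π g n x ≤ M.bellmanValue Ystar n x := by
  refine backward_induction (fun x => ?_) fun n hn ih x => ?_
  · rw [markovValue_horizon, bellmanValue_horizon]
  · have hv := hM.isValueLike_bellmanValue hb (n + 1) hn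
    obtain ⟨C, -, hC⟩ := hv.bound
    obtain ⟨hm, C', -, hC'⟩ := hM.markovValue_bound hb π g (n + 1) hn
    have hY := g.mem n (x, π.d n x)
    rw [markovValue_of_lt π hn, ← hπ n hn x]
    exact (hM.integral_stageCost_mono hn (π.admissible n x) hb (M.isDensity_Qd n _ hY).1 hm hC'
      hv.mono.measurable hC ih).trans
      (hM.integral_stageCost_le hn (π.admissible n x) hb hv (hM.stopLossLE hn hY))

lemma bellmanValue_le_markovValue {g : M.MarkovNaturePolicy p} (hg : M.IsWorstCase Ystar g)
    (π : M.MarkovPolicy) :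
    ∀ n ≤ M.N, ∀ x, M.bellmanValue Ystar n x ≤ M.markovValue π g n x := by
  refine backward_induction (fun x => ?_) fun n hn ih x => ?_
  · rw [markovValue_horizon, bellmanValue_horizon]
  · have hv := hM.isValueLike_bellmanValue hb (n + 1) hn
    obtain ⟨C, -, hC⟩ := hv.bound
    obtain ⟨hm, C', -, hC'⟩ := hM.markovValue_bound hb π g (n + 1) hn
    have hxa := π.admissible n x
    obtain ⟨U, hU, hY⟩ := hg n hn x _ hxa
    have h0 := (M.isDensity_Qd n _ (g.mem n (x, π.d n x))).1
    rw [markovValue_of_lt π hn]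
    refine le_trans ?_ (hM.integral_stageCost_mono hn hxa hb h0 hv.mono.measurable hC hm hC' ih)
    rw [hM.integral_stageCost_eq hn hxa hv.mono hU h0 hY]
    exact (hM.isLeast_bellmanValue hb hn hv x).2 ⟨_, hxa, rfl⟩

end Markov

/-! ### Values of the robust problem -/

lemma robustValue_eq {g : M.MarkovNaturePolicy p} (hg : M.IsWorstCase Ystar g)
    (π : M.MarkovPolicy) (hπ : ∀ n < M.N, ∀ h : History A n, M.Feasible h →
      M.bellmanObjective Ystar n (M.bellmanValue Ystar (n + 1)) h.state (π.d n h.state)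
        = M.bellmanValue Ystar n h.state) (hn : n ≤ M.N) {h : History A n} (hh : M.Feasible h) :
    M.robustValue p π.toRand n h = (M.bellmanValue Ystar n h.state : EReal) := by
  refine le_antisymm (iSup_le fun g' => EReal.coe_le_coe_iff.2 ?_) ?_
  · exact hM.expectedCost_le_bellmanValue hb (hM.dominatedRules_nature g') π hπ hn hh
  · exact (EReal.coe_le_coe_iff.2 (hM.bellmanValue_le_expectedCost hb
      (hM.dominatedRules_nature g.toNature) (hM.attainsRisk_nature hb hg) π.toRand hn hh)).trans
      (le_iSup (fun g' : M.NaturePolicy p => (M.value π.toRand g' n h : EReal)) g.toNature)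

/-- The Bellman policy bounds the infimum from above. A worst-case rule, as one competitor in the
supremum, bounds every robust value from below. -/
lemma upperValue_eq {g : M.MarkovNaturePolicy p} (hg : M.IsWorstCase Ystar g) (hn : n ≤ M.N)
    {h : History A n} (hh : M.Feasible h) :
    M.upperValue p n h = (M.bellmanValue Ystar n h.state : EReal) := by
  obtain ⟨π, hπ⟩ := hM.exists_bellman_policy hb
  refine le_antisymm ?_ (le_iInf fun π' => ?_)
  · rw [← hM.robustValue_eq hb hg π (fun n hn h _ => hπ n hn h.state) hn hh]
    exact iInf_le _ _
  · exact (EReal.coe_le_coe_iff.2 (hM.bellmanValue_le_expectedCost hb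
      (hM.dominatedRules_nature g.toNature) (hM.attainsRisk_nature hb hg) π' hn hh)).trans
      (le_iSup (fun g' : M.NaturePolicy p => (M.value π' g' n h : EReal)) g.toNature)

lemma J_eq {g : M.MarkovNaturePolicy p} (hg : M.IsWorstCase Ystar g) (hn : n ≤ M.N) :
    M.J p n = M.bellmanValue Ystar n := by
  obtain ⟨π, hπ⟩ := hM.exists_bellman_policy hb
  funext x
  have : (⨅ π : M.MarkovPolicy, ⨆ g : M.MarkovNaturePolicy p, (M.markovValue π g n x : EReal))
      = (M.bellmanValue Ystar n x : EReal) := by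
    refine le_antisymm ?_ (le_iInf fun π' => ?_)
    · exact (iInf_le _ π).trans (iSup_le fun g' => EReal.coe_le_coe_iff.2
        (hM.markovValue_le_bellmanValue hb π hπ g' n hn x))
    · exact (EReal.coe_le_coe_iff.2 (hM.bellmanValue_le_markovValue hb hg π' n hn x)).trans
        (le_iSup (fun g' : M.MarkovNaturePolicy p => (M.markovValue π' g' n x : EReal)) g)
  rw [J, this, EReal.toReal_coe]

lemma isGLB_J {g : M.MarkovNaturePolicy p} (hg : M.IsWorstCase Ystar g) (hn : n < M.N) (x : ℝ) :
    IsGLB {r : ℝ | ∃ a, (x, a) ∈ M.D n ∧ r = spectralRisk (M.spectrum (Ystar n)) (M.P n)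
        (fun z => M.c n x a (M.T n x a z) + M.J p (n + 1) (M.T n x a z))} (M.J p n x) := by
  rw [hM.J_eq hb hg hn.le, hM.J_eq hb hg (Nat.succ_le_of_lt hn)]
  have e : {r : ℝ | ∃ a, (x, a) ∈ M.D n ∧ r = spectralRisk (M.spectrum (Ystar n)) (M.P n)
        (fun z => M.c n x a (M.T n x a z) + M.bellmanValue Ystar (n + 1) (M.T n x a z))}
      = (fun a => M.bellmanObjective Ystar n (M.bellmanValue Ystar (n + 1)) x a) ''
        {a | (x, a) ∈ M.D n} :=
    Set.ext fun r => ⟨fun ⟨a, ha, e⟩ => ⟨a, ha, e.symm⟩, fun ⟨a, ha, e⟩ => ⟨a, ha, e.symm⟩⟩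
  rw [e]
  exact (hM.isLeast_bellmanValue hb hn (hM.isValueLike_bellmanValue hb (n + 1) hn) x).isGLB

lemma isOptimalNature {g : M.MarkovNaturePolicy p} (hg : M.IsWorstCase Ystar g) :
    M.IsOptimalNature g where
  bellman n hn x a hxa := by
    have hv := hM.isValueLike_bellmanValue hb (n + 1) hn
    obtain ⟨U, hU, hY⟩ := hg n hn x a hxa
    rw [hM.J_eq hb hg (Nat.succ_le_of_lt hn)]
    refine ⟨⟨_, g.mem n _, rfl⟩, ?_⟩
    rintro _ ⟨Y, hYm, rfl⟩
    exact (hM.integral_stageCost_le hn hxa hb hv (hM.stopLossLE hn hYm)).trans_eq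
      (hM.integral_stageCost_eq hn hxa hv.mono hU (M.isDensity_Qd n _ (g.mem n _)).1 hY).symm
  value_eq n hn h hh := by
    obtain ⟨π, hπ⟩ := hM.exists_bellman_policy hb
    rw [hM.upperValue_eq hb hg hn hh]
    refine le_antisymm ?_ (le_iInf fun π' => EReal.coe_le_coe_iff.2 ?_)
    · exact (iInf_le _ π.toRand).trans (EReal.coe_le_coe_iff.2
        (hM.expectedCost_le_bellmanValue hb (hM.dominatedRules_nature g.toNature) π
          (fun n hn h _ => hπ n hn h.state) hn hh))
    · exact hM.bellmanValue_le_expectedCost hb (hM.dominatedRules_nature g.toNature)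
        (hM.attainsRisk_nature hb hg) π' hn hh
  attained := by
    obtain ⟨π, hπ⟩ := hM.exists_bellman_policy hb
    refine ⟨π, fun n hn h hh => ?_⟩
    rw [hM.upperValue_eq hb hg hn hh]
    refine ⟨hM.robustValue_eq hb hg π (fun n hn h _ => hπ n hn h.state) hn hh,
      le_antisymm (EReal.coe_le_coe_iff.2 ?_) (EReal.coe_le_coe_iff.2 ?_)⟩
    · exact hM.expectedCost_le_bellmanValue hb (hM.dominatedRules_nature g.toNature) π
        (fun n hn h _ => hπ n hn h.state) hn hh
    · exact hM.bellmanValue_le_expectedCost hb (hM.dominatedRules_nature g.toNature)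
        (hM.attainsRisk_nature hb hg) π.toRand hn hh

end StandingAssumptions

end Model

namespace Model

/-! ### Increasing transition functions -/

section RealDisturbance

variable {A : Type*} [MeasurableSpace A] {p q : ℝ≥0∞} {M : Model A ℝ q}
  {Ystar : (n : ℕ) → Lp ℝ q (M.P n)} {n : ℕ}

/-- Constant rules with densities `φ(U_Z)` are worst-case rules. -/
lemma isWorstCase_constNature
    (hT : ∀ n < M.N, ∀ x a, (x, a) ∈ M.D n → Monotone (M.T n x a)) {U : ℕ → ℝ → ℝ}
    (hU : ∀ n < M.N, IsDistribTransform (M.P n) id (U n)) {Y : (n : ℕ) → M.Qd n}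
    (hY : ∀ n < M.N, ((Y n : Lp ℝ q (M.P n)) : ℝ → ℝ) =ᵐ[M.P n]
      fun z => M.spectrum (Ystar n) (U n z)) :
    M.IsWorstCase Ystar (M.constNature p Y) :=
  fun n hn x a hxa => ⟨U n, (hU n hn).comp_monotone (hT n hn x a hxa), hY n hn⟩

variable [TopologicalSpace A]

namespace StandingAssumptions

variable (hM : M.StandingAssumptions p Ystar) {U : ℕ → ℝ → ℝ}
  (hU : ∀ n < M.N, IsDistribTransform (M.P n) id (U n))
include hM hU

lemma exists_density_rearrangement : ∃ Y : (n : ℕ) → M.Qd n, ∀ n < M.N,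
    ((Y n : Lp ℝ q (M.P n)) : ℝ → ℝ) =ᵐ[M.P n] fun z => M.spectrum (Ystar n) (U n z) := by
  have key : ∀ n, ∃ Y : M.Qd n, n < M.N →
      ((Y : Lp ℝ q (M.P n)) : ℝ → ℝ) =ᵐ[M.P n] fun z => M.spectrum (Ystar n) (U n z) := by
    intro n
    by_cases hn : n < M.N
    · exact ⟨⟨_, hM.toLp_spectrum_comp_mem hn (hU n hn).measurable (hU n hn).uniform⟩,
        fun _ => MemLp.coeFn_toLp (hM.memLp_spectrum_comp hn (hU n hn).measurable
          (hU n hn).uniform)⟩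
    · exact ⟨⟨_, (M.nonempty_Qd n).some_mem⟩, fun h => absurd h hn⟩
  choose Y hY using key
  exact ⟨Y, hY⟩

/-- Densities in `𝔔` need not belong to the ambiguity set. Convex-order domination by `φ(U)` still
gives stop-loss domination by `Ystar`, because both have the same law. -/
lemma exists_stopLossLE_of_mem_coherentSet (hq : 1 ≤ q) {R : ℕ → ProbabilityMeasure ℝ}
    (hR : R ∈ M.coherentSet fun n z => M.spectrum (Ystar n) (U n z)) :
    ∀ n < M.N, ∃ Y : Lp ℝ q (M.P n), StopLossLE (M.P n) Y (Ystar n) ∧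
      (R n : Measure ℝ) = densMeasure (M.P n) Y := by
  intro n hn
  obtain ⟨Y, h0, hcx, e⟩ := hR n hn
  refine ⟨Y, ?_, e⟩
  exact (StopLossLE.rearrangement (hM.isDensity_Ystar hn) (hU n hn).measurable
    (hU n hn).uniform).1 (hcx.stopLossLE ((Lp.memLp Y).integrable hq) h0
      ((hM.isDensity_Ystar hn).rearrangement (hU n hn).measurable (hU n hn).uniform))

end StandingAssumptions

end RealDisturbance

/-! ### The risk-neutral problem under the worst-case measures -/

section RiskNeutral

variable {A Z : Type*} [MeasurableSpace A] [MeasurableSpace Z] {p q : ℝ≥0∞}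
  {M : Model A Z q} {Ystar : (n : ℕ) → Lp ℝ q (M.P n)} {n : ℕ}

lemma riskNeutralValue_eq_value {Y : (n : ℕ) → M.Qd n} {Q : ℕ → ProbabilityMeasure Z}
    (hQ : ∀ n, (Q n : Measure Z) = densMeasure (M.P n) (Y n : Lp ℝ q (M.P n)))
    (π : M.RandPolicy) (h : History A n) :
    M.riskNeutralValue Q π n h = M.value π (M.constNature p Y).toNature n h := by
  refine expectedCost_congr π (funext fun k => Kernel.ext fun y => ?_) h
  rw [Kernel.const_apply, hQ]
  rfl

variable [TopologicalSpace A] [TopologicalSpace.MetrizableSpace A] [SecondCountableTopology A]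
  [BorelSpace A] [ENNReal.HolderConjugate p q]

namespace StandingAssumptions

variable (hM : M.StandingAssumptions p Ystar) {α : ℝ} {b : ℝ → ℝ} (hb : M.HasBound p α b)
  {Y : (n : ℕ) → M.Qd n} (hY : M.IsWorstCase Ystar (M.constNature p Y))
  {Q : ℕ → ProbabilityMeasure Z}
  (hQ : ∀ n, (Q n : Measure Z) = densMeasure (M.P n) (Y n : Lp ℝ q (M.P n)))
include hM hb hY hQ

lemma bellmanValue_le_riskNeutralValue (π : M.RandPolicy) (hn : n ≤ M.N) {h : History A n}
    (hh : M.Feasible h) : M.bellmanValue Ystar n h.state ≤ M.riskNeutralValue Q π n h := by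
  rw [riskNeutralValue_eq_value hQ (p := p)]
  exact hM.bellmanValue_le_expectedCost hb (hM.dominatedRules_nature _)
    (hM.attainsRisk_nature hb hY) π hn hh

/-- Optimality against the constant worst case forces the Bellman equation at all states of feasible
histories, and that gives the optimal robust value. Conversely the risk-neutral value lies between
`bellmanValue` and the robust value. -/
lemma riskNeutralValue_eq_iff (π : M.MarkovPolicy) :
    (∀ n ≤ M.N, ∀ h : History A n, M.Feasible h →
      (M.riskNeutralValue Q π.toRand n h : EReal) = M.upperValue p n h) ↔
    (∀ n ≤ M.N, ∀ h : History A n, M.Feasible h →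
      M.robustValue p π.toRand n h = M.upperValue p n h) := by
  refine ⟨fun H n hn h hh => ?_, fun H n hn h hh => le_antisymm ?_ ?_⟩
  · rw [hM.upperValue_eq hb hY hn hh]
    refine hM.robustValue_eq hb hY π (fun n hn h hh => ?_) hn hh
    refine hM.bellmanObjective_eq_of_expectedCost_eq hb (hM.dominatedRules_nature _)
      (hM.attainsRisk_nature hb hY) π (fun n hn h hh => ?_) hn hh
    have := H n hn h hh
    rw [hM.upperValue_eq hb hY hn hh, EReal.coe_eq_coe_iff,
      riskNeutralValue_eq_value hQ (p := p)] at this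
    exact this
  · rw [← H n hn h hh, riskNeutralValue_eq_value hQ (p := p)]
    exact le_iSup (fun g : M.NaturePolicy p => (M.value π.toRand g n h : EReal)) _
  · rw [hM.upperValue_eq hb hY hn hh]
    exact EReal.coe_le_coe_iff.2 (hM.bellmanValue_le_riskNeutralValue hb hY hQ _ hn hh)

lemma iInf_riskNeutralValue (hn : n ≤ M.N) {h : History A n} (hh : M.Feasible h) :
    (⨅ π : M.RandPolicy, (M.riskNeutralValue Q π n h : EReal)) = M.upperValue p n h ∧
    (⨅ π : M.MarkovPolicy, (M.riskNeutralValue Q π.toRand n h : EReal))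
      = M.upperValue p n h := by
  obtain ⟨π, hπ⟩ := hM.exists_bellman_policy hb
  rw [hM.upperValue_eq hb hY hn hh]
  have hle : (M.riskNeutralValue Q π.toRand n h : EReal) ≤ M.bellmanValue Ystar n h.state := by
    rw [riskNeutralValue_eq_value hQ (p := p)]
    exact EReal.coe_le_coe_iff.2 (hM.expectedCost_le_bellmanValue hb
      (hM.dominatedRules_nature _) π (fun n hn h _ => hπ n hn h.state) hn hh)
  have hge : ∀ π : M.RandPolicy,
      (M.bellmanValue Ystar n h.state : EReal) ≤ M.riskNeutralValue Q π n h := fun π =>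
    EReal.coe_le_coe_iff.2 (hM.bellmanValue_le_riskNeutralValue hb hY hQ π hn hh)
  exact ⟨le_antisymm ((iInf_le _ π.toRand).trans hle) (le_iInf hge),
    le_antisymm ((iInf_le _ π).trans hle) (le_iInf fun π => hge π.toRand)⟩

/-- Only two properties of `S` matter: all its laws have dominated densities, and it contains the
worst-case law `Q`. -/
lemma iInf_iSup_riskNeutralValue {S : Set (ℕ → ProbabilityMeasure Z)}
    (hS : ∀ R ∈ S, ∀ n < M.N, ∃ Y : Lp ℝ q (M.P n), StopLossLE (M.P n) Y (Ystar n) ∧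
      (R n : Measure Z) = densMeasure (M.P n) Y) (hQS : Q ∈ S) (hn : n ≤ M.N) {h : History A n}
    (hh : M.Feasible h) :
    (⨅ π : M.MarkovPolicy, ⨆ R ∈ S, (M.riskNeutralValue R π.toRand n h : EReal))
      = M.upperValue p n h := by
  obtain ⟨π, hπ⟩ := hM.exists_bellman_policy hb
  rw [hM.upperValue_eq hb hY hn hh]
  refine le_antisymm ((iInf_le _ π).trans (iSup₂_le fun R hR => EReal.coe_le_coe_iff.2 ?_))
    (le_iInf fun π' => ?_)
  · exact hM.expectedCost_le_bellmanValue hb (dominatedRules_const (hS R hR)) π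
      (fun n hn h _ => hπ n hn h.state) hn hh
  · exact (EReal.coe_le_coe_iff.2
      (hM.bellmanValue_le_riskNeutralValue hb hY hQ π'.toRand hn hh)).trans
      (le_iSup₂ (f := fun R _ => (M.riskNeutralValue R π'.toRand n h : EReal)) Q hQS)

end StandingAssumptions

end RiskNeutral

end Model

end RobustMDP

/-! ### Proof of the two parts of the main theorem -/

theorem mainTheorem6 {A : Type*} [TopologicalSpace A] [TopologicalSpace.MetrizableSpace A]
    [SecondCountableTopology A] [MeasurableSpace A] [BorelSpace A] [StandardBorelSpace A]
    (p q : ℝ≥0∞) [ENNReal.HolderConjugate p q] (hq : 1 < q) :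
    -- part a)
    (∀ {Z : Type*} [MeasurableSpace Z] (M : RobustMDP.Model A Z q)
      (Ystar : (n : ℕ) → Lp ℝ q (M.P n)), M.StandingAssumptions p Ystar →
      -- the worst-case expectation is a (coherent) spectral risk measure
      (∀ n < M.N,
        RobustMDP.IsSpectrum (M.spectrum (Ystar n)) ∧
        (∀ X : Lp ℝ p (M.P n),
          IntegrableOn (fun u => RobustMDP.lowerQuantile ((M.P n).map X) u *
            M.spectrum (Ystar n) u) (Ioo 0 1) ∧
          IsLUB {r : ℝ | ∃ Y ∈ M.Qd n, r = ∫ z, X z * Y z ∂(M.P n)}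
            (RobustMDP.spectralRisk (M.spectrum (Ystar n)) (M.P n) X)) ∧
        RobustMDP.IsCoherent (fun X : Lp ℝ p (M.P n) =>
          RobustMDP.spectralRisk (M.spectrum (Ystar n)) (M.P n) X)) ∧
      -- the value function, and its Bellman equation in terms of the spectral risk measures
      (∀ n ≤ M.N, ∀ h : RobustMDP.History A n, M.Feasible h →
        M.upperValue p n h = (M.J p n h.state : EReal)) ∧
      (∀ n < M.N, ∀ x, IsGLB
        {r : ℝ | ∃ a, (x, a) ∈ M.D n ∧ r = RobustMDP.spectralRisk (M.spectrum (Ystar n)) (M.P n)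
          (fun z => M.c n x a (M.T n x a z) + M.J p (n + 1) (M.T n x a z))}
        (M.J p n x)) ∧
      -- strategies of the form `φ(U_{T(x,a,Z)})` exist
      (∃ g : M.MarkovNaturePolicy p, ∀ n < M.N, ∀ x a, (x, a) ∈ M.D n →
        ∃ U, RobustMDP.IsDistribTransform (M.P n) (M.T n x a) U ∧
          g.γ n (x, a) =ᵐ[M.P n] fun z => M.spectrum (Ystar n) (U z)) ∧
      -- and every such strategy is optimal
      (∀ g : M.MarkovNaturePolicy p, (∀ n < M.N, ∀ x a, (x, a) ∈ M.D n →
        ∃ U, RobustMDP.IsDistribTransform (M.P n) (M.T n x a) U ∧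
          g.γ n (x, a) =ᵐ[M.P n] fun z => M.spectrum (Ystar n) (U z)) →
        M.IsOptimalNature g)) ∧
    -- part b)
    (∀ (M : RobustMDP.Model A ℝ q) (Ystar : (n : ℕ) → Lp ℝ q (M.P n)),
      M.StandingAssumptions p Ystar →
      (∀ n < M.N, ∀ x a, (x, a) ∈ M.D n →
        Monotone (M.T n x a) ∧ LowerSemicontinuous (M.T n x a)) →
      (∀ n < M.N, ∃ U, RobustMDP.IsDistribTransform (M.P n) id U) ∧
      ∀ U : ℕ → ℝ → ℝ, (∀ n < M.N, RobustMDP.IsDistribTransform (M.P n) id (U n)) →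
        ∃ (Y : (n : ℕ) → M.Qd n) (Q : ℕ → ProbabilityMeasure ℝ),
          (∀ n < M.N, ((Y n : Lp ℝ q (M.P n)) : ℝ → ℝ) =ᵐ[M.P n]
            fun z => M.spectrum (Ystar n) (U n z)) ∧
          (∀ n < M.N, (Q n : Measure ℝ) =
            RobustMDP.densMeasure (M.P n) (fun z => M.spectrum (Ystar n) (U n z))) ∧
          -- the constant action is optimal for nature
          M.IsOptimalNature (M.constNature p Y) ∧
          -- the robust problem is the risk-neutral problem with disturbance laws `Q`
          (∀ n ≤ M.N, ∀ h : RobustMDP.History A n, M.Feasible h →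
            (⨅ π : M.RandPolicy, (M.riskNeutralValue Q π n h : EReal)) = M.upperValue p n h ∧
            (⨅ π : M.MarkovPolicy, (M.riskNeutralValue Q π.toRand n h : EReal))
              = M.upperValue p n h) ∧
          (∀ π : M.MarkovPolicy,
            (∀ n ≤ M.N, ∀ h : RobustMDP.History A n, M.Feasible h →
              (M.riskNeutralValue Q π.toRand n h : EReal) = M.upperValue p n h) ↔
            (∀ n ≤ M.N, ∀ h : RobustMDP.History A n, M.Feasible h →
              M.robustValue p π.toRand n h = M.upperValue p n h)) ∧
          -- and the minimization of the coherent risk measure `sup_{Q ∈ 𝔔} E^Q`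
          (∀ n ≤ M.N, ∀ h : RobustMDP.History A n, M.Feasible h →
            (⨅ π : M.MarkovPolicy, ⨆ R ∈ M.coherentSet (fun n z => M.spectrum (Ystar n) (U n z)),
              (M.riskNeutralValue R π.toRand n h : EReal)) = M.upperValue p n h)) := by
  refine ⟨fun {Z} _ M Ystar hM => ?_, fun M Ystar hM hT => ?_⟩
  · obtain ⟨α, b, hb⟩ := hM.bounding.exists_hasBound hM.real
    obtain ⟨g, hg⟩ := hM.exists_worstCase_nature hq
    refine ⟨fun n hn => ⟨hM.isSpectrum hn, fun X => ⟨?_, ?_⟩, hM.isCoherent hn⟩,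
      fun n hn h hh => ?_, fun n hn x => hM.isGLB_J hb hg hn x, ⟨g, hg⟩,
      fun g hg => hM.isOptimalNature hb hg⟩
    · exact hM.integrableOn_lowerQuantile_mul_spectrum hn (Lp.stronglyMeasurable X).measurable
        (Lp.memLp X)
    · exact (hM.isGreatest_spectralRisk hn (Lp.stronglyMeasurable X).measurable
        (Lp.memLp X)).isLUB
    · rw [hM.upperValue_eq hb hg hn hh, hM.J_eq hb hg hn]
  · obtain ⟨α, b, hb⟩ := hM.bounding.exists_hasBound hM.real
    refine ⟨fun n hn => hM.exists_isDistribTransform hn measurable_id, fun U hU => ?_⟩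
    obtain ⟨Y, hY⟩ := hM.exists_density_rearrangement hU
    have hg := RobustMDP.Model.isWorstCase_constNature (p := p)
      (fun n hn x a h => (hT n hn x a h).1) hU hY
    -- `Q` is built from the members `Y n` of the ambiguity sets, so that it is a probability
    -- measure also at the irrelevant stages `n ≥ N`, where `U n` is unconstrained.
    let Q : ℕ → ProbabilityMeasure ℝ := fun n =>
      ⟨RobustMDP.densMeasure (M.P n) (Y n : Lp ℝ q (M.P n)),
        (M.isDensity_Qd n _ (Y n).2).isProbabilityMeasure⟩
    have hQ : ∀ n, (Q n : Measure ℝ)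
        = RobustMDP.densMeasure (M.P n) (Y n : Lp ℝ q (M.P n)) := fun _ => rfl
    -- `Y n` equals `φ(U n)` almost everywhere, so the convex-order inequality holds with equality.
    have hQS : Q ∈ M.coherentSet fun n z => M.spectrum (Ystar n) (U n z) := fun n hn =>
      ⟨Y n, (M.isDensity_Qd n _ (Y n).2).1, fun f _ _ _ =>
        (integral_congr_ae ((hY n hn).fun_comp f)).le, rfl⟩
    refine ⟨Y, Q, hY, fun n hn => ?_, hM.isOptimalNature hb hg,
      fun n hn h hh => hM.iInf_riskNeutralValue hb hg hQ hn hh,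
      hM.riskNeutralValue_eq_iff hb hg hQ, fun n hn h hh =>
        hM.iInf_iSup_riskNeutralValue hb hg hQ (fun R hR =>
          hM.exists_stopLossLE_of_mem_coherentSet hU hq.le hR) hQS hn hh⟩
    rw [hQ]
    exact withDensity_congr_ae ((hY n hn).fun_comp ENNReal.ofReal)
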